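/- Let $n\ge 1$, $\epsilon_1=\epsilon_2=1$, $\epsilon_3=-1$; let $(i,j,k)$ denote any cyclic permutation of $(1,2,3)$ and $s,t,r\in\{1,2,3\}$. A para 3-Sasakian manifold is a smooth $(4n+3)$-dimensional manifold $M$ with a pseudo-Riemannian metric $g$ of signature $(2n+1,2n+2)$, with Levi-Civita connection $\nabla^g$, and three Killing vector fields $\xi_1,\xi_2,\xi_3$ such that $g(\xi_s,\xi_t)=-\epsilon_s\delta_{st}$, $[\xi_i,\xi_j]=2\epsilon_k\xi_k$, and the endomorphisms $\Phi_iB=\nabla^g_B\xi_i$ satisfy $(\nabla^g_A\Phi_i)B=g(\xi_i,B)A-g(A,B)\xi_i$. Put $\eta_s(A)=-\epsilon_s g(A,\xi_s)$, $H=\bigcap_s\ker\eta_s$, $V=\mathrm{span}\{\xi_1,\xi_2,\xi_3\}$, $I_s=\Phi_s|_H$, and $\omega_s(X,Y)=g(I_sX,Y)$ on $H$, extended by $0$ on $V$. Below, $X,Y,Z,W\in H$, the subscripts $_H,{}_V$ are the projections for $TM=H\oplus V$, and $d\eta(A,B)=A\eta(B)-B\eta(A)-\eta([A,B])$. Then these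 data form a paraquaternionic contact (pqc) structure with Reeb fields $\xi_s$: $g|_H$ has signature $(2n,2n)$, the $I_s$ preserve $H$, and $I_s^2=\epsilon_s$, $I_iI_j=-I_jI_i=-\epsilon_kI_k$, $g(I_sX,I_sY)=-\epsilon_sg(X,Y)$, $d\eta_s(X,Y)=-2\epsilon_sg(I_sX,Y)$, $\eta_s(\xi_t)=\delta_{st}$, $d\eta_s(\xi_s,X)=0$, $d\eta_i(\xi_j,X)=\epsilon_kd\eta_j(\xi_i,X)$. The structure equations are $$d\eta_s(\xi_t,X)=d\eta_s(\xi_t,\xi_s)=0,\qquad d\eta_i(\xi_j,\xi_k)=-2\epsilon_i,$$ $$d\eta_i=-2\epsilon_i\omega_i-2\epsilon_i\,\eta_j\wedge\eta_k,\qquad d\omega_i=2\epsilon_j\,\omega_j\wedge\eta_k-2\epsilon_k\,\omega_k\wedge\eta_j .$$ There is a unique connection $\nabla$ on $TM$ (the canonical pqc connection), with torsion $T$, such that: $\nabla$ preserves $H$, $V$, the metric $g|_H$ and the bundle $\mathrm{span}\{I_1,I_2,I_3\}$; $T(X,Y)=-[X,Y]_V$; for $\xi\in V$ the endomorphism $T(\xi,\cdot)_H$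 of $H$ is orthogonal to $sp(n,\mathbb R)\oplus sp(1,\mathbb R)$ for $\langle A,B\rangle=\sum_a g(e_a,e_a)g(Ae_a,Be_a)$, where $sp(n,\mathbb R)$ consists of the $g$-skew endomorphisms of $H$ commuting with all $I_s$, $sp(1,\mathbb R)=\mathrm{span}\{I_1,I_2,I_3\}$, and $(e_a)$ is an orthonormal basis of $H$; and $\nabla\varphi=0$ for the identification $\varphi:V\to sp(1,\mathbb R)$, $\xi_s\mapsto I_s$. Let $T^0$ and $T^a$ be the parts of $T(\xi,X,Y)=g(T(\xi,X),Y)$ that are symmetric and skew-symmetric in $X,Y$, let $\tau(X,Y)=-\sum_s\epsilon_sT^0(\xi_s,I_sX,Y)$ and $\mu_s(X,Y)=\epsilon_sT^a(\xi_s,I_sX,Y)$ (so that $\mu=\mu_1=\mu_2=\mu_3$). With $R(A,B)C=\nabla_A\nabla_BC-\nabla_B\nabla_AC-\nabla_{[A,B]}C$, $R(A,B,C,D)=g(R(A,B)C,D)$, and likewise $R^g$ for $\nabla^g$, and with the convention that a repeated $e_a$ means summation with weights $g(e_a,e_a)$, let $$\rho_s(B,C)=\tfrac1{4n}R(B,C,e_a,I_se_a),\quad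 \zeta_s(B,C)=\tfrac1{4n}R(e_a,B,C,I_se_a),\quad \varrho_s(B,C)=\tfrac1{4n}R(e_a,I_se_a,B,C),$$ $$Ric(B,C)=R(e_a,B,C,e_a),\qquad Scal=Ric(e_a,e_a).$$ Then: 1. The torsion endomorphism vanishes: $T(\xi,X)=0$ for $\xi\in V$, and $\tau=0$, $\mu_1=\mu_2=\mu_3=0$. 2. The structure is pqc-Einstein, $Ric(X,Y)=\frac{Scal}{4n}g(X,Y)$, with $Scal=16n(n+2)$. 3. $\rho_s(X,Y)=\varrho_s(X,Y)=-2\zeta_s(X,Y)=-2\omega_s(X,Y)$ and $Ric(\xi_s,X)=\rho_s(\xi_t,X)=\zeta_s(\xi_t,X)=\rho_s(\xi_t,\xi_r)=0$. 4. The curvatures $R$ and $R^g$ are related by $$R(X,Y,Z,W)=R^g(X,Y,Z,W)+\sum_{s=1}^3\epsilon_s\big[\omega_s(X,Z)\omega_s(Y,W)-\omega_s(Y,Z)\omega_s(X,W)+2\omega_s(X,Y)\omega_s(Z,W)\big],$$ $$R(\xi_s,Y,Z,W)=R^g(\xi_s,Y,Z,W)=0,\qquad R(\xi_s,\xi_t,Z,W)=R^g(\xi_s,\xi_t,Z,W)=R^g(Z,W,\xi_s,\xi_t)=0.$$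 -/

import Mathlib

open scoped Manifold ContDiff

noncomputable section

namespace Pqc

/-- The model space of a manifold of dimension `4n+3`. -/
abbrev Model (n : ℕ) : Type := EuclideanSpace ℝ (Fin (4 * n + 3))

/-- The numbers `ε₁ = ε₂ = 1`, `ε₃ = -1`. The indices `1, 2, 3` are `0, 1, 2 : Fin 3`, so that the
cyclic permutations `(i, j, k)` of `(1, 2, 3)` are the triples `(i, i + 1, i + 2)` in `Fin 3`. -/
def eps : Fin 3 → ℝ := ![1, 1, -1]

section Tensors

variable (n : ℕ) (M : Type*) [TopologicalSpace M] [ChartedSpace (Model n) M]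
  [IsManifold 𝓘(ℝ, Model n) ∞ M]

/-- (Rough) vector fields. -/
abbrev VField : Type _ := Π x : M, TangentSpace 𝓘(ℝ, Model n) x

/-- (Rough) 1-forms. -/
abbrev OneForm : Type _ := Π x : M, TangentSpace 𝓘(ℝ, Model n) x →L[ℝ] ℝ

/-- (Rough) fields of bilinear forms. -/
abbrev TwoTensor : Type _ :=
  Π x : M, TangentSpace 𝓘(ℝ, Model n) x →L[ℝ] TangentSpace 𝓘(ℝ, Model n) x →L[ℝ] ℝ

/-- (Rough) 2-forms, and other fields of scalar functions of two tangent vectors. -/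
abbrev TwoForm : Type _ :=
  Π x : M, TangentSpace 𝓘(ℝ, Model n) x → TangentSpace 𝓘(ℝ, Model n) x → ℝ

/-- (Rough) fields of endomorphisms of the tangent spaces. -/
abbrev EndField : Type _ :=
  Π x : M, TangentSpace 𝓘(ℝ, Model n) x →L[ℝ] TangentSpace 𝓘(ℝ, Model n) x

/-- Affine connections: `D B x a` is `(D_a B)(x)`. -/
abbrev Connection : Type _ :=
  CovariantDerivative 𝓘(ℝ, Model n) (Model n)
    (fun x : M ↦ TangentSpace 𝓘(ℝ, Model n) x)

end Tensors

variable {n : ℕ} {M : Type*} [TopologicalSpace M] [ChartedSpace (Model n) M]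
  [IsManifold 𝓘(ℝ, Model n) ∞ M]

/-- The vector field `A` is differentiable at `x`. -/
def DiffAt (A : VField n M) (x : M) : Prop :=
  MDifferentiableAt 𝓘(ℝ, Model n) (𝓘(ℝ, Model n).prod 𝓘(ℝ, Model n))
    (fun y ↦ Bundle.TotalSpace.mk' (Model n) (E := fun y : M ↦ TangentSpace 𝓘(ℝ, Model n) y)
      y (A y)) x

def SmoothField (A : VField n M) : Prop :=
  ContMDiff 𝓘(ℝ, Model n) (𝓘(ℝ, Model n).prod 𝓘(ℝ, Model n)) ∞
    (fun y ↦ Bundle.TotalSpace.mk' (Model n) (E := fun y : M ↦ TangentSpace 𝓘(ℝ, Model n) y)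
      y (A y))

def SmoothOneForm (α : OneForm n M) : Prop :=
  ContMDiff 𝓘(ℝ, Model n) (𝓘(ℝ, Model n).prod 𝓘(ℝ, Model n →L[ℝ] ℝ)) ∞
    (fun y ↦ Bundle.TotalSpace.mk' (Model n →L[ℝ] ℝ)
      (E := fun y : M ↦ TangentSpace 𝓘(ℝ, Model n) y →L[ℝ] ℝ) y (α y))

def SmoothTwoTensor (g : TwoTensor n M) : Prop :=
  ContMDiff 𝓘(ℝ, Model n) (𝓘(ℝ, Model n).prod 𝓘(ℝ, Model n →L[ℝ] Model n →L[ℝ] ℝ)) ∞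
    (fun y ↦ Bundle.TotalSpace.mk' (Model n →L[ℝ] Model n →L[ℝ] ℝ)
      (E := fun y : M ↦ TangentSpace 𝓘(ℝ, Model n) y →L[ℝ] TangentSpace 𝓘(ℝ, Model n) y →L[ℝ] ℝ)
      y (g y))

def SmoothEndField (J : EndField n M) : Prop :=
  ContMDiff 𝓘(ℝ, Model n) (𝓘(ℝ, Model n).prod 𝓘(ℝ, Model n →L[ℝ] Model n)) ∞
    (fun y ↦ Bundle.TotalSpace.mk' (Model n →L[ℝ] Model n)
      (E := fun y : M ↦ TangentSpace 𝓘(ℝ, Model n) y →L[ℝ] TangentSpace 𝓘(ℝ, Model n) y)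
      y (J y))

/-- The derivative of the function `f` in the direction of the tangent vector `u`. -/
def dirDeriv (f : M → ℝ) (x : M) (u : TangentSpace 𝓘(ℝ, Model n) x) : ℝ :=
  mvfderiv 𝓘(ℝ, Model n) f x u

/-- The Lie bracket `[A, B]` of vector fields. -/
def bracket (A B : VField n M) : VField n M :=
  VectorField.mlieBracket 𝓘(ℝ, Model n) A B

/-- A vector field with prescribed value at `x`, smooth near `x`. The expressions below in which it
is used are tensorial, so that they do not depend on the choice of the extension. -/
def ext {x : M} (u : TangentSpace 𝓘(ℝ, Model n) x) : VField n M :=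
  FiberBundle.extend (Model n) u

/-- `dα(A, B) = A α(B) - B α(A) - α([A, B])`. -/
def extDeriv₁ (α : OneForm n M) (x : M) (u v : TangentSpace 𝓘(ℝ, Model n) x) : ℝ :=
  dirDeriv (fun y ↦ α y (ext v y)) x u - dirDeriv (fun y ↦ α y (ext u y)) x v
    - α x (bracket (ext u) (ext v) x)

/-- `dσ(A, B, C)` is the cyclic sum of `A σ(B, C) - σ([A, B], C)`. -/
def extDeriv₂ (σ : TwoForm n M) (x : M) (u v w : TangentSpace 𝓘(ℝ, Model n) x) : ℝ :=
  (dirDeriv (fun y ↦ σ y (ext v y) (ext w y)) x u - σ x (bracket (ext u) (ext v) x) w)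
  + (dirDeriv (fun y ↦ σ y (ext w y) (ext u y)) x v - σ x (bracket (ext v) (ext w) x) u)
  + (dirDeriv (fun y ↦ σ y (ext u y) (ext v y)) x w - σ x (bracket (ext w) (ext u) x) v)

/-- The curvature operator `R(A, B)C = D_A D_B C - D_B D_A C - D_{[A, B]} C`. -/
def curvOp (D : Connection n M) (x : M) (u v w : TangentSpace 𝓘(ℝ, Model n) x) :
    TangentSpace 𝓘(ℝ, Model n) x :=
  D (fun y ↦ D (ext w) y (ext v y)) x u - D (fun y ↦ D (ext w) y (ext u y)) x v
    - D (ext w) x (bracket (ext u) (ext v) x)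

/-- The curvature of type (0,4): `R(A, B, C, D) = g(R(A, B)C, D)`. -/
def curv (g : TwoTensor n M) (D : Connection n M) (x : M)
    (u v w z : TangentSpace 𝓘(ℝ, Model n) x) : ℝ :=
  g x (curvOp D x u v w) z

/-- `(α ∧ β)(u, v)` for 1-forms. -/
def wedge₁₁ (α β : OneForm n M) (x : M) (u v : TangentSpace 𝓘(ℝ, Model n) x) : ℝ :=
  α x u * β x v - α x v * β x u

/-- `(σ ∧ β)(u, v, w)` for a 2-form `σ` and a 1-form `β`. -/
def wedge₂₁ (σ : TwoForm n M) (β : OneForm n M) (x : M)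
    (u v w : TangentSpace 𝓘(ℝ, Model n) x) : ℝ :=
  σ x u v * β x w + σ x v w * β x u + σ x w u * β x v

/-! ### Para 3-Sasakian manifolds -/

/-- `g` is a pseudo-Riemannian metric of signature `(2n+1, 2n+2)`. -/
structure IsMetric (g : TwoTensor n M) : Prop where
  smooth : SmoothTwoTensor g
  symm : ∀ x u v, g x u v = g x v u
  signature : ∀ x : M,
    ∃ b : Module.Basis (Fin (2 * n + 1) ⊕ Fin (2 * n + 2)) ℝ (TangentSpace 𝓘(ℝ, Model n) x),
      ∀ p q, g x (b p) (b q) = if p = q then Sum.elim (fun _ ↦ 1) (fun _ ↦ -1) p else 0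

/-- `D` is the Levi-Civita connection of `g`. -/
structure IsLeviCivita (g : TwoTensor n M) (D : Connection n M) : Prop where
  smooth : CovariantDerivative.ContMDiffCovariantDerivative D ∞
  torsion_free : ∀ x u v, D.torsion x u v = 0
  metric : ∀ (x : M) (u : TangentSpace 𝓘(ℝ, Model n) x) (A B : VField n M),
    DiffAt A x → DiffAt B x →
      dirDeriv (fun y ↦ g y (A y) (B y)) x u = g x (D A x u) (B x) + g x (A x) (D B x u)

/-- `ξ` is a Killing vector field: the Lie derivative of `g` along `ξ` vanishes. -/
def IsKilling (g : TwoTensor n M) (ξ : VField n M) : Prop :=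
  ∀ (x : M) (A B : VField n M), DiffAt A x → DiffAt B x →
    dirDeriv (fun y ↦ g y (A y) (B y)) x (ξ x)
      - g x (bracket ξ A x) (B x) - g x (A x) (bracket ξ B x) = 0

/-- The para 3-Sasakian structure on `M` with metric `g`, Levi-Civita connection `D` and
characteristic Killing fields `ξ₁, ξ₂, ξ₃`; the endomorphism `Φ_s B = D_B ξ_s` is `D (ξ s)`. -/
structure IsPara3Sasakian (g : TwoTensor n M) (D : Connection n M) (ξ : Fin 3 → VField n M) :
    Prop where
  metric : IsMetric g
  leviCivita : IsLeviCivita g D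
  smooth : ∀ s, SmoothField (ξ s)
  killing : ∀ s, IsKilling g (ξ s)
  orthogonal : ∀ s t x, g x (ξ s x) (ξ t x) = if s = t then -eps s else 0
  commutator : ∀ (i : Fin 3) (x : M),
    bracket (ξ i) (ξ (i + 1)) x = (2 * eps (i + 2)) • ξ (i + 2) x
  covDeriv : ∀ (i : Fin 3) (x : M) (u : TangentSpace 𝓘(ℝ, Model n) x) (B : VField n M),
    DiffAt B x →
      D (fun y ↦ D (ξ i) y (B y)) x u - D (ξ i) x (D B x u)
        = g x (ξ i x) (B x) • u - g x u (B x) • ξ i x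

/-! ### Paraquaternionic contact structures -/

/-- The data of a pqc structure with globally defined contact form `η = (η₁, η₂, η₃)`: the
(extended) metric `g`, the 1-forms `η_s`, the vector fields `ξ_s` and the endomorphisms `I_s`.
Of `I_s` only the restriction to the horizontal distribution is ever used. -/
structure PqcData (n : ℕ) (M : Type*) [TopologicalSpace M] [ChartedSpace (Model n) M]
    [IsManifold 𝓘(ℝ, Model n) ∞ M] where
  g : TwoTensor n M
  η : Fin 3 → OneForm n M
  ξ : Fin 3 → VField n M
  I : Fin 3 → EndField n M

namespace PqcData

variable (S : PqcData n M)

/-- The horizontal distribution, the common kernel of the `η_s`. -/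
def H (x : M) : Submodule ℝ (TangentSpace 𝓘(ℝ, Model n) x) :=
  ⨅ s, LinearMap.ker (S.η s x).toLinearMap

/-- The vertical distribution, spanned by the `ξ_s`. -/
def V (x : M) : Submodule ℝ (TangentSpace 𝓘(ℝ, Model n) x) :=
  Submodule.span ℝ (Set.range fun s ↦ S.ξ s x)

/-- The projection on the vertical distribution along the horizontal one. -/
def projV (x : M) : TangentSpace 𝓘(ℝ, Model n) x →L[ℝ] TangentSpace 𝓘(ℝ, Model n) x :=
  ∑ s, (S.η s x).smulRight (S.ξ s x)

/-- The projection on the horizontal distribution along the vertical one. -/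
def projH (x : M) : TangentSpace 𝓘(ℝ, Model n) x →L[ℝ] TangentSpace 𝓘(ℝ, Model n) x :=
  ContinuousLinearMap.id ℝ _ - S.projV x

/-- The fundamental 2-form `ω_s(X, Y) = g(I_s X, Y)` for horizontal `X, Y`, extended by zero. -/
def omega (s : Fin 3) : TwoForm n M := fun x u v ↦
  S.g x (S.I s x (S.projH x u)) (S.projH x v)

/-- A `g`-orthonormal basis of the horizontal space at `x`, with signature `(2n, 2n)`. -/
def IsFrame (x : M) (e : Fin (2 * n) ⊕ Fin (2 * n) → TangentSpace 𝓘(ℝ, Model n) x) : Prop :=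
  (∀ a, e a ∈ S.H x) ∧
    ∀ a b, S.g x (e a) (e b) = if a = b then Sum.elim (fun _ ↦ 1) (fun _ ↦ -1) a else 0

/-- The contraction `P(e_a, e_a)`, which is by convention `∑ g(e_a, e_a) P(e_a, e_a)`. -/
def contr {x : M} (e : Fin (2 * n) ⊕ Fin (2 * n) → TangentSpace 𝓘(ℝ, Model n) x)
    (P : TangentSpace 𝓘(ℝ, Model n) x → TangentSpace 𝓘(ℝ, Model n) x → ℝ) : ℝ :=
  ∑ a, S.g x (e a) (e a) * P (e a) (e a)

/-- The endomorphism `B`, considered on the horizontal space at `x`, lies in `sp(n, ℝ)`. -/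
def IsSpn (x : M) (B : TangentSpace 𝓘(ℝ, Model n) x →ₗ[ℝ] TangentSpace 𝓘(ℝ, Model n) x) : Prop :=
  (∀ X ∈ S.H x, B X ∈ S.H x) ∧
  (∀ X ∈ S.H x, ∀ Y ∈ S.H x, S.g x (B X) Y = -S.g x X (B Y)) ∧
  ∀ s, ∀ X ∈ S.H x, B (S.I s x X) = S.I s x (B X)

/-- The endomorphism `B`, considered on the horizontal space at `x`, lies in
`sp(n, ℝ) ⊕ sp(1, ℝ)`, where `sp(1, ℝ)` is spanned by the `I_s`. -/
def IsSpnSp1 (x : M) (B : TangentSpace 𝓘(ℝ, Model n) x →ₗ[ℝ] TangentSpace 𝓘(ℝ, Model n) x) :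
    Prop :=
  ∃ (B₀ : TangentSpace 𝓘(ℝ, Model n) x →ₗ[ℝ] TangentSpace 𝓘(ℝ, Model n) x) (c : Fin 3 → ℝ),
    S.IsSpn x B₀ ∧ ∀ X ∈ S.H x, B X = B₀ X + ∑ s, c s • S.I s x X

/-- `S` is a paraquaternionic contact structure on the `(4n+3)`-dimensional manifold `M`, with
Reeb vector fields `ξ_s` and with `g` the extension of the horizontal metric for which the vertical
space is orthogonal to the horizontal one and `g(ξ_s, ξ_t) = -ε_s δ_st`. -/
structure IsPqc : Prop where
  smooth_g : SmoothTwoTensor S.g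
  smooth_η : ∀ s, SmoothOneForm (S.η s)
  smooth_ξ : ∀ s, SmoothField (S.ξ s)
  smooth_I : ∀ s, SmoothEndField (S.I s)
  symm : ∀ x u v, S.g x u v = S.g x v u
  neutral : ∀ x, ∃ e, S.IsFrame x e
  dual : ∀ s t x, S.η s x (S.ξ t x) = if s = t then 1 else 0
  metric_V : ∀ s t x, S.g x (S.ξ s x) (S.ξ t x) = if s = t then -eps s else 0
  metric_HV : ∀ s x, ∀ X ∈ S.H x, S.g x (S.ξ s x) X = 0
  I_mem : ∀ s x, ∀ X ∈ S.H x, S.I s x X ∈ S.H x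
  I_sq : ∀ s x, ∀ X ∈ S.H x, S.I s x (S.I s x X) = eps s • X
  I_mul : ∀ (i : Fin 3) (x : M), ∀ X ∈ S.H x,
    S.I i x (S.I (i + 1) x X) = -(eps (i + 2) • S.I (i + 2) x X) ∧
    S.I (i + 1) x (S.I i x X) = eps (i + 2) • S.I (i + 2) x X
  compatible : ∀ s x, ∀ X ∈ S.H x, ∀ Y ∈ S.H x,
    S.g x (S.I s x X) (S.I s x Y) = -eps s * S.g x X Y
  contact : ∀ s x, ∀ X ∈ S.H x, ∀ Y ∈ S.H x,
    extDeriv₁ (S.η s) x X Y = -2 * eps s * S.g x (S.I s x X) Y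
  reeb_self : ∀ s x, ∀ X ∈ S.H x, extDeriv₁ (S.η s) x (S.ξ s x) X = 0
  reeb : ∀ (i : Fin 3) (x : M), ∀ X ∈ S.H x,
    extDeriv₁ (S.η i) x (S.ξ (i + 1) x) X
      = eps (i + 2) * extDeriv₁ (S.η (i + 1)) x (S.ξ i x) X

/-- `nabla` is the canonical connection of the pqc structure `S`. -/
structure IsCanonical (nabla : Connection n M) : Prop where
  smooth : CovariantDerivative.ContMDiffCovariantDerivative nabla ∞
  /-- `∇` preserves the horizontal distribution. -/
  preserves_H : ∀ (x : M) (u : TangentSpace 𝓘(ℝ, Model n) x) (X : VField n M),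
    DiffAt X x → (∀ y, X y ∈ S.H y) → nabla X x u ∈ S.H x
  /-- `∇` preserves the vertical distribution. -/
  preserves_V : ∀ (x : M) (u : TangentSpace 𝓘(ℝ, Model n) x) (ξ : VField n M),
    DiffAt ξ x → (∀ y, ξ y ∈ S.V y) → nabla ξ x u ∈ S.V x
  /-- `∇g = 0` on the horizontal distribution. -/
  metric : ∀ (x : M) (u : TangentSpace 𝓘(ℝ, Model n) x) (X Y : VField n M),
    DiffAt X x → DiffAt Y x → (∀ y, X y ∈ S.H y) → (∀ y, Y y ∈ S.H y) →
      dirDeriv (fun y ↦ S.g y (X y) (Y y)) x u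
        = S.g x (nabla X x u) (Y x) + S.g x (X x) (nabla Y x u)
  /-- `∇σ` is a section of the bundle spanned by `I₁, I₂, I₃` for each section `σ = ∑ f_s I_s`. -/
  preserves_PQ : ∀ (x : M) (u : TangentSpace 𝓘(ℝ, Model n) x) (f : Fin 3 → M → ℝ),
    (∀ s, MDifferentiableAt 𝓘(ℝ, Model n) 𝓘(ℝ, ℝ) (f s) x) →
    ∃ c : Fin 3 → ℝ, ∀ X : VField n M, DiffAt X x → (∀ y, X y ∈ S.H y) →
      nabla (fun y ↦ ∑ s, f s y • S.I s y (X y)) x u - ∑ s, f s x • S.I s x (nabla X x u)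
        = ∑ s, c s • S.I s x (X x)
  /-- `T(X, Y) = -[X, Y]_V` for horizontal vector fields `X, Y`. -/
  torsion_H : ∀ (x : M) (X Y : VField n M),
    DiffAt X x → DiffAt Y x → (∀ y, X y ∈ S.H y) → (∀ y, Y y ∈ S.H y) →
      nabla.torsion x (X x) (Y x) = -S.projV x (bracket X Y x)
  /-- For vertical `ξ`, the endomorphism `T(ξ, ·)_H` of the horizontal space is orthogonal to
  `sp(n, ℝ) ⊕ sp(1, ℝ)` for the inner product `⟨A, B⟩ = g(e_a, e_a) g(A e_a, B e_a)`. -/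
  torsion_V : ∀ (x : M), ∀ ξ ∈ S.V x, ∀ B, S.IsSpnSp1 x B → ∀ e, S.IsFrame x e →
    S.contr e (fun X Y ↦ S.g x (S.projH x (nabla.torsion x ξ X)) (B Y)) = 0
  /-- `∇φ = 0` for the identification `φ(ξ) = ∑ η_s(ξ) I_s` of the vertical distribution
  with the bundle spanned by `I₁, I₂, I₃`. -/
  identification : ∀ (x : M) (u : TangentSpace 𝓘(ℝ, Model n) x) (ξ X : VField n M),
    DiffAt ξ x → DiffAt X x → (∀ y, ξ y ∈ S.V y) → (∀ y, X y ∈ S.H y) →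
      nabla (fun y ↦ ∑ s, S.η s y (ξ y) • S.I s y (X y)) x u
          - ∑ s, S.η s x (ξ x) • S.I s x (nabla X x u)
        = ∑ s, S.η s x (nabla ξ x u) • S.I s x (X x)

variable (nabla : Connection n M)

/-- `T(A, B, C) = g(T(A, B), C)`. -/
def T (x : M) (u v w : TangentSpace 𝓘(ℝ, Model n) x) : ℝ :=
  S.g x (nabla.torsion x u v) w

/-- The symmetric part of the torsion endomorphism. -/
def Tsym (x : M) (ξ X Y : TangentSpace 𝓘(ℝ, Model n) x) : ℝ :=
  (S.T nabla x ξ X Y + S.T nabla x ξ Y X) / 2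

/-- The skew-symmetric part of the torsion endomorphism. -/
def Tskew (x : M) (ξ X Y : TangentSpace 𝓘(ℝ, Model n) x) : ℝ :=
  (S.T nabla x ξ X Y - S.T nabla x ξ Y X) / 2

/-- The tensor `τ` on the horizontal distribution. -/
def τ (x : M) (X Y : TangentSpace 𝓘(ℝ, Model n) x) : ℝ :=
  -∑ s, eps s * S.Tsym nabla x (S.ξ s x) (S.I s x X) Y

/-- The tensors `μ_s` on the horizontal distribution (they coincide with each other). -/
def μ (s : Fin 3) (x : M) (X Y : TangentSpace 𝓘(ℝ, Model n) x) : ℝ :=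
  eps s * S.Tskew nabla x (S.ξ s x) (S.I s x X) Y

section Ricci

variable {x : M} (e : Fin (2 * n) ⊕ Fin (2 * n) → TangentSpace 𝓘(ℝ, Model n) x)

/-- `ρ_s(B, C) = (1/4n) R(B, C, e_a, I_s e_a)`. -/
def ricciForm (s : Fin 3) (u v : TangentSpace 𝓘(ℝ, Model n) x) : ℝ :=
  1 / (4 * n) * S.contr e (fun a b ↦ curv S.g nabla x u v a (S.I s x b))

/-- `Ric(B, C) = R(e_a, B, C, e_a)`. -/
def Ric (u v : TangentSpace 𝓘(ℝ, Model n) x) : ℝ :=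
  S.contr e (fun a b ↦ curv S.g nabla x a u v b)

/-- `Scal = Ric(e_a, e_a)`. -/
def Scal : ℝ := S.contr e (fun a b ↦ S.Ric nabla e a b)

/-- `ζ_s(B, C) = (1/4n) R(e_a, B, C, I_s e_a)`. -/
def zetaForm (s : Fin 3) (u v : TangentSpace 𝓘(ℝ, Model n) x) : ℝ :=
  1 / (4 * n) * S.contr e (fun a b ↦ curv S.g nabla x a u v (S.I s x b))

/-- `ϱ_s(B, C) = (1/4n) R(e_a, I_s e_a, B, C)`. -/
def varrhoForm (s : Fin 3) (u v : TangentSpace 𝓘(ℝ, Model n) x) : ℝ :=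
  1 / (4 * n) * S.contr e (fun a b ↦ curv S.g nabla x a (S.I s x b) u v)

end Ricci

/-- The pqc structure is pqc-Einstein: the horizontal Ricci tensor of its canonical connection
`nabla` is trace-free, i.e. `Ric(X, Y) = (Scal / 4n) g(X, Y)`. -/
def IsPqcEinstein : Prop :=
  ∀ (x : M) (e : Fin (2 * n) ⊕ Fin (2 * n) → TangentSpace 𝓘(ℝ, Model n) x), S.IsFrame x e →
    ∀ X ∈ S.H x, ∀ Y ∈ S.H x,
      S.Ric nabla e X Y = S.Scal nabla e / (4 * n) * S.g x X Y

end PqcData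

/-- The pqc structure of a para 3-Sasakian manifold: `η_s(A) = -ε_s g(A, ξ_s)` and `I_s` is the
restriction of `Φ_s` to the horizontal distribution, `Φ_s B = D_B ξ_s`. -/
def ofPara3Sasakian (g : TwoTensor n M) (D : Connection n M) (ξ : Fin 3 → VField n M) :
    PqcData n M where
  g := g
  η s x := -eps s • g x (ξ s x)
  ξ := ξ
  I s x := D (ξ s) x

end Pqc

end

/-! Everything is forced by the endomorphisms `Φ_s = D ξ_s`. The Killing equation makes them skew,
and feeding the fields `ξ_t` themselves into the equation for `DΦ_i` yields the paraquaternionic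
relations up to terms along the `ξ_i` (`phi_sq`, `phi_mul`, `phi_mul'`). Since `dη_s` is `-2ε_s
g(Φ_s ·, ·)`, the pqc axioms and the structure equations become pointwise algebra. The signature of
`H` comes from `I_1`: an involutive anti-isometry forces neutrality (`exists_neutral_frame`).

The canonical connection is given explicitly as `D + canonDiff`. The correction removes the vertical
part of `D_u X` for horizontal `X`, and it is arranged so that `T(ξ, X) = 0`; the orthogonality
condition on the torsion then holds trivially (`isCanonical_canonConn`). For uniqueness, the
difference of another canonical connection and this one is treated block by block. Along `H` in
horizontal directions it vanishes by the Koszul argument. In vertical directions it is a skew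
endomorphism of `H` that normalizes `sp(1, ℝ)`, hence lies in `sp(n, ℝ) ⊕ sp(1, ℝ)`, and it is also
orthogonal to that algebra, hence zero (`eq_zero_of_orthogonal`). On `V` it vanishes because `∇φ =
0` and the `I_s` are linearly independent. So every claim about canonical connections need only be
checked for `canonConn`.

Substituting the formula into the curvature gives `R^g`, quadratic terms in the `ω_s`, and a
commutator term that needs both first arguments to have vertical parts (`curv_canonConn`). The
Ricci-type traces do not require knowing `R^g`: the Ricci identity for `Φ_j` says that on `H` the
commutator of `R(X, Y)` with each `I_j` is that of `∑ 2ε_s ω_s(X, Y) I_s` (`horCurv_phi`). What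
remains after subtracting this sum commutes with all `I_j` and is trace-orthogonal to them, which
determines `ρ_s`. Pair symmetry then gives `ϱ_s`, the Bianchi identity gives `ζ_s`, and the same
commutator formula turns `ζ_1` into `Ric`. -/

set_option linter.unusedSectionVars false

noncomputable section

namespace Pqc

open Bundle Filter Topology

/-! ### Local calculus of vector fields, brackets, connections and curvature -/

section

variable {n : ℕ} {M : Type*} [TopologicalSpace M] [ChartedSpace (Model n) M]
  [IsManifold 𝓘(ℝ, Model n) ∞ M]

/-- The vector field `A` is smooth at `x`. -/
def SmoothAt (A : VField n M) (x : M) : Prop :=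
  ContMDiffAt 𝓘(ℝ, Model n) (𝓘(ℝ, Model n).prod 𝓘(ℝ, Model n)) ∞
    (fun y ↦ Bundle.TotalSpace.mk' (Model n) (E := fun y : M ↦ TangentSpace 𝓘(ℝ, Model n) y)
      y (A y)) x

/-- The vector field `A` is smooth on a neighbourhood of `x`. -/
def SmoothNear (A : VField n M) (x : M) : Prop := ∀ᶠ y in 𝓝 x, SmoothAt A y

/-- The function `f` is smooth at `x`. -/
def FunSmoothAt (f : M → ℝ) (x : M) : Prop := ContMDiffAt 𝓘(ℝ, Model n) 𝓘(ℝ, ℝ) ∞ f x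

/-- The function `f` is differentiable at `x`. -/
def FunDiffAt (f : M → ℝ) (x : M) : Prop := MDifferentiableAt 𝓘(ℝ, Model n) 𝓘(ℝ, ℝ) f x

variable {A B : VField n M} {x : M}

lemma SmoothAt.diffAt (h : SmoothAt A x) : DiffAt A x :=
  ContMDiffAt.mdifferentiableAt h (by simp)

lemma SmoothNear.smoothAt (h : SmoothNear A x) : SmoothAt A x := h.self_of_nhds

lemma SmoothNear.diffAt (h : SmoothNear A x) : DiffAt A x := h.smoothAt.diffAt

lemma SmoothNear.eventually_diffAt (h : SmoothNear A x) : ∀ᶠ y in 𝓝 x, DiffAt A y :=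
  h.mono fun _ hy ↦ hy.diffAt

lemma SmoothField.smoothAt (h : SmoothField A) (x : M) : SmoothAt A x := h x

lemma SmoothField.smoothNear (h : SmoothField A) (x : M) : SmoothNear A x :=
  Eventually.of_forall fun y ↦ h y

lemma SmoothField.diffAt (h : SmoothField A) (x : M) : DiffAt A x := (h.smoothAt x).diffAt

lemma smoothNear_ext (u : TangentSpace 𝓘(ℝ, Model n) x) : SmoothNear (ext u) x := by
  obtain ⟨t, ht, h⟩ := FiberBundle.exists_contMDiffOn_extend (I := 𝓘(ℝ, Model n)) (k := ∞) (Model n)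
    (V := fun y : M ↦ TangentSpace 𝓘(ℝ, Model n) y) u
  filter_upwards [eventually_mem_nhds_iff.2 ht] with y hy
  exact h.contMDiffAt hy

lemma diffAt_ext (u : TangentSpace 𝓘(ℝ, Model n) x) : DiffAt (ext u) x :=
  (smoothNear_ext u).diffAt

@[simp] lemma ext_self (u : TangentSpace 𝓘(ℝ, Model n) x) : ext u x = u :=
  FiberBundle.extend_apply_self _ u

lemma DiffAt.add (hA : DiffAt A x) (hB : DiffAt B x) : DiffAt (fun y ↦ A y + B y) x :=
  mdifferentiableAt_add_section hA hB

lemma DiffAt.sub (hA : DiffAt A x) (hB : DiffAt B x) : DiffAt (fun y ↦ A y - B y) x :=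
  mdifferentiableAt_sub_section hA hB

lemma DiffAt.neg (hA : DiffAt A x) : DiffAt (fun y ↦ -A y) x :=
  mdifferentiableAt_neg_section hA

lemma DiffAt.smul {f : M → ℝ} (hf : FunDiffAt (n := n) f x) (hA : DiffAt A x) :
    DiffAt (fun y ↦ f y • A y) x :=
  MDifferentiableAt.smul_section hf hA

lemma DiffAt.sum {ι : Type*} {s : Finset ι} {F : ι → VField n M} (h : ∀ i ∈ s, DiffAt (F i) x) :
    DiffAt (fun y ↦ ∑ i ∈ s, F i y) x :=
  MDifferentiableAt.sum_section h

lemma SmoothAt.smul {f : M → ℝ} (hf : FunSmoothAt (n := n) f x) (hA : SmoothAt A x) :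
    SmoothAt (fun y ↦ f y • A y) x :=
  ContMDiffAt.smul_section hf hA

lemma SmoothNear.congr (hA : SmoothNear A x) (h : A =ᶠ[𝓝 x] B) : SmoothNear B x := by
  filter_upwards [hA, h.eventuallyEq_nhds] with y hy hy'
  refine ContMDiffAt.congr_of_eventuallyEq hy ?_
  filter_upwards [hy'] with z hz
  rw [hz]

lemma DiffAt.congr (hA : DiffAt A x) (h : A =ᶠ[𝓝 x] B) : DiffAt B x := by
  refine MDifferentiableAt.congr_of_eventuallyEq hA ?_
  filter_upwards [h] with z hz
  rw [hz]

lemma FunSmoothAt.funDiffAt {f : M → ℝ} (h : FunSmoothAt (n := n) f x) : FunDiffAt (n := n) f x :=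
  ContMDiffAt.mdifferentiableAt h (by simp)

lemma FunDiffAt.const (c : ℝ) : FunDiffAt (n := n) (fun _ : M ↦ c) x := mdifferentiableAt_const

lemma FunDiffAt.mul {f k : M → ℝ} (hf : FunDiffAt (n := n) f x) (hk : FunDiffAt (n := n) k x) :
    FunDiffAt (n := n) (fun y ↦ f y * k y) x := MDifferentiableAt.mul hf hk

lemma FunDiffAt.add {f k : M → ℝ} (hf : FunDiffAt (n := n) f x) (hk : FunDiffAt (n := n) k x) :
    FunDiffAt (n := n) (fun y ↦ f y + k y) x := MDifferentiableAt.add hf hk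

lemma FunDiffAt.sub {f k : M → ℝ} (hf : FunDiffAt (n := n) f x) (hk : FunDiffAt (n := n) k x) :
    FunDiffAt (n := n) (fun y ↦ f y - k y) x := MDifferentiableAt.sub hf hk

lemma FunDiffAt.const_mul {f : M → ℝ} (c : ℝ) (hf : FunDiffAt (n := n) f x) :
    FunDiffAt (n := n) (fun y ↦ c * f y) x := (FunDiffAt.const c).mul hf

variable {u : TangentSpace 𝓘(ℝ, Model n) x}

@[simp] lemma dirDeriv_const (c : ℝ) : dirDeriv (fun _ : M ↦ c) x u = 0 := by
  simp [dirDeriv, mvfderiv_const]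

lemma dirDeriv_add {f k : M → ℝ} (hf : FunDiffAt (n := n) f x) (hk : FunDiffAt (n := n) k x) :
    dirDeriv (fun y ↦ f y + k y) x u = dirDeriv f x u + dirDeriv k x u := by
  simp only [dirDeriv]; rw [mvfderiv_fun_add hf hk]; rfl

lemma dirDeriv_sub {f k : M → ℝ} (hf : FunDiffAt (n := n) f x) (hk : FunDiffAt (n := n) k x) :
    dirDeriv (fun y ↦ f y - k y) x u = dirDeriv f x u - dirDeriv k x u := by
  simp only [dirDeriv]; rw [mvfderiv_fun_sub hf hk]; rfl

lemma dirDeriv_mul {f k : M → ℝ} (hf : FunDiffAt (n := n) f x) (hk : FunDiffAt (n := n) k x) :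
    dirDeriv (fun y ↦ f y * k y) x u = f x * dirDeriv k x u + k x * dirDeriv f x u := by
  simp only [dirDeriv]; rw [mvfderiv_fun_mul hf hk]; rfl

lemma dirDeriv_const_mul {f : M → ℝ} (c : ℝ) (hf : FunDiffAt (n := n) f x) :
    dirDeriv (fun y ↦ c * f y) x u = c * dirDeriv f x u := by
  rw [dirDeriv_mul (FunDiffAt.const c) hf]; simp

lemma dirDeriv_congr {f k : M → ℝ} (h : f =ᶠ[𝓝 x] k) : dirDeriv f x u = dirDeriv k x u := by
  have : mvfderiv 𝓘(ℝ, Model n) f x = mvfderiv 𝓘(ℝ, Model n) k x := by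
    ext v
    have := congrArg (fun L : Model n →L[ℝ] ℝ ↦ L v) (h.mfderiv_eq (I := 𝓘(ℝ, Model n)) (I' := 𝓘(ℝ, ℝ)))
    exact this
  simp only [dirDeriv, this]

variable {g : TwoTensor n M}

lemma smoothAt_metric (hg : SmoothTwoTensor g) (hA : SmoothAt A x) (hB : SmoothAt B x) :
    FunSmoothAt (n := n) (fun y ↦ g y (A y) (B y)) x := by
  have h := ContMDiffAt.clm_bundle_apply₂ (b := fun y : M ↦ y) (hψ := hg x) (hv := hA) (hw := hB)
    (E₃ := fun _ : M ↦ ℝ) (F₃ := ℝ)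
  exact (contMDiffAt_section _).1 h

lemma diffAt_metric (hg : SmoothTwoTensor g) (hA : DiffAt A x) (hB : DiffAt B x) :
    FunDiffAt (n := n) (fun y ↦ g y (A y) (B y)) x := by
  have h := MDifferentiableAt.clm_bundle_apply₂ (b := fun y : M ↦ y)
    (hψ := (hg x).mdifferentiableAt (by simp)) (hv := hA) (hw := hB)
    (E₃ := fun _ : M ↦ ℝ) (F₃ := ℝ)
  exact (mdifferentiableAt_section _ _).1 h

lemma SmoothEndField.smoothAt_apply {J : EndField n M} (hJ : SmoothEndField J)
    (hA : SmoothAt A x) : SmoothAt (fun y ↦ J y (A y)) x :=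
  ContMDiffAt.clm_bundle_apply (b := fun y : M ↦ y) (hϕ := hJ x) (hv := hA)

lemma SmoothEndField.diffAt_apply {J : EndField n M} (hJ : SmoothEndField J)
    (hA : DiffAt A x) : DiffAt (fun y ↦ J y (A y)) x :=
  MDifferentiableAt.clm_bundle_apply (b := fun y : M ↦ y)
    (hϕ := (hJ x).mdifferentiableAt (by simp)) (hv := hA)

/-! ### Connections -/

section Connection

variable (D : Connection n M)

lemma conn_add (hA : DiffAt A x) (hB : DiffAt B x) (u : TangentSpace 𝓘(ℝ, Model n) x) :
    D (fun y ↦ A y + B y) x u = D A x u + D B x u :=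
  congrArg (fun L ↦ L u) (D.isCovariantDerivativeOnUniv.add hA hB)

lemma conn_smul {f : M → ℝ} (hf : FunDiffAt (n := n) f x) (hA : DiffAt A x)
    (u : TangentSpace 𝓘(ℝ, Model n) x) :
    D (fun y ↦ f y • A y) x u = f x • D A x u + dirDeriv f x u • A x :=
  congrArg (fun L ↦ L u) (D.isCovariantDerivativeOnUniv.leibniz hA hf)

lemma conn_const_smul (c : ℝ) (hA : DiffAt A x) (u : TangentSpace 𝓘(ℝ, Model n) x) :
    D (fun y ↦ c • A y) x u = c • D A x u := by
  rw [conn_smul D (FunDiffAt.const c) hA]; simp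

lemma conn_neg (hA : DiffAt A x) (u : TangentSpace 𝓘(ℝ, Model n) x) :
    D (fun y ↦ -A y) x u = -D A x u := by
  simpa using conn_const_smul D (-1) hA u

lemma conn_sub (hA : DiffAt A x) (hB : DiffAt B x) (u : TangentSpace 𝓘(ℝ, Model n) x) :
    D (fun y ↦ A y - B y) x u = D A x u - D B x u := by
  simp only [sub_eq_add_neg]
  rw [conn_add D hA hB.neg, conn_neg D hB]

lemma conn_zero (u : TangentSpace 𝓘(ℝ, Model n) x) : D (fun _ ↦ 0) x u = 0 := by
  have := D.zero
  exact congrArg (fun L ↦ L u) (congrFun this x)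

lemma conn_sum {ι : Type*} {s : Finset ι} {F : ι → VField n M} (h : ∀ i ∈ s, DiffAt (F i) x)
    (u : TangentSpace 𝓘(ℝ, Model n) x) :
    D (fun y ↦ ∑ i ∈ s, F i y) x u = ∑ i ∈ s, D (F i) x u := by
  classical
  induction s using Finset.induction_on with
  | empty => simpa using conn_zero D u
  | insert a s ha ih =>
    simp only [Finset.mem_insert, forall_eq_or_imp] at h
    simp only [Finset.sum_insert ha]
    rw [conn_add D h.1 (DiffAt.sum h.2), ih h.2]

lemma conn_congr (hA : DiffAt A x) (h : A =ᶠ[𝓝 x] B) (u : TangentSpace 𝓘(ℝ, Model n) x) :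
    D A x u = D B x u :=
  congrArg (fun L ↦ L u) (D.isCovariantDerivativeOn.congr_of_eventuallyEq (s := Set.univ) hA
    (hA.congr h) univ_mem h)

lemma torsion_eq (hA : DiffAt A x) (hB : DiffAt B x) :
    D.torsion x (A x) (B x) = D B x (A x) - D A x (B x) - bracket A B x :=
  D.torsion_apply hA hB

variable [T2Space M]

/-- A vector field which is smooth near `x` agrees near `x` with a global smooth one. -/
lemma SmoothNear.exists_global (hA : SmoothNear A x) :
    ∃ A' : VField n M, SmoothField A' ∧ A' =ᶠ[𝓝 x] A := by
  obtain ⟨U, hU, hUo, hx⟩ := eventually_nhds_iff.1 hA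
  obtain ⟨f, -, hf⟩ := (SmoothBumpFunction.nhds_basis_tsupport (I := 𝓘(ℝ, Model n)) x).mem_iff.1
    (hUo.mem_nhds hx)
  refine ⟨fun y ↦ f y • A y, ?_, ?_⟩
  · exact ContMDiffOn.smul_section_of_tsupport (f.contMDiff.contMDiffOn (s := U)) hUo hf
      fun y hy ↦ ContMDiffAt.contMDiffWithinAt (hU y hy)
  · filter_upwards [f.eventuallyEq_one] with y hy
    rw [hy, Pi.one_apply, one_smul]

variable {D}

lemma conn_smoothEndField (hD : CovariantDerivative.ContMDiffCovariantDerivative D ∞)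
    (hA : SmoothField A) : SmoothEndField (D A) := by
  have h := hD.contMDiff.contMDiff (σ := A) (ContMDiff.contMDiffOn hA)
  exact contMDiffOn_univ.1 h

/-- Smoothness of a connection is used only through sections smooth on all of `M`, so `A` is first
replaced near `x` by a global smooth field. -/
lemma SmoothNear.conn (hD : CovariantDerivative.ContMDiffCovariantDerivative D ∞)
    (hA : SmoothNear A x) (hB : SmoothNear B x) : SmoothNear (fun y ↦ D A y (B y)) x := by
  obtain ⟨A', hA', h⟩ := hA.exists_global
  have h1 : SmoothNear (fun y ↦ D A' y (B y)) x := by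
    filter_upwards [hB] with y hy
    exact (conn_smoothEndField hD hA').smoothAt_apply hy
  refine h1.congr ?_
  filter_upwards [h.eventuallyEq_nhds] with y hy
  exact conn_congr D (hA'.diffAt y) hy (B y)

end Connection

lemma two_le_infty : (2 : ℕ∞ω) ≤ ∞ :=
  WithTop.coe_le_coe.2 (le_top : (2 : ℕ∞) ≤ ⊤)

lemma three_le_infty : (3 : ℕ∞ω) ≤ ∞ :=
  WithTop.coe_le_coe.2 (le_top : (3 : ℕ∞) ≤ ⊤)

lemma SmoothNear.bracket (hA : SmoothNear A x) (hB : SmoothNear B x) :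
    SmoothNear (bracket A B) x := by
  filter_upwards [hA, hB] with y hy hy'
  have : IsManifold 𝓘(ℝ, Model n) (((⊤ : ℕ∞) : ℕ∞ω) + 1) M := ‹IsManifold 𝓘(ℝ, Model n) ∞ M›
  have : IsManifold 𝓘(ℝ, Model n) (minSmoothness ℝ 2) M := by
    simp only [minSmoothness_of_isRCLikeNormedField]
    exact .of_le (m := 2) (n := ∞) two_le_infty
  exact ContMDiffAt.mlieBracket_vectorField (m := ⊤) (n := ⊤) hy hy' (by simp)

lemma bracket_swap (A B : VField n M) (x : M) : bracket A B x = -bracket B A x :=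
  VectorField.mlieBracket_swap_apply

lemma bracket_congr {A' B' : VField n M} (hA : A =ᶠ[𝓝 x] A') (hB : B =ᶠ[𝓝 x] B') :
    bracket A B x = bracket A' B' x :=
  hA.mlieBracket_vectorField_eq hB

lemma jacobi {C : VField n M} (hA : SmoothAt A x) (hB : SmoothAt B x) (hC : SmoothAt C x) :
    bracket A (bracket B C) x = bracket (bracket A B) C x + bracket B (bracket A C) x := by
  have : IsManifold 𝓘(ℝ, Model n) (minSmoothness ℝ 3) M := by
    simp only [minSmoothness_of_isRCLikeNormedField]
    exact .of_le (m := 3) (n := ∞) three_le_infty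
  refine VectorField.leibniz_identity_mlieBracket_apply ?_ ?_ ?_ <;>
    simp only [minSmoothness_of_isRCLikeNormedField]
  exacts [ContMDiffAt.of_le hA two_le_infty,
    ContMDiffAt.of_le hB two_le_infty, ContMDiffAt.of_le hC two_le_infty]

lemma bracket_smul_right {f : M → ℝ} (hf : FunDiffAt (n := n) f x) (hB : DiffAt B x) :
    bracket A (fun y ↦ f y • B y) x = dirDeriv f x (A x) • B x + f x • bracket A B x :=
  VectorField.mlieBracket_smul_right hf hB

lemma bracket_add_right {C : VField n M} (hB : DiffAt B x) (hC : DiffAt C x) :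
    bracket A (fun y ↦ B y + C y) x = bracket A B x + bracket A C x :=
  VectorField.mlieBracket_add_right hB hC

/-- Obtained from the Jacobi identity for `A`, `B` and `f • C`, where `C` is an auxiliary field with
`C x ≠ 0`. After the Leibniz rule, the first-order terms cancel and the Jacobi identity for `C`
removes the rest. What is left is `(ABf - BAf - [A, B]f) • C x = 0`. -/
lemma dirDeriv_comm {f : M → ℝ} (hA : SmoothNear A x) (hB : SmoothNear B x)
    (hf : ∀ᶠ y in 𝓝 x, FunSmoothAt (n := n) f y)
    (hAf : FunDiffAt (n := n) (fun y ↦ dirDeriv f y (A y)) x)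
    (hBf : FunDiffAt (n := n) (fun y ↦ dirDeriv f y (B y)) x) :
    dirDeriv (fun y ↦ dirDeriv f y (B y)) x (A x) - dirDeriv (fun y ↦ dirDeriv f y (A y)) x (B x)
      = dirDeriv f x (bracket A B x) := by
  let c : Model n := EuclideanSpace.single 0 1
  have hc0 : c ≠ 0 := by simp [c]
  let C : VField n M := ext (x := x) c
  have hC : SmoothNear C x := smoothNear_ext _
  have hcx : C x = c := ext_self (x := x) c
  have hfx : FunDiffAt (n := n) f x := hf.self_of_nhds.funDiffAt
  have hlie (A B : VField n M) (hA : SmoothNear A x) (hB : SmoothNear B x)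
      (hBf : FunDiffAt (n := n) (fun y ↦ dirDeriv f y (B y)) x) :
      bracket A (bracket B fun y ↦ f y • C y) x
        = dirDeriv (fun y ↦ dirDeriv f y (B y)) x (A x) • C x
          + dirDeriv f x (B x) • bracket A C x
          + (dirDeriv f x (A x) • bracket B C x + f x • bracket A (bracket B C) x) := by
    have h1 : bracket B (fun y ↦ f y • C y)
        =ᶠ[𝓝 x] fun y ↦ dirDeriv f y (B y) • C y + f y • bracket B C y := by
      filter_upwards [hf, hC] with y hy hy'
      exact bracket_smul_right hy.funDiffAt hy'.diffAt
    rw [bracket_congr (EventuallyEq.refl _ A) h1,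
      bracket_add_right (hC.diffAt.smul hBf) ((hB.bracket hC).diffAt.smul hfx),
      bracket_smul_right hBf hC.diffAt, bracket_smul_right hfx (hB.bracket hC).diffAt]
  have hJ := jacobi hA.smoothAt hB.smoothAt (hC.smoothAt.smul hf.self_of_nhds)
  rw [hlie A B hA hB hBf, hlie B A hB hA hAf, bracket_smul_right hfx hC.diffAt,
    jacobi hA.smoothAt hB.smoothAt hC.smoothAt] at hJ
  have h0 : (dirDeriv (fun y ↦ dirDeriv f y (B y)) x (A x)
      - dirDeriv (fun y ↦ dirDeriv f y (A y)) x (B x) - dirDeriv f x (bracket A B x)) • C x = 0 := by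
    linear_combination (norm := module) hJ
  rcases smul_eq_zero.1 h0 with h | h
  · linarith
  · exact absurd (hcx.symm.trans h) hc0

/-! ### The curvature of a metric torsion-free connection -/

section Curvature

variable {D : Connection n M}

/-- The curvature `R(A, B)C` of vector fields. -/
def curvField (D : Connection n M) (A B C : VField n M) (x : M) : TangentSpace 𝓘(ℝ, Model n) x :=
  D (fun y ↦ D C y (B y)) x (A x) - D (fun y ↦ D C y (A y)) x (B x) - D C x (bracket A B x)

lemma curvOp_eq (u v w : TangentSpace 𝓘(ℝ, Model n) x) :
    curvOp D x u v w = curvField D (ext u) (ext v) (ext w) x := by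
  simp [curvOp, curvField]

lemma curvField_swap (A B C : VField n M) (x : M) : curvField D A B C x = -curvField D B A C x := by
  simp only [curvField, bracket_swap A B, map_neg]; abel

lemma IsLeviCivita.bracket_eq (h : IsLeviCivita g D) (hA : DiffAt A x) (hB : DiffAt B x) :
    bracket A B x = D B x (A x) - D A x (B x) := by
  have := torsion_eq D hA hB
  rw [h.torsion_free] at this
  exact (sub_eq_zero.1 this.symm).symm

variable [T2Space M]

/-- Since the torsion vanishes, `D_A D_B C - D_A D_C B - D_{[B, C]} A` is `D_A [B, C] - D_{[B, C]} A
= [A, [B, C]]`. The cyclic sum of these double brackets is the Jacobi identity. -/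
lemma IsLeviCivita.bianchi_field (h : IsLeviCivita g D) {C : VField n M} (hA : SmoothNear A x)
    (hB : SmoothNear B x) (hC : SmoothNear C x) :
    curvField D A B C x + curvField D B C A x + curvField D C A B x = 0 := by
  have key (A B C : VField n M) (hA : SmoothNear A x) (hB : SmoothNear B x) (hC : SmoothNear C x) :
      D (fun y ↦ D C y (B y)) x (A x) - D (fun y ↦ D B y (C y)) x (A x)
        - D A x (bracket B C x) = bracket A (bracket B C) x := by
    rw [h.bracket_eq hA.diffAt (hB.bracket hC).diffAt,
      ← conn_sub D (hC.conn h.smooth hB).diffAt (hB.conn h.smooth hC).diffAt]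
    congr 1
    refine conn_congr D ((hC.conn h.smooth hB).diffAt.sub (hB.conn h.smooth hC).diffAt) ?_ _
    filter_upwards [hB, hC] with y hy hy'
    exact (h.bracket_eq hy.diffAt hy'.diffAt).symm
  have hJ := jacobi hA.smoothAt hB.smoothAt hC.smoothAt
  rw [bracket_swap (bracket A B) C, bracket_congr (EventuallyEq.refl _ B)
    (Eventually.of_forall (bracket_swap A C))] at hJ
  have h3 : bracket B (fun y ↦ -bracket C A y) x = -bracket B (bracket C A) x := by
    have := bracket_smul_right (A := B) (B := bracket C A) (x := x) (FunDiffAt.const (-1))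
      (hC.bracket hA).diffAt
    simpa using this
  rw [h3] at hJ
  simp only [curvField]
  have h1 := key A B C hA hB hC
  have h2 := key B C A hB hC hA
  have h4 := key C A B hC hA hB
  linear_combination (norm := module) h1 + h2 + h4 + hJ

/-- Apply `AB - BA - [A, B]`, which kills functions, to `g(C, E)` and expand by metric
compatibility; the mixed products of first derivatives cancel. The lemma also provides tensoriality:
the left side depends on `E` only through `E x`, the right side on `C` only through `C x`. -/
lemma IsLeviCivita.curvField_skew (hg : SmoothTwoTensor g) (h : IsLeviCivita g D)
    {C E : VField n M} (hA : SmoothNear A x) (hB : SmoothNear B x) (hC : SmoothNear C x)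
    (hE : SmoothNear E x) :
    g x (curvField D A B C x) (E x) = -g x (C x) (curvField D A B E x) := by
  have hf : ∀ᶠ y in 𝓝 x, FunSmoothAt (n := n) (fun y ↦ g y (C y) (E y)) y := by
    filter_upwards [hC, hE] with y hy hy'
    exact smoothAt_metric hg hy hy'
  have hd (A : VField n M) (hA : SmoothNear A x) :
      (fun y ↦ dirDeriv (fun y ↦ g y (C y) (E y)) y (A y))
        =ᶠ[𝓝 x] fun y ↦ g y (D C y (A y)) (E y) + g y (C y) (D E y (A y)) := by
    filter_upwards [hC, hE] with y hy hy'
    exact h.metric y (A y) C E hy.diffAt hy'.diffAt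
  have hdd (A : VField n M) (hA : SmoothNear A x) :
      FunDiffAt (n := n) (fun y ↦ g y (D C y (A y)) (E y) + g y (C y) (D E y (A y))) x :=
    (diffAt_metric hg (hC.conn h.smooth hA).diffAt hE.diffAt).add
      (diffAt_metric hg hC.diffAt (hE.conn h.smooth hA).diffAt)
  have hs (A B : VField n M) (hA : SmoothNear A x) (hB : SmoothNear B x) :
      dirDeriv (fun y ↦ dirDeriv (fun y ↦ g y (C y) (E y)) y (B y)) x (A x)
        = g x (D (fun y ↦ D C y (B y)) x (A x)) (E x) + g x (D C x (B x)) (D E x (A x))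
          + (g x (D C x (A x)) (D E x (B x)) + g x (C x) (D (fun y ↦ D E y (B y)) x (A x))) := by
    rw [dirDeriv_congr (hd B hB), dirDeriv_add
      (diffAt_metric hg (hC.conn h.smooth hB).diffAt hE.diffAt)
      (diffAt_metric hg hC.diffAt (hE.conn h.smooth hB).diffAt),
      h.metric _ _ _ _ (hC.conn h.smooth hB).diffAt hE.diffAt,
      h.metric _ _ _ _ hC.diffAt (hE.conn h.smooth hB).diffAt]
  have hk := dirDeriv_comm hA hB hf ((hdd A hA).congr_of_eventuallyEq (hd A hA))
    ((hdd B hB).congr_of_eventuallyEq (hd B hB))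
  rw [hs A B hA hB, hs B A hB hA, h.metric _ _ _ _ hC.diffAt hE.diffAt] at hk
  simp only [curvField, map_sub, sub_apply]
  linarith

end Curvature

end

/-! ### Algebra of the endomorphisms `Φ_s` -/

section

variable {n : ℕ} {M : Type*} [TopologicalSpace M] [ChartedSpace (Model n) M]
  [IsManifold 𝓘(ℝ, Model n) ∞ M]

variable {g : TwoTensor n M} {D : Connection n M} {ξ : Fin 3 → VField n M}

@[simp] lemma eps_zero : eps 0 = 1 := rfl
@[simp] lemma eps_one : eps 1 = 1 := rfl
@[simp] lemma eps_two : eps 2 = -1 := rfl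

@[simp] lemma eps_mul_self (s : Fin 3) : eps s * eps s = 1 := by
  fin_cases s <;> simp

lemma eps_ne_zero (s : Fin 3) : eps s ≠ 0 := by
  fin_cases s <;> simp

lemma IsMetric.nondegenerate (h : IsMetric g) {x : M} {u : TangentSpace 𝓘(ℝ, Model n) x}
    (hu : ∀ v, g x u v = 0) : u = 0 := by
  obtain ⟨b, hb⟩ := h.signature x
  refine b.ext_elem fun p ↦ ?_
  have h1 := hu (b p)
  rw [← b.sum_repr u] at h1
  simp only [map_sum, map_smul, sum_apply, smul_apply, hb, smul_eq_mul] at h1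
  simp only [mul_ite, mul_zero, Finset.sum_ite_eq', Finset.mem_univ, if_true] at h1
  rcases mul_eq_zero.1 h1 with h2 | h2
  · simpa using h2
  · rcases p with p | p <;> simp at h2

namespace IsPara3Sasakian

variable (h : IsPara3Sasakian g D ξ) (x : M)
include h

lemma symm (u v : TangentSpace 𝓘(ℝ, Model n) x) : g x u v = g x v u := h.metric.symm x u v

lemma ext_left {u v : TangentSpace 𝓘(ℝ, Model n) x} (huv : ∀ w, g x u w = g x v w) : u = v :=
  sub_eq_zero.1 (h.metric.nondegenerate fun w ↦ by simp [huv])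

/-- The Killing equation with `[ξ, A] = D_ξ A - D_A ξ` and metric compatibility inserted. -/
lemma skew (s : Fin 3) (u v : TangentSpace 𝓘(ℝ, Model n) x) :
    g x (D (ξ s) x u) v = -g x u (D (ξ s) x v) := by
  have h1 := h.killing s x (ext u) (ext v) (diffAt_ext u) (diffAt_ext v)
  rw [h.leviCivita.metric _ _ _ _ (diffAt_ext u) (diffAt_ext v),
    h.leviCivita.bracket_eq ((h.smooth s).diffAt x) (diffAt_ext u),
    h.leviCivita.bracket_eq ((h.smooth s).diffAt x) (diffAt_ext v)] at h1
  simp only [ext_self, map_sub, sub_apply] at h1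
  linarith

lemma metric_phi_add (s t : Fin 3) (u : TangentSpace 𝓘(ℝ, Model n) x) :
    g x (D (ξ s) x u) (ξ t x) + g x (ξ s x) (D (ξ t) x u) = 0 := by
  rw [← h.leviCivita.metric x u _ _ ((h.smooth s).diffAt x) ((h.smooth t).diffAt x)]
  simp only [h.orthogonal]
  exact dirDeriv_const _

/-- The constants `g(ξ_s, ξ_t)` have zero derivative; skewness moves both `Φ` onto the Reeb fields.
-/
lemma phi_anti (s t : Fin 3) : D (ξ s) x (ξ t x) = -D (ξ t) x (ξ s x) := by
  refine h.ext_left x fun w ↦ ?_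
  have h1 := h.metric_phi_add x s t w
  rw [map_neg, neg_apply, h.skew x t]
  rw [h.skew, h.symm] at h1
  linarith

lemma phi_self (s : Fin 3) : D (ξ s) x (ξ s x) = 0 := by
  have h2 : (2 : ℝ) • D (ξ s) x (ξ s x) = 0 := by
    linear_combination (norm := module) h.phi_anti x s s
  exact (smul_eq_zero.1 h2).resolve_left two_ne_zero

/-- By torsion-freeness and `phi_anti`, the commutator `[ξ_i, ξ_{i+1}]` is twice `Φ_{i+1} ξ_i`. -/
lemma phi_prev (i : Fin 3) : D (ξ (i + 1)) x (ξ i x) = eps (i + 2) • ξ (i + 2) x := by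
  have h1 := h.commutator i x
  rw [h.leviCivita.bracket_eq ((h.smooth _).diffAt x) ((h.smooth _).diffAt x),
    h.phi_anti x i (i + 1)] at h1
  have h2 : (2 : ℝ) • D (ξ (i + 1)) x (ξ i x) = (2 : ℝ) • eps (i + 2) • ξ (i + 2) x := by
    linear_combination (norm := module) h1
  exact smul_right_injective _ (two_ne_zero) h2

lemma phi_next (i : Fin 3) : D (ξ i) x (ξ (i + 1) x) = -(eps (i + 2) • ξ (i + 2) x) := by
  rw [h.phi_anti, h.phi_prev]

/-- The equation for `DΦ_i` is applied to `B = ξ_i`: the field `Φ_i ξ_i` vanishes identically, so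
only `-Φ_i (D_u ξ_i) = -Φ_i² u` remains on the left. The products `Φ_s Φ_t` below arise in the same
way, from `B = ξ_t` and the known field `Φ_s ξ_t`. -/
lemma phi_sq (i : Fin 3) (u : TangentSpace 𝓘(ℝ, Model n) x) :
    D (ξ i) x (D (ξ i) x u) = eps i • u + g x (ξ i x) u • ξ i x := by
  have h1 := h.covDeriv i x u (ξ i) ((h.smooth i).diffAt x)
  have h2 : (fun y ↦ D (ξ i) y (ξ i y)) = fun _ ↦ 0 := funext fun y ↦ h.phi_self y i
  rw [h2, conn_zero, h.orthogonal, if_pos rfl, h.symm x u] at h1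
  linear_combination (norm := module) -h1

lemma phi_mul (i : Fin 3) (u : TangentSpace 𝓘(ℝ, Model n) x) :
    D (ξ i) x (D (ξ (i + 1)) x u)
      = -(eps (i + 2) • D (ξ (i + 2)) x u) + g x (ξ (i + 1) x) u • ξ i x := by
  have h1 := h.covDeriv i x u (ξ (i + 1)) ((h.smooth _).diffAt x)
  have h2 : (fun y ↦ D (ξ i) y (ξ (i + 1) y)) = fun y ↦ (-eps (i + 2)) • ξ (i + 2) y :=
    funext fun y ↦ by rw [h.phi_next, neg_smul]
  rw [h2, conn_const_smul D _ ((h.smooth _).diffAt x), h.orthogonal, if_neg (by simp),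
    h.symm x u] at h1
  linear_combination (norm := module) -h1

lemma phi_mul' (i : Fin 3) (u : TangentSpace 𝓘(ℝ, Model n) x) :
    D (ξ (i + 1)) x (D (ξ i) x u)
      = eps (i + 2) • D (ξ (i + 2)) x u + g x (ξ i x) u • ξ (i + 1) x := by
  have h1 := h.covDeriv (i + 1) x u (ξ i) ((h.smooth _).diffAt x)
  have h2 : (fun y ↦ D (ξ (i + 1)) y (ξ i y)) = fun y ↦ eps (i + 2) • ξ (i + 2) y :=
    funext fun y ↦ h.phi_prev y i
  rw [h2, conn_const_smul D _ ((h.smooth _).diffAt x), h.orthogonal, if_neg (by simp),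
    h.symm x u] at h1
  linear_combination (norm := module) -h1

/-- The values `Φ_s ξ_t`. -/
lemma phi_table :
    (D (ξ 0) x (ξ 0 x) = 0 ∧ D (ξ 0) x (ξ 1 x) = ξ 2 x ∧ D (ξ 0) x (ξ 2 x) = ξ 1 x) ∧
    (D (ξ 1) x (ξ 0 x) = -ξ 2 x ∧ D (ξ 1) x (ξ 1 x) = 0 ∧ D (ξ 1) x (ξ 2 x) = -ξ 0 x) ∧
    (D (ξ 2) x (ξ 0 x) = -ξ 1 x ∧ D (ξ 2) x (ξ 1 x) = ξ 0 x ∧ D (ξ 2) x (ξ 2 x) = 0) := by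
  have a0 := h.phi_next x 0
  have a1 := h.phi_next x 1
  have a2 := h.phi_next x 2
  have b0 := h.phi_prev x 0
  have b1 := h.phi_prev x 1
  have b2 := h.phi_prev x 2
  have e1 : (1 + 1 : Fin 3) = 2 := rfl
  have e2 : (1 + 2 : Fin 3) = 0 := rfl
  have e3 : (2 + 1 : Fin 3) = 0 := rfl
  have e4 : (2 + 2 : Fin 3) = 1 := rfl
  simp only [zero_add, e1, e2, e3, e4, eps_zero, eps_one, eps_two, one_smul, neg_smul,
    neg_neg] at a0 a1 a2 b0 b1 b2
  exact ⟨⟨h.phi_self x 0, a0, b2⟩, ⟨b0, h.phi_self x 1, a1⟩, ⟨a2, b1, h.phi_self x 2⟩⟩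

/-- The products `Φ_s Φ_t`. -/
lemma phi_phi_table (u : TangentSpace 𝓘(ℝ, Model n) x) :
    (D (ξ 0) x (D (ξ 0) x u) = u + g x (ξ 0 x) u • ξ 0 x ∧
      D (ξ 0) x (D (ξ 1) x u) = D (ξ 2) x u + g x (ξ 1 x) u • ξ 0 x ∧
      D (ξ 0) x (D (ξ 2) x u) = D (ξ 1) x u + g x (ξ 2 x) u • ξ 0 x) ∧
    (D (ξ 1) x (D (ξ 0) x u) = -D (ξ 2) x u + g x (ξ 0 x) u • ξ 1 x ∧
      D (ξ 1) x (D (ξ 1) x u) = u + g x (ξ 1 x) u • ξ 1 x ∧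
      D (ξ 1) x (D (ξ 2) x u) = -D (ξ 0) x u + g x (ξ 2 x) u • ξ 1 x) ∧
    (D (ξ 2) x (D (ξ 0) x u) = -D (ξ 1) x u + g x (ξ 0 x) u • ξ 2 x ∧
      D (ξ 2) x (D (ξ 1) x u) = D (ξ 0) x u + g x (ξ 1 x) u • ξ 2 x ∧
      D (ξ 2) x (D (ξ 2) x u) = -u + g x (ξ 2 x) u • ξ 2 x) := by
  have a0 := h.phi_mul x 0 u
  have a1 := h.phi_mul x 1 u
  have a2 := h.phi_mul x 2 u
  have b0 := h.phi_mul' x 0 u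
  have b1 := h.phi_mul' x 1 u
  have b2 := h.phi_mul' x 2 u
  have c0 := h.phi_sq x 0 u
  have c1 := h.phi_sq x 1 u
  have c2 := h.phi_sq x 2 u
  have e1 : (1 + 1 : Fin 3) = 2 := rfl
  have e2 : (1 + 2 : Fin 3) = 0 := rfl
  have e3 : (2 + 1 : Fin 3) = 0 := rfl
  have e4 : (2 + 2 : Fin 3) = 1 := rfl
  simp only [zero_add, e1, e2, e3, e4, eps_zero, eps_one, eps_two, one_smul, neg_smul,
    neg_neg] at a0 a1 a2 b0 b1 b2 c0 c1 c2
  exact ⟨⟨c0, a0, b2⟩, ⟨b0, c1, a1⟩, ⟨a2, b1, c2⟩⟩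

/-- The values `g(ξ_s, ξ_t)`. -/
lemma orthogonal_table :
    (g x (ξ 0 x) (ξ 0 x) = -1 ∧ g x (ξ 0 x) (ξ 1 x) = 0 ∧ g x (ξ 0 x) (ξ 2 x) = 0) ∧
    (g x (ξ 1 x) (ξ 0 x) = 0 ∧ g x (ξ 1 x) (ξ 1 x) = -1 ∧ g x (ξ 1 x) (ξ 2 x) = 0) ∧
    (g x (ξ 2 x) (ξ 0 x) = 0 ∧ g x (ξ 2 x) (ξ 1 x) = 0 ∧ g x (ξ 2 x) (ξ 2 x) = 1) := by
  simp [h.orthogonal]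

/-- `g(ξ_s, Φ_t u)` in terms of the `g(ξ_r, u)`. -/
lemma metric_phi_table (u : TangentSpace 𝓘(ℝ, Model n) x) :
    (g x (ξ 0 x) (D (ξ 0) x u) = 0 ∧ g x (ξ 1 x) (D (ξ 0) x u) = -g x (ξ 2 x) u ∧
      g x (ξ 2 x) (D (ξ 0) x u) = -g x (ξ 1 x) u) ∧
    (g x (ξ 0 x) (D (ξ 1) x u) = g x (ξ 2 x) u ∧ g x (ξ 1 x) (D (ξ 1) x u) = 0 ∧
      g x (ξ 2 x) (D (ξ 1) x u) = g x (ξ 0 x) u) ∧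
    (g x (ξ 0 x) (D (ξ 2) x u) = g x (ξ 1 x) u ∧ g x (ξ 1 x) (D (ξ 2) x u) = -g x (ξ 0 x) u ∧
      g x (ξ 2 x) (D (ξ 2) x u) = 0) := by
  obtain ⟨⟨p1, p2, p3⟩, ⟨p4, p5, p6⟩, ⟨p7, p8, p9⟩⟩ := h.phi_table x
  have sk (s t : Fin 3) : g x (ξ s x) (D (ξ t) x u) = -g x (D (ξ t) x (ξ s x)) u := by
    rw [h.skew, neg_neg]
  simp [sk, p1, p2, p3, p4, p5, p6, p7, p8, p9]

/-- The derivatives of the extensions cancel against the bracket because `D` is torsion-free, and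
skewness of `Φ_s` makes the two remaining terms equal. -/
lemma dEta (s : Fin 3) (u v : TangentSpace 𝓘(ℝ, Model n) x) :
    extDeriv₁ (fun y ↦ -eps s • g y (ξ s y)) x u v = -2 * eps s * g x (D (ξ s) x u) v := by
  have hd (u v : TangentSpace 𝓘(ℝ, Model n) x) :
      dirDeriv (fun y ↦ (-eps s • g y (ξ s y)) (ext v y)) x u
        = -eps s * (g x (D (ξ s) x u) v + g x (ξ s x) (D (ext v) x u)) := by
    have h1 := diffAt_metric h.metric.smooth ((h.smooth s).diffAt x) (diffAt_ext v)
    have h2 := dirDeriv_const_mul (u := u) (-eps s) h1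
    rw [h.leviCivita.metric _ _ _ _ ((h.smooth s).diffAt x) (diffAt_ext v), ext_self] at h2
    exact h2
  rw [extDeriv₁, hd, hd, h.leviCivita.bracket_eq (diffAt_ext u) (diffAt_ext v)]
  simp only [ext_self, smul_apply, map_sub, smul_eq_mul]
  rw [h.skew x s v u, h.symm x v]
  ring

end IsPara3Sasakian

end

/-! ### Horizontal and vertical projections, neutral orthonormal frames, contractions -/

section

/-- A nondegenerate symmetric form with a product structure that is an anti-isometry has an
orthonormal basis of neutral signature. -/
lemma exists_neutral_frame {W : Type*} [AddCommGroup W] [Module ℝ W] [FiniteDimensional ℝ W]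
    (b : W →ₗ[ℝ] W →ₗ[ℝ] ℝ) (hs : ∀ u v, b u v = b v u) (hn : ∀ u, (∀ v, b u v = 0) → u = 0)
    (J : W →ₗ[ℝ] W) (hJ : ∀ u, J (J u) = u) (hb : ∀ u v, b (J u) (J v) = -b u v) {m : ℕ}
    (hm : Module.finrank ℝ W = 2 * m) :
    ∃ e : Fin m ⊕ Fin m → W,
      ∀ p q, b (e p) (e q) = if p = q then Sum.elim (fun _ ↦ 1) (fun _ ↦ -1) p else 0 := by
  -- The `±1` eigenspaces of `J` are complementary, and each is totally isotropic because `J` is an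
  -- anti-isometry.
  let P := LinearMap.ker (J - LinearMap.id)
  let Q := LinearMap.ker (J + LinearMap.id)
  have hP (u : W) : u ∈ P ↔ J u = u := by simp [P, sub_eq_zero]
  have hQ (u : W) : u ∈ Q ↔ J u = -u := by simp [Q, add_eq_zero_iff_eq_neg]
  have hPP (u v : W) (hu : u ∈ P) (hv : v ∈ P) : b u v = 0 := by
    have := hb u v
    rw [(hP u).1 hu, (hP v).1 hv] at this
    linarith
  have hQQ (u v : W) (hu : u ∈ Q) (hv : v ∈ Q) : b u v = 0 := by
    have := hb u v
    rw [(hQ u).1 hu, (hQ v).1 hv] at this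
    simp only [map_neg, LinearMap.neg_apply, neg_neg] at this
    linarith
  have hdec (u : W) : ∃ p ∈ P, ∃ q ∈ Q, u = p + q :=
    ⟨(1 / 2 : ℝ) • (u + J u), (hP _).2 (by simp only [map_smul, map_add, hJ]; module),
      (1 / 2 : ℝ) • (u - J u), (hQ _).2 (by simp only [map_smul, map_sub, hJ]; module), by module⟩
  have hsup : P ⊔ Q = ⊤ := by
    refine eq_top_iff.2 fun u _ ↦ ?_
    obtain ⟨p, hp, q, hq, rfl⟩ := hdec u
    exact Submodule.add_mem_sup hp hq
  have hinf : P ⊓ Q = ⊥ := by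
    refine eq_bot_iff.2 fun u hu ↦ ?_
    refine hn u fun v ↦ ?_
    obtain ⟨p, hp, q, hq, rfl⟩ := hdec v
    rw [map_add, hPP u p hu.1 hp, hQQ u q hu.2 hq, add_zero]
  -- Nondegeneracy makes the pairing between `P` and `Q` injective on both sides, so both have
  -- dimension `m` and `Q` is the dual of `P`.
  let φ : Q →ₗ[ℝ] Module.Dual ℝ P := (b.compl₂ P.subtype).comp Q.subtype
  let ψ : P →ₗ[ℝ] Module.Dual ℝ Q := (b.compl₂ Q.subtype).comp P.subtype
  have hφ : Function.Injective φ := by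
    refine (injective_iff_map_eq_zero φ).2 fun u hu ↦ Subtype.ext (hn u fun v ↦ ?_)
    obtain ⟨p, hp, q, hq, rfl⟩ := hdec v
    rw [map_add, hQQ u q u.2 hq, add_zero]
    exact LinearMap.congr_fun hu ⟨p, hp⟩
  have hψ : Function.Injective ψ := by
    refine (injective_iff_map_eq_zero ψ).2 fun u hu ↦ Subtype.ext (hn u fun v ↦ ?_)
    obtain ⟨p, hp, q, hq, rfl⟩ := hdec v
    rw [map_add, hPP u p u.2 hp, zero_add]
    exact LinearMap.congr_fun hu ⟨q, hq⟩
  have hd1 := LinearMap.finrank_le_finrank_of_injective hφ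
  have hd2 := LinearMap.finrank_le_finrank_of_injective hψ
  rw [Subspace.dual_finrank_eq] at hd1 hd2
  have hd3 := Submodule.finrank_sup_add_finrank_inf_eq P Q
  rw [hsup, hinf, finrank_top, finrank_bot, hm] at hd3
  have hdP : Module.finrank ℝ P = m := by omega
  have hsurj : Function.Surjective φ :=
    (LinearMap.injective_iff_surjective_of_finrank_eq_finrank
      (by rw [Subspace.dual_finrank_eq]; omega)).1 hφ
  let f : Module.Basis (Fin m) ℝ P := Module.finBasisOfFinrankEq ℝ P hdP
  choose k hk using fun a ↦ hsurj (f.coord a)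
  have hkf (a c : Fin m) : b (k a) (f c) = if a = c then 1 else 0 := by
    have := LinearMap.congr_fun (hk a) (f c)
    rw [Module.Basis.coord_apply, f.repr_self, Finsupp.single_apply] at this
    simp only [eq_comm (a := a)]
    exact this
  have hfk (a c : Fin m) : b (f a) (k c) = if a = c then 1 else 0 := by
    rw [hs, hkf]; simp only [eq_comm]
  -- For dual isotropic bases `f`, `k`, the vectors `f ± k/2` have square `±2 · (1/2) = ±1`.
  refine ⟨Sum.elim (fun a ↦ (f a : W) + (1 / 2 : ℝ) • (k a : W))
    (fun a ↦ (f a : W) - (1 / 2 : ℝ) • (k a : W)), ?_⟩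
  rintro (a | a) (c | c) <;>
  · simp only [Sum.elim_inl, Sum.elim_inr, map_add, map_sub, map_smul, LinearMap.add_apply,
      LinearMap.sub_apply, LinearMap.smul_apply, hfk, hkf, hPP _ _ (f a).2 (f c).2,
      hQQ _ _ (k a).2 (k c).2, smul_eq_mul, Sum.inl.injEq, Sum.inr.injEq, reduceCtorEq]
    by_cases hac : a = c <;> simp [hac] <;> norm_num

section Contraction

variable {E ι : Type*} [AddCommGroup E] [Module ℝ E] [Fintype ι]

lemma isLinearMap_sum {L : E → ℝ} (hL : IsLinearMap ℝ L) (c : ι → ℝ) (e : ι → E) :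
    L (∑ a, c a • e a) = ∑ a, c a * L (e a) := by
  have h1 (u : E) : L u = hL.mk' L u := rfl
  simp only [h1, map_sum, map_smul, smul_eq_mul]

/-- Shifting a skew-symmetric endomorphism in a contraction. -/
lemma sum_contraction_skew {b : E → E → ℝ} {e : ι → E} {J : E → E}
    (hJ : ∀ a, ∑ c, (b (e c) (e c) * b (e c) (J (e a))) • e c = J (e a))
    (hb : ∀ a c, b (e a) (J (e c)) = -b (e c) (J (e a)))
    {F : E → E → ℝ} (hF₁ : ∀ v, IsLinearMap ℝ (fun u ↦ F u v)) (hF₂ : ∀ u, IsLinearMap ℝ (F u)) :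
    ∑ a, b (e a) (e a) * F (J (e a)) (e a) = -∑ a, b (e a) (e a) * F (e a) (J (e a)) := by
  have h1 (a : ι) : F (J (e a)) (e a)
      = ∑ c, (b (e c) (e c) * b (e c) (J (e a))) * F (e c) (e a) := by
    conv_lhs => rw [← hJ a]
    exact isLinearMap_sum (hF₁ (e a)) _ _
  have h2 (a : ι) : F (e a) (J (e a))
      = ∑ c, (b (e c) (e c) * b (e c) (J (e a))) * F (e a) (e c) := by
    conv_lhs => rw [← hJ a]
    exact isLinearMap_sum (hF₂ (e a)) _ _
  simp only [h1, h2, Finset.mul_sum]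
  rw [Finset.sum_comm, ← Finset.sum_neg_distrib]
  refine Finset.sum_congr rfl fun a _ ↦ ?_
  rw [← Finset.sum_neg_distrib]
  refine Finset.sum_congr rfl fun c _ ↦ ?_
  rw [hb a c]
  ring

end Contraction

variable {n : ℕ} {M : Type*} [TopologicalSpace M] [ChartedSpace (Model n) M]
  [IsManifold 𝓘(ℝ, Model n) ∞ M]

variable {g : TwoTensor n M} {D : Connection n M} {ξ : Fin 3 → VField n M}

lemma mem_H {x : M} {u : TangentSpace 𝓘(ℝ, Model n) x} :
    u ∈ (ofPara3Sasakian g D ξ).H x ↔ ∀ s, g x (ξ s x) u = 0 := by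
  simp only [PqcData.H, Submodule.mem_iInf, LinearMap.mem_ker]
  refine forall_congr' fun s ↦ ?_
  change -eps s * g x (ξ s x) u = 0 ↔ _
  simp [eps_ne_zero]

namespace IsPara3Sasakian

variable (h : IsPara3Sasakian g D ξ) (x : M)
include h

lemma phi_mem_H (s : Fin 3) {u : TangentSpace 𝓘(ℝ, Model n) x}
    (hu : u ∈ (ofPara3Sasakian g D ξ).H x) : D (ξ s) x u ∈ (ofPara3Sasakian g D ξ).H x := by
  rw [mem_H] at hu ⊢
  obtain ⟨⟨p1, p2, p3⟩, ⟨p4, p5, p6⟩, ⟨p7, p8, p9⟩⟩ := h.metric_phi_table x u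
  have h0 := hu 0
  have h1 := hu 1
  have h2 := hu 2
  intro t
  fin_cases s <;> fin_cases t <;> simp [p1, p2, p3, p4, p5, p6, p7, p8, p9, h0, h1, h2]

lemma eta_xi (s t : Fin 3) :
    (ofPara3Sasakian g D ξ).η s x (ξ t x) = if s = t then 1 else 0 := by
  change -eps s * g x (ξ s x) (ξ t x) = _
  rw [h.orthogonal]
  split_ifs <;> simp

lemma projV_apply (u : TangentSpace 𝓘(ℝ, Model n) x) :
    (ofPara3Sasakian g D ξ).projV x u = ∑ s, (-eps s * g x (ξ s x) u) • ξ s x := by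
  simp only [PqcData.projV, sum_apply]
  rfl

lemma projH_apply (u : TangentSpace 𝓘(ℝ, Model n) x) :
    (ofPara3Sasakian g D ξ).projH x u = u - ∑ s, (-eps s * g x (ξ s x) u) • ξ s x := by
  rw [← h.projV_apply]; rfl

lemma projH_mem (u : TangentSpace 𝓘(ℝ, Model n) x) :
    (ofPara3Sasakian g D ξ).projH x u ∈ (ofPara3Sasakian g D ξ).H x := by
  rw [mem_H, h.projH_apply]
  intro t
  simp only [map_sub, map_sum, map_smul, h.orthogonal, smul_eq_mul]
  fin_cases t <;> simp

lemma projV_mem (u : TangentSpace 𝓘(ℝ, Model n) x) :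
    (ofPara3Sasakian g D ξ).projV x u ∈ (ofPara3Sasakian g D ξ).V x := by
  rw [h.projV_apply]
  exact Submodule.sum_mem _ fun s _ ↦ Submodule.smul_mem _ _ (Submodule.subset_span ⟨s, rfl⟩)

lemma projH_of_mem {u : TangentSpace 𝓘(ℝ, Model n) x}
    (hu : u ∈ (ofPara3Sasakian g D ξ).H x) : (ofPara3Sasakian g D ξ).projH x u = u := by
  rw [h.projH_apply]
  simp [mem_H.1 hu]

lemma projV_of_mem {u : TangentSpace 𝓘(ℝ, Model n) x}
    (hu : u ∈ (ofPara3Sasakian g D ξ).V x) : (ofPara3Sasakian g D ξ).projV x u = u := by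
  induction hu using Submodule.span_induction with
  | mem v hv =>
    obtain ⟨t, rfl⟩ := hv
    change (ofPara3Sasakian g D ξ).projV x (ξ t x) = ξ t x
    rw [h.projV_apply]
    simp [h.orthogonal]
  | zero => simp
  | add u v _ _ hu hv => rw [map_add, hu, hv]
  | smul c u _ hu => rw [map_smul, hu]

lemma metric_V_H {u v : TangentSpace 𝓘(ℝ, Model n) x} (hu : u ∈ (ofPara3Sasakian g D ξ).V x)
    (hv : v ∈ (ofPara3Sasakian g D ξ).H x) : g x u v = 0 := by
  rw [← h.projV_of_mem x hu, h.projV_apply]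
  simp [mem_H.1 hv]

lemma projH_add_projV (u : TangentSpace 𝓘(ℝ, Model n) x) :
    (ofPara3Sasakian g D ξ).projH x u + (ofPara3Sasakian g D ξ).projV x u = u := by
  simp [PqcData.projH]

/-- The metric is nondegenerate on the horizontal space. -/
lemma nondegenerate_H {u : TangentSpace 𝓘(ℝ, Model n) x}
    (hu : u ∈ (ofPara3Sasakian g D ξ).H x)
    (h0 : ∀ v ∈ (ofPara3Sasakian g D ξ).H x, g x u v = 0) : u = 0 := by
  refine h.metric.nondegenerate fun v ↦ ?_
  rw [← h.projH_add_projV x v, map_add, h0 _ (h.projH_mem x v), h.symm,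
    h.metric_V_H x (h.projV_mem x v) hu, add_zero]

lemma finrank_H : Module.finrank ℝ ((ofPara3Sasakian g D ξ).H x) = 4 * n := by
  let S := ofPara3Sasakian g D ξ
  let L : TangentSpace 𝓘(ℝ, Model n) x →ₗ[ℝ] (Fin 3 → ℝ) :=
    LinearMap.pi fun s ↦ (S.η s x).toLinearMap
  have hL : LinearMap.range L = ⊤ := by
    refine LinearMap.range_eq_top.2 fun c ↦ ⟨∑ t, c t • ξ t x, ?_⟩
    ext s
    simp only [L, LinearMap.pi_apply, map_sum, map_smul]
    change ∑ t, c t • S.η s x (ξ t x) = c s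
    simp [S, h.eta_xi]
  have hker : LinearMap.ker L = S.H x := LinearMap.ker_pi _
  have hT : FiniteDimensional ℝ (TangentSpace 𝓘(ℝ, Model n) x) :=
    inferInstanceAs (FiniteDimensional ℝ (Model n))
  have hfr : Module.finrank ℝ (TangentSpace 𝓘(ℝ, Model n) x) = 4 * n + 3 :=
    (finrank_euclideanSpace_fin : Module.finrank ℝ (Model n) = 4 * n + 3)
  have h1 := LinearMap.finrank_range_add_finrank_ker L
  rw [hL, hker, finrank_top, Module.finrank_fin_fun, hfr] at h1
  change Module.finrank ℝ (S.H x) = 4 * n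
  omega

/-- The signature `(2n, 2n)` is not extracted from that of `g`: on `H` the map `I_1` is an
involution with `g(I_1 u, I_1 v) = -g(u, v)`, which suffices together with nondegeneracy and the
dimension `4n`. -/
lemma exists_frame : ∃ e, (ofPara3Sasakian g D ξ).IsFrame x e := by
  let S := ofPara3Sasakian g D ξ
  have hT : FiniteDimensional ℝ (TangentSpace 𝓘(ℝ, Model n) x) :=
    inferInstanceAs (FiniteDimensional ℝ (Model n))
  let b : S.H x →ₗ[ℝ] S.H x →ₗ[ℝ] ℝ := LinearMap.mk₂ ℝ (fun u v ↦ g x u v)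
    (by intros; simp) (by intros; simp) (by intros; simp) (by intros; simp)
  let J : S.H x →ₗ[ℝ] S.H x :=
    (D (ξ 0) x).toLinearMap.restrict fun u hu ↦ h.phi_mem_H x 0 hu
  have hJ (u : S.H x) : (J u : TangentSpace 𝓘(ℝ, Model n) x) = D (ξ 0) x u := rfl
  have hJJ (u : TangentSpace 𝓘(ℝ, Model n) x) (hu : u ∈ S.H x) :
      D (ξ 0) x (D (ξ 0) x u) = u := by
    rw [h.phi_sq, mem_H.1 hu]; simp
  obtain ⟨e, he⟩ := exists_neutral_frame b (fun u v ↦ h.symm x u v)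
    (fun u hu ↦ Subtype.ext (h.nondegenerate_H x u.2 fun v hv ↦ hu ⟨v, hv⟩)) J
    (fun u ↦ Subtype.ext (hJJ u u.2))
    (fun u v ↦ by
      change g x (D (ξ 0) x u) (D (ξ 0) x v) = -g x u v
      rw [h.skew, hJJ v v.2])
    (m := 2 * n) (by rw [h.finrank_H]; ring)
  exact ⟨fun a ↦ e a, fun a ↦ (e a).2, he⟩

section Frame

variable {x} {e : Fin (2 * n) ⊕ Fin (2 * n) → TangentSpace 𝓘(ℝ, Model n) x}
  (he : (ofPara3Sasakian g D ξ).IsFrame x e)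
include he

lemma frame_metric (a b) :
    g x (e a) (e b) = if a = b then Sum.elim (fun _ ↦ 1) (fun _ ↦ -1) a else 0 := he.2 a b

lemma frame_mul_self (a) : g x (e a) (e a) * g x (e a) (e a) = 1 := by
  rw [h.frame_metric he, if_pos rfl]
  rcases a with a | a <;> simp

/-- The frame consists of `4n` independent vectors in a space of dimension `4n`, so it spans `H`.
The difference of the two sides is orthogonal to the frame, hence zero by nondegeneracy. -/
lemma frame_sum {u : TangentSpace 𝓘(ℝ, Model n) x} (hu : u ∈ (ofPara3Sasakian g D ξ).H x) :
    ∑ a, (g x (e a) (e a) * g x (e a) u) • e a = u := by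
  let S := ofPara3Sasakian g D ξ
  have hT : FiniteDimensional ℝ (TangentSpace 𝓘(ℝ, Model n) x) :=
    inferInstanceAs (FiniteDimensional ℝ (Model n))
  have horth (a b) (hab : a ≠ b) : g x (e a) (e b) = 0 := by rw [h.frame_metric he, if_neg hab]
  let f : Fin (2 * n) ⊕ Fin (2 * n) → S.H x := fun a ↦ ⟨e a, he.1 a⟩
  have hli : LinearIndependent ℝ f := by
    refine Fintype.linearIndependent_iff.2 fun c hc a ↦ ?_
    have h1 : ∑ b, c b • e b = 0 := by simpa [f] using congrArg (Subtype.val) hc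
    have h2 := congrArg (g x (e a)) h1
    rw [map_sum, map_zero, Finset.sum_eq_single a (fun b _ hb ↦ by
      rw [map_smul, horth a b hb.symm, smul_zero]) (by simp)] at h2
    have h3 := h.frame_mul_self he a
    rw [map_smul, smul_eq_mul] at h2
    rcases mul_eq_zero.1 h2 with h4 | h4
    · exact h4
    · rw [h4] at h3; simp at h3
  have hsp : Submodule.span ℝ (Set.range f) = ⊤ :=
    hli.span_eq_top_of_card_eq_finrank' (by
      have := h.finrank_H x
      simp only [Fintype.card_sum, Fintype.card_fin]
      change _ = Module.finrank ℝ (S.H x)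
      change Module.finrank ℝ (S.H x) = _ at this
      omega)
  refine sub_eq_zero.1 (h.nondegenerate_H x (Submodule.sub_mem _ (Submodule.sum_mem _ fun a _ ↦
    Submodule.smul_mem _ _ (he.1 a)) hu) fun v hv ↦ ?_)
  have hv' : (⟨v, hv⟩ : S.H x) ∈ Submodule.span ℝ (Set.range f) := hsp ▸ Submodule.mem_top
  obtain ⟨c, hc⟩ := (Submodule.mem_span_range_iff_exists_fun ℝ).1 hv'
  have hc' : v = ∑ b, c b • e b := by
    have := congrArg Subtype.val hc
    simpa [f] using this.symm
  rw [hc', map_sum]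
  refine Finset.sum_eq_zero fun b _ ↦ ?_
  rw [map_smul, map_sub, map_sum, sub_apply, sum_apply, Finset.sum_eq_single b (fun a _ ha ↦ by
    rw [map_smul, smul_apply, horth a b ha, smul_zero]) (by simp), map_smul, smul_apply,
    h.symm x u (e b)]
  simp only [smul_eq_mul]
  linear_combination c b * g x (e b) u * h.frame_mul_self he b

/-- Contraction of a linear form against the metric. -/
lemma frame_sum_linear {L : TangentSpace 𝓘(ℝ, Model n) x → ℝ} (hL : IsLinearMap ℝ L)
    {u : TangentSpace 𝓘(ℝ, Model n) x} (hu : u ∈ (ofPara3Sasakian g D ξ).H x) :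
    ∑ a, g x (e a) (e a) * (g x (e a) u * L (e a)) = L u := by
  conv_rhs => rw [← h.frame_sum he hu, isLinearMap_sum hL]
  exact Finset.sum_congr rfl fun a _ ↦ by ring

/-- `Φ_s` is skew-symmetric in contractions over the horizontal space. -/
lemma frame_sum_phi (s : Fin 3) {F : TangentSpace 𝓘(ℝ, Model n) x → TangentSpace 𝓘(ℝ, Model n) x → ℝ}
    (hF₁ : ∀ v, IsLinearMap ℝ (fun u ↦ F u v)) (hF₂ : ∀ u, IsLinearMap ℝ (F u)) :
    ∑ a, g x (e a) (e a) * F (D (ξ s) x (e a)) (e a)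
      = -∑ a, g x (e a) (e a) * F (e a) (D (ξ s) x (e a)) :=
  sum_contraction_skew (b := fun u v ↦ g x u v) (J := D (ξ s) x)
    (fun a ↦ h.frame_sum he (h.phi_mem_H x s (he.1 a)))
    (fun a c ↦ by rw [h.symm, h.skew]) hF₁ hF₂

lemma frame_sum_one : ∑ a, g x (e a) (e a) * g x (e a) (e a) = 4 * n := by
  simp only [h.frame_mul_self he]
  simp; ring

end Frame

end IsPara3Sasakian

end

/-! ### The pqc structure and its structure equations -/

section

variable {n : ℕ} {M : Type*} [TopologicalSpace M] [ChartedSpace (Model n) M]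
  [IsManifold 𝓘(ℝ, Model n) ∞ M]

variable {g : TwoTensor n M} {D : Connection n M} {ξ : Fin 3 → VField n M}

lemma smoothOneForm_metric (hg : SmoothTwoTensor g) {A : VField n M} (hA : SmoothField A) :
    SmoothOneForm (fun y ↦ g y (A y)) :=
  ContMDiff.clm_bundle_apply (b := fun y : M ↦ y) (hϕ := hg) (hv := hA)
    (E₂ := fun y : M ↦ TangentSpace 𝓘(ℝ, Model n) y →L[ℝ] ℝ) (F₂ := Model n →L[ℝ] ℝ)

lemma SmoothOneForm.const_smul (c : ℝ) {α : OneForm n M} (hα : SmoothOneForm α) :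
    SmoothOneForm (fun y ↦ c • α y) :=
  ContMDiff.const_smul_section hα

lemma fin_three_add : ∀ i : Fin 3,
    i + 1 + 1 = i + 2 ∧ i + 1 + 2 = i ∧ i + 2 + 1 = i ∧ i + 2 + 2 = i + 1 := by decide

namespace IsPara3Sasakian

variable (h : IsPara3Sasakian g D ξ) (x : M)
include h

lemma smooth_eta (s : Fin 3) : SmoothOneForm ((ofPara3Sasakian g D ξ).η s) :=
  (smoothOneForm_metric h.metric.smooth (h.smooth s)).const_smul (-eps s)

lemma isPqc [T2Space M] : (ofPara3Sasakian g D ξ).IsPqc where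
  smooth_g := h.metric.smooth
  smooth_η := h.smooth_eta
  smooth_ξ := h.smooth
  smooth_I s := conn_smoothEndField h.leviCivita.smooth (h.smooth s)
  symm := h.metric.symm
  neutral := h.exists_frame
  dual s t x := h.eta_xi x s t
  metric_V := h.orthogonal
  metric_HV s x X hX := mem_H.1 hX s
  I_mem s x X hX := h.phi_mem_H x s hX
  I_sq s x X hX := by
    change D (ξ s) x (D (ξ s) x X) = _
    rw [h.phi_sq, mem_H.1 hX, zero_smul, add_zero]
  I_mul i x X hX := by
    change D (ξ i) x (D (ξ (i + 1)) x X) = _ ∧ D (ξ (i + 1)) x (D (ξ i) x X) = _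
    rw [h.phi_mul, h.phi_mul', mem_H.1 hX, mem_H.1 hX]
    simp only [zero_smul, add_zero]
    exact ⟨rfl, rfl⟩
  compatible s x X hX Y hY := by
    change g x (D (ξ s) x X) (D (ξ s) x Y) = -eps s * g x X Y
    rw [h.skew, h.phi_sq, mem_H.1 hY, zero_smul, add_zero, map_smul, smul_eq_mul, neg_mul]
  contact s x X _ Y _ := h.dEta x s X Y
  reeb_self s x X _ := by
    refine (h.dEta x s (ξ s x) X).trans ?_
    rw [h.phi_self]; simp
  reeb i x X hX := by
    -- Both sides vanish, since `Φ_i ξ_{i+1}` and `Φ_{i+1} ξ_i` are multiples of `ξ_{i+2}`, which is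
    -- orthogonal to `X`.
    have h1 := h.dEta x i (ξ (i + 1) x) X
    have h2 := h.dEta x (i + 1) (ξ i x) X
    rw [h.phi_next, map_neg, map_smul, neg_apply, smul_apply, mem_H.1 hX] at h1
    rw [h.phi_prev, map_smul, smul_apply, mem_H.1 hX] at h2
    simp only [smul_zero, neg_zero, mul_zero] at h1 h2
    exact h1.trans (by rw [show extDeriv₁ ((ofPara3Sasakian g D ξ).η (i + 1)) x
      ((ofPara3Sasakian g D ξ).ξ i x) X = 0 from h2, mul_zero])

lemma dEta_xi (s t : Fin 3) :
    (∀ X ∈ (ofPara3Sasakian g D ξ).H x,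
      extDeriv₁ ((ofPara3Sasakian g D ξ).η s) x (ξ t x) X = 0) ∧
      extDeriv₁ ((ofPara3Sasakian g D ξ).η s) x (ξ t x) (ξ s x) = 0 := by
  refine ⟨fun X hX ↦ (h.dEta x s (ξ t x) X).trans ?_, (h.dEta x s (ξ t x) (ξ s x)).trans ?_⟩
  · rw [h.skew, h.symm, h.skew, ← mul_neg_one]
    have := mem_H.1 (h.phi_mem_H x s hX) t
    rw [h.symm] at this
    rw [h.symm x X, h.skew, h.symm x (ξ t x)]
    simp [this]
  · rw [h.skew, h.phi_self]; simp

lemma dEta_xi_xi (i : Fin 3) :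
    extDeriv₁ ((ofPara3Sasakian g D ξ).η i) x (ξ (i + 1) x) (ξ (i + 2) x) = -2 * eps i := by
  refine (h.dEta x i (ξ (i + 1) x) (ξ (i + 2) x)).trans ?_
  rw [h.phi_next, map_neg, map_smul, neg_apply, smul_apply, h.orthogonal, if_pos rfl]
  have := eps_mul_self (i + 2)
  simp only [smul_eq_mul]
  linear_combination (-2 * eps i) * this

/-- The fundamental 2-forms on arbitrary tangent vectors. -/
lemma omega_eq (i : Fin 3) (u v : TangentSpace 𝓘(ℝ, Model n) x) :
    (ofPara3Sasakian g D ξ).omega i x u v = g x (D (ξ i) x u) v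
      - wedge₁₁ ((ofPara3Sasakian g D ξ).η (i + 1)) ((ofPara3Sasakian g D ξ).η (i + 2)) x u v := by
  change g x (D (ξ i) x ((ofPara3Sasakian g D ξ).projH x u)) ((ofPara3Sasakian g D ξ).projH x v)
    = g x (D (ξ i) x u) v - ((-eps (i + 1) * g x (ξ (i + 1) x) u)
        * (-eps (i + 2) * g x (ξ (i + 2) x) v)
      - (-eps (i + 1) * g x (ξ (i + 1) x) v) * (-eps (i + 2) * g x (ξ (i + 2) x) u))
  rw [h.symm x _ ((ofPara3Sasakian g D ξ).projH x v), h.projH_apply x v, map_sub, sub_apply,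
    map_sum, sum_apply]
  simp only [map_smul, smul_apply, mem_H.1 (h.phi_mem_H x i (h.projH_mem x u)), smul_zero,
    Finset.sum_const_zero, sub_zero]
  rw [h.projH_apply, map_sub, map_sum, map_sub, map_sum]
  simp only [map_smul, h.symm x v]
  -- Only the vertical block is left to compare: there `g(Φ_i ·, ·)` is `η_{i+1} ∧ η_{i+2}`, as the
  -- values `Φ_s ξ_t` show.
  obtain ⟨⟨p1, p2, p3⟩, ⟨p4, p5, p6⟩, ⟨p7, p8, p9⟩⟩ := h.phi_table x
  fin_cases i <;>
  · simp [Fin.sum_univ_three, p1, p2, p3, p4, p5, p6, p7, p8, p9]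
    ring

lemma omega_eq_of_mem (i : Fin 3) {u v : TangentSpace 𝓘(ℝ, Model n) x}
    (hu : u ∈ (ofPara3Sasakian g D ξ).H x) (hv : v ∈ (ofPara3Sasakian g D ξ).H x) :
    (ofPara3Sasakian g D ξ).omega i x u v = g x (D (ξ i) x u) v := by
  simp only [PqcData.omega, h.projH_of_mem x hu, h.projH_of_mem x hv]
  rfl

lemma dEta_eq (i : Fin 3) (u v : TangentSpace 𝓘(ℝ, Model n) x) :
    extDeriv₁ ((ofPara3Sasakian g D ξ).η i) x u v
      = -2 * eps i * (ofPara3Sasakian g D ξ).omega i x u v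
        - 2 * eps i * wedge₁₁ ((ofPara3Sasakian g D ξ).η (i + 1))
          ((ofPara3Sasakian g D ξ).η (i + 2)) x u v := by
  rw [h.omega_eq]
  refine (h.dEta x i u v).trans ?_
  ring

variable {x} {B C : VField n M}

lemma dirDeriv_eta (s : Fin 3) (u : TangentSpace 𝓘(ℝ, Model n) x) (hB : DiffAt B x) :
    dirDeriv (fun y ↦ (ofPara3Sasakian g D ξ).η s y (B y)) x u
      = -eps s * (g x (D (ξ s) x u) (B x)) + (ofPara3Sasakian g D ξ).η s x (D B x u) := by
  have h1 := diffAt_metric h.metric.smooth ((h.smooth s).diffAt x) hB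
  have h2 := dirDeriv_const_mul (u := u) (-eps s) h1
  rw [h.leviCivita.metric _ _ _ _ ((h.smooth s).diffAt x) hB, mul_add] at h2
  exact h2

lemma diffAt_eta (s : Fin 3) (hB : DiffAt B x) :
    FunDiffAt (n := n) (fun y ↦ (ofPara3Sasakian g D ξ).η s y (B y)) x :=
  (diffAt_metric h.metric.smooth ((h.smooth s).diffAt x) hB).const_mul (-eps s)

variable [T2Space M]

lemma diffAt_phi (s : Fin 3) (hB : DiffAt B x) : DiffAt (fun y ↦ D (ξ s) y (B y)) x :=
  (conn_smoothEndField h.leviCivita.smooth (h.smooth s)).diffAt_apply hB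

lemma conn_phi (s : Fin 3) (u : TangentSpace 𝓘(ℝ, Model n) x) (hB : DiffAt B x) :
    D (fun y ↦ D (ξ s) y (B y)) x u
      = D (ξ s) x (D B x u) + (g x (ξ s x) (B x) • u - g x u (B x) • ξ s x) := by
  rw [← h.covDeriv s x u B hB]; abel

/-- The last parenthesis is `(D_u ω_i)(B, C)`. Its first two terms come from `DΦ_i`, the others from
differentiating the wedge product in `omega_eq`. -/
lemma dirDeriv_omega (i : Fin 3) (u : TangentSpace 𝓘(ℝ, Model n) x) (hB : DiffAt B x)
    (hC : DiffAt C x) :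
    dirDeriv (fun y ↦ (ofPara3Sasakian g D ξ).omega i y (B y) (C y)) x u
      = (ofPara3Sasakian g D ξ).omega i x (D B x u) (C x)
        + (ofPara3Sasakian g D ξ).omega i x (B x) (D C x u)
        + (g x (ξ i x) (B x) * g x u (C x) - g x u (B x) * g x (ξ i x) (C x)
          + eps (i + 1) * (g x (D (ξ (i + 1)) x u) (B x) * (ofPara3Sasakian g D ξ).η (i + 2) x (C x)
            - g x (D (ξ (i + 1)) x u) (C x) * (ofPara3Sasakian g D ξ).η (i + 2) x (B x))
          + eps (i + 2) * (g x (D (ξ (i + 2)) x u) (C x) * (ofPara3Sasakian g D ξ).η (i + 1) x (B x)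
            - g x (D (ξ (i + 2)) x u) (B x)
              * (ofPara3Sasakian g D ξ).η (i + 1) x (C x))) := by
  simp only [h.omega_eq, wedge₁₁]
  rw [dirDeriv_sub (diffAt_metric h.metric.smooth (h.diffAt_phi i hB) hC)
      (((h.diffAt_eta _ hB).mul (h.diffAt_eta _ hC)).sub
        ((h.diffAt_eta _ hC).mul (h.diffAt_eta _ hB))),
    dirDeriv_sub ((h.diffAt_eta _ hB).mul (h.diffAt_eta _ hC))
      ((h.diffAt_eta _ hC).mul (h.diffAt_eta _ hB)),
    dirDeriv_mul (h.diffAt_eta _ hB) (h.diffAt_eta _ hC),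
    dirDeriv_mul (h.diffAt_eta _ hC) (h.diffAt_eta _ hB),
    h.leviCivita.metric _ _ _ _ (h.diffAt_phi i hB) hC, h.conn_phi i u hB,
    h.dirDeriv_eta _ u hB, h.dirDeriv_eta _ u hB, h.dirDeriv_eta _ u hC, h.dirDeriv_eta _ u hC]
  simp only [map_add, map_sub, map_smul, add_apply, sub_apply, smul_apply, smul_eq_mul]
  ring

variable (x)

lemma omega_swap (i : Fin 3) (u v : TangentSpace 𝓘(ℝ, Model n) x) :
    (ofPara3Sasakian g D ξ).omega i x u v = -(ofPara3Sasakian g D ξ).omega i x v u := by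
  rw [h.omega_eq, h.omega_eq, h.skew, h.symm x u]
  simp only [wedge₁₁]
  ring

lemma omega_sub (i : Fin 3) (u u' v : TangentSpace 𝓘(ℝ, Model n) x) :
    (ofPara3Sasakian g D ξ).omega i x (u - u') v
      = (ofPara3Sasakian g D ξ).omega i x u v - (ofPara3Sasakian g D ξ).omega i x u' v := by
  simp only [PqcData.omega, map_sub, sub_apply]

-- With a torsion-free connection, `dω_i` is the cyclic sum of `(D_u ω_i)(v, w)`. The terms `g(ξ_i,
-- v) g(u, w) - g(u, v) g(ξ_i, w)` cancel cyclically, and the terms cubic in `η` introduced by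
-- replacing `g(Φ_j ·, ·)` by `ω_j` cancel as well. Naming `j` and `k` keeps index sums such as `i +
-- 1 + 2` out of the computation.
set_option maxHeartbeats 1000000 in
lemma dOmega_of_cyclic (i j k : Fin 3) (hj : i + 1 = j) (hk : i + 2 = k)
    (u v w : TangentSpace 𝓘(ℝ, Model n) x) :
    extDeriv₂ ((ofPara3Sasakian g D ξ).omega i) x u v w
      = 2 * eps j * wedge₂₁ ((ofPara3Sasakian g D ξ).omega j)
          ((ofPara3Sasakian g D ξ).η k) x u v w
        - 2 * eps k * wedge₂₁ ((ofPara3Sasakian g D ξ).omega k)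
          ((ofPara3Sasakian g D ξ).η j) x u v w := by
  have hd (u v w : TangentSpace 𝓘(ℝ, Model n) x) :=
    h.dirDeriv_omega i u (diffAt_ext v) (diffAt_ext w)
  have hb (u v w : TangentSpace 𝓘(ℝ, Model n) x) :
      (ofPara3Sasakian g D ξ).omega i x (bracket (ext u) (ext v) x) w
        = (ofPara3Sasakian g D ξ).omega i x (D (ext v) x u) w
          - (ofPara3Sasakian g D ξ).omega i x (D (ext u) x v) w := by
    rw [h.leviCivita.bracket_eq (diffAt_ext _) (diffAt_ext _), h.omega_sub, ext_self, ext_self]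
  have oj := h.omega_eq x j
  have ok := h.omega_eq x k
  obtain ⟨e1, e2, e3, e4⟩ := fin_three_add i
  rw [hj] at e1 e2
  rw [hk] at e3 e4
  rw [e1, e2, hk] at oj
  rw [e3, e4, hj] at ok
  have e5 (s : Fin 3) (u : TangentSpace 𝓘(ℝ, Model n) x) :
    (ofPara3Sasakian g D ξ).η s x u = -eps s * g x (ξ s x) u := rfl
  have sk (s : Fin 3) (u v : TangentSpace 𝓘(ℝ, Model n) x) :
    g x (D (ξ s) x u) v = -g x (D (ξ s) x v) u := by rw [h.skew, h.symm]
  have sy := h.symm x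
  simp only [ext_self, hj, hk] at hd
  unfold extDeriv₂
  rw [hd, hd, hd, hb, hb, hb, h.omega_swap x i v (D (ext w) x u),
    h.omega_swap x i w (D (ext u) x v), h.omega_swap x i u (D (ext v) x w)]
  simp only [wedge₂₁, oj, ok, wedge₁₁, e5]
  simp only [sy v u, sy w u, sy w v, sk j v u, sk j w u, sk j w v, sk k v u, sk k w u, sk k w v]
  ring

lemma dOmega (i : Fin 3) (u v w : TangentSpace 𝓘(ℝ, Model n) x) :
    extDeriv₂ ((ofPara3Sasakian g D ξ).omega i) x u v w
      = 2 * eps (i + 1) * wedge₂₁ ((ofPara3Sasakian g D ξ).omega (i + 1))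
          ((ofPara3Sasakian g D ξ).η (i + 2)) x u v w
        - 2 * eps (i + 2) * wedge₂₁ ((ofPara3Sasakian g D ξ).omega (i + 2))
          ((ofPara3Sasakian g D ξ).η (i + 1)) x u v w :=
  h.dOmega_of_cyclic x i _ _ rfl rfl u v w

end IsPara3Sasakian

end

/-! ### The explicit candidate for the canonical connection -/

section

variable {n : ℕ} {M : Type*} [TopologicalSpace M] [ChartedSpace (Model n) M]
  [IsManifold 𝓘(ℝ, Model n) ∞ M]

variable {g : TwoTensor n M} {D : Connection n M} {ξ : Fin 3 → VField n M}

lemma contMDiffAt_smulRight {E : Type*} [NormedAddCommGroup E] [NormedSpace ℝ E]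
    {f : M → E →L[ℝ] ℝ} {v : M → E} {x : M}
    (hf : ContMDiffAt 𝓘(ℝ, Model n) 𝓘(ℝ, E →L[ℝ] ℝ) ∞ f x)
    (hv : ContMDiffAt 𝓘(ℝ, Model n) 𝓘(ℝ, E) ∞ v x) :
    ContMDiffAt 𝓘(ℝ, Model n) 𝓘(ℝ, E →L[ℝ] E) ∞ (fun y ↦ (f y).smulRight (v y)) x := by
  have h1 : ContDiff ℝ ∞ (fun p : (E →L[ℝ] ℝ) × E ↦ p.1.smulRight p.2) :=
    contDiff_fst.smulRight contDiff_snd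
  exact h1.contDiffAt.contMDiffAt.comp x (hf.prodMk_space hv)

/-- Checked in the trivialization at `x`, where the field becomes the `smulRight` of two smooth
vector-valued functions. -/
lemma SmoothOneForm.smulRight {α : OneForm n M} (hα : SmoothOneForm α) {A : VField n M}
    (hA : SmoothField A) : SmoothEndField (fun y ↦ (α y).smulRight (A y)) := by
  intro x
  have h1 := ((contMDiffAt_hom_bundle _).1 (hα x)).2
  have h2 := (contMDiffAt_section _).1 (hA x)
  refine (contMDiffAt_hom_bundle _).2 ⟨contMDiffAt_id, ?_⟩
  refine (contMDiffAt_smulRight h1 h2).congr_of_eventuallyEq ?_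
  filter_upwards [(trivializationAt (Model n) (fun y : M ↦ TangentSpace 𝓘(ℝ, Model n) y)
    x).open_baseSet.mem_nhds (FiberBundle.mem_baseSet_trivializationAt' x)] with y hy
  ext1 v
  simp [ContinuousLinearMap.inCoordinates, Trivialization.coe_linearMapAt_of_mem _ hy]

lemma SmoothEndField.add {J K : EndField n M} (hJ : SmoothEndField J) (hK : SmoothEndField K) :
    SmoothEndField (fun y ↦ J y + K y) := ContMDiff.add_section hJ hK

lemma SmoothEndField.sum {ι : Type*} {s : Finset ι} {J : ι → EndField n M}
    (hJ : ∀ i ∈ s, SmoothEndField (J i)) : SmoothEndField (fun y ↦ ∑ i ∈ s, J i y) :=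
  ContMDiff.sum_section hJ

lemma SmoothEndField.smul {J : EndField n M} (hJ : SmoothEndField J) {f : M → ℝ}
    (hf : ∀ x, FunSmoothAt (n := n) f x) : SmoothEndField (fun y ↦ f y • J y) :=
  ContMDiff.smul_section hf hJ

lemma SmoothOneForm.smul {α : OneForm n M} (hα : SmoothOneForm α) {f : M → ℝ}
    (hf : ∀ x, FunSmoothAt (n := n) f x) : SmoothOneForm (fun y ↦ f y • α y) :=
  ContMDiff.smul_section hf hα

lemma SmoothOneForm.sub {α β : OneForm n M} (hα : SmoothOneForm α) (hβ : SmoothOneForm β) :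
    SmoothOneForm (fun y ↦ α y - β y) := ContMDiff.sub_section hα hβ

/-- The difference of the canonical and the Levi-Civita connection. -/
def canonDiff (g : TwoTensor n M) (D : Connection n M) (ξ : Fin 3 → VField n M) (x : M) :
    TangentSpace 𝓘(ℝ, Model n) x →L[ℝ] TangentSpace 𝓘(ℝ, Model n) x →L[ℝ]
      TangentSpace 𝓘(ℝ, Model n) x :=
  have : FiniteDimensional ℝ (TangentSpace 𝓘(ℝ, Model n) x) :=
    inferInstanceAs (FiniteDimensional ℝ (Model n))
  have : T2Space (TangentSpace 𝓘(ℝ, Model n) x) := inferInstanceAs (T2Space (Model n))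
  LinearMap.toContinuousBilinearMap (LinearMap.mk₂ ℝ
    -- The formula adds `canonDiff b u` to `D_u b`. For horizontal `b`, the term `ε_s g(Φ_s b, u)
    -- ξ_s` cancels the vertical part of `D_u b`, and `ε_s g(ξ_s, u) Φ_s b` makes `T(ξ, X)` vanish.
    -- For `b = ξ_t`, the last term cancels `D_u ξ_t = Φ_t u` when `u` is horizontal. The term with
    -- factor `2` matters only when both arguments have vertical parts and is fixed by `∇_u ξ_t =
    -- 2Φ_t u` for vertical `u`, the rotation of `V` that matches the commutators of the `I_s`.
    (fun b u ↦ ∑ s, ((eps s * g x (D (ξ s) x b) u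
        - 2 * (g x (ξ (s + 1) x) u * g x (ξ (s + 2) x) b
          - g x (ξ (s + 2) x) u * g x (ξ (s + 1) x) b)) • ξ s x
      + (eps s * g x (ξ s x) u) • D (ξ s) x b + (eps s * g x (ξ s x) b) • D (ξ s) x u))
    (fun b b' u ↦ by
      rw [← Finset.sum_add_distrib]
      refine Finset.sum_congr rfl fun s _ ↦ ?_
      simp only [map_add, add_apply]
      module)
    (fun c b u ↦ by
      rw [Finset.smul_sum]
      refine Finset.sum_congr rfl fun s _ ↦ ?_
      simp only [map_smul, smul_apply, smul_eq_mul]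
      module)
    (fun b u u' ↦ by
      rw [← Finset.sum_add_distrib]
      refine Finset.sum_congr rfl fun s _ ↦ ?_
      simp only [map_add]
      module)
    (fun c b u ↦ by
      rw [Finset.smul_sum]
      refine Finset.sum_congr rfl fun s _ ↦ ?_
      simp only [map_smul, smul_eq_mul]
      module))

lemma canonDiff_apply (x : M) (b u : TangentSpace 𝓘(ℝ, Model n) x) :
    canonDiff g D ξ x b u = ∑ s, ((eps s * g x (D (ξ s) x b) u
        - 2 * (g x (ξ (s + 1) x) u * g x (ξ (s + 2) x) b
          - g x (ξ (s + 2) x) u * g x (ξ (s + 1) x) b)) • ξ s x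
      + (eps s * g x (ξ s x) u) • D (ξ s) x b + (eps s * g x (ξ s x) b) • D (ξ s) x u) := rfl

/-- The canonical connection of a para 3-Sasakian manifold. -/
def canonConn (g : TwoTensor n M) (D : Connection n M) (ξ : Fin 3 → VField n M) :
    Connection n M := D.addOneForm (canonDiff g D ξ)

lemma canonConn_apply (B : VField n M) (x : M) (u : TangentSpace 𝓘(ℝ, Model n) x) :
    canonConn g D ξ B x u = D B x u + canonDiff g D ξ x (B x) u := rfl

namespace IsPara3Sasakian

variable (h : IsPara3Sasakian g D ξ)
include h

lemma smooth_canonConn [T2Space M] :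
    CovariantDerivative.ContMDiffCovariantDerivative (canonConn g D ξ) ∞ := by
  refine ⟨⟨fun {σ} hσ' ↦ ?_⟩⟩
  have hσ : SmoothField σ := contMDiffOn_univ.1 hσ'
  refine ContMDiff.contMDiffOn ?_
  have hΦ (s : Fin 3) : SmoothEndField (D (ξ s)) :=
    conn_smoothEndField h.leviCivita.smooth (h.smooth s)
  have hΦσ (s : Fin 3) : SmoothField (fun y ↦ D (ξ s) y (σ y)) :=
    fun x ↦ (hΦ s).smoothAt_apply (hσ x)
  have hg (s : Fin 3) : SmoothOneForm (fun y ↦ g y (ξ s y)) :=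
    smoothOneForm_metric h.metric.smooth (h.smooth s)
  have hf (s : Fin 3) (x : M) : FunSmoothAt (n := n) (fun y ↦ g y (ξ s y) (σ y)) x :=
    smoothAt_metric h.metric.smooth (h.smooth s x) (hσ x)
  have hf' (c : ℝ) (s : Fin 3) (x : M) :
      FunSmoothAt (n := n) (fun y ↦ c * g y (ξ s y) (σ y)) x :=
    ContMDiffAt.mul contMDiffAt_const (hf s x)
  -- The same endomorphism field with its argument `u` removed, written through operations that
  -- preserve smooth sections.
  have key : SmoothEndField (fun y ↦ D σ y + ∑ s, (((eps s • g y (D (ξ s) y (σ y))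
      - (2 : ℝ) • ((g y (ξ (s + 2) y) (σ y)) • g y (ξ (s + 1) y)
        - (g y (ξ (s + 1) y) (σ y)) • g y (ξ (s + 2) y))).smulRight (ξ s y)
      + (eps s • g y (ξ s y)).smulRight (D (ξ s) y (σ y)))
      + (eps s * g y (ξ s y) (σ y)) • D (ξ s) y)) := by
    refine (conn_smoothEndField h.leviCivita.smooth hσ).add (SmoothEndField.sum fun s _ ↦ ?_)
    refine SmoothEndField.add (SmoothEndField.add (SmoothOneForm.smulRight ?_ (h.smooth s))
      (SmoothOneForm.smulRight ((hg s).const_smul _) (hΦσ s))) ((hΦ s).smul (hf' _ s))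
    refine SmoothOneForm.sub ((smoothOneForm_metric h.metric.smooth (hΦσ s)).const_smul _) ?_
    exact SmoothOneForm.const_smul _ (SmoothOneForm.sub ((hg _).smul (hf _)) ((hg _).smul (hf _)))
  refine ContMDiff.congr key fun y ↦ ?_
  refine congrArg _ ?_
  refine ContinuousLinearMap.ext fun u ↦ ?_
  rw [canonConn_apply, canonDiff_apply, add_apply, sum_apply]
  congr 1
  refine Finset.sum_congr rfl fun s _ ↦ ?_
  simp only [add_apply, sub_apply, smul_apply, ContinuousLinearMap.smulRight_apply,
    smul_eq_mul]
  module

end IsPara3Sasakian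

end

/-! ### Existence: the candidate is canonical -/

section

variable {n : ℕ} {M : Type*} [TopologicalSpace M] [ChartedSpace (Model n) M]
  [IsManifold 𝓘(ℝ, Model n) ∞ M]

variable {g : TwoTensor n M} {D : Connection n M} {ξ : Fin 3 → VField n M}

namespace IsPara3Sasakian

variable (h : IsPara3Sasakian g D ξ) {x : M}
include h

lemma canonDiff_horizontal {b : TangentSpace 𝓘(ℝ, Model n) x}
    (hb : b ∈ (ofPara3Sasakian g D ξ).H x) (u : TangentSpace 𝓘(ℝ, Model n) x) :
    canonDiff g D ξ x b u = ∑ s, ((eps s * g x (D (ξ s) x b) u) • ξ s x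
      + (eps s * g x (ξ s x) u) • D (ξ s) x b) := by
  rw [canonDiff_apply]
  refine Finset.sum_congr rfl fun s _ ↦ ?_
  rw [mem_H.1 hb, mem_H.1 hb, mem_H.1 hb]
  module

lemma canonDiff_xi (t : Fin 3) (u : TangentSpace 𝓘(ℝ, Model n) x) :
    canonDiff g D ξ x (ξ t x) u
      = (2 : ℝ) • D (ξ t) x ((ofPara3Sasakian g D ξ).projV x u) - D (ξ t) x u := by
  rw [canonDiff_apply, h.projV_apply]
  obtain ⟨⟨p1, p2, p3⟩, ⟨p4, p5, p6⟩, ⟨p7, p8, p9⟩⟩ := h.phi_table x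
  obtain ⟨⟨q1, q2, q3⟩, ⟨q4, q5, q6⟩, ⟨q7, q8, q9⟩⟩ := h.orthogonal_table x
  fin_cases t <;>
  · simp [Fin.sum_univ_three, p1, p2, p3, p4, p5, p6, p7, p8, p9, q1, q2, q3, q4, q5, q6, q7, q8,
      q9]
    module

lemma canonDiff_xi_horizontal (t : Fin 3) {u : TangentSpace 𝓘(ℝ, Model n) x}
    (hu : u ∈ (ofPara3Sasakian g D ξ).H x) :
    canonDiff g D ξ x (ξ t x) u = -D (ξ t) x u := by
  rw [h.canonDiff_xi, h.projV_apply]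
  simp [mem_H.1 hu]

variable {B C : VField n M}

/-- Differentiate `g(ξ_s, B) = 0`. This measures how far `D` is from preserving `H`. -/
lemma metric_xi_conn (hB : DiffAt B x) (hBH : ∀ y, B y ∈ (ofPara3Sasakian g D ξ).H y) (s : Fin 3)
    (u : TangentSpace 𝓘(ℝ, Model n) x) : g x (ξ s x) (D B x u) = g x (D (ξ s) x (B x)) u := by
  have h1 := h.leviCivita.metric x u _ _ ((h.smooth s).diffAt x) hB
  have h2 : (fun y ↦ g y (ξ s y) (B y)) = fun _ ↦ 0 := funext fun y ↦ mem_H.1 (hBH y) s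
  rw [h2, dirDeriv_const, h.skew, h.symm x u] at h1
  linarith

lemma canonConn_mem_H (hB : DiffAt B x) (hBH : ∀ y, B y ∈ (ofPara3Sasakian g D ξ).H y)
    (u : TangentSpace 𝓘(ℝ, Model n) x) :
    canonConn g D ξ B x u ∈ (ofPara3Sasakian g D ξ).H x := by
  refine mem_H.2 fun t ↦ ?_
  rw [canonConn_apply, h.canonDiff_horizontal (hBH x), map_add, h.metric_xi_conn hB hBH, map_sum]
  simp only [map_add, map_smul, mem_H.1 (h.phi_mem_H x _ (hBH x)), h.orthogonal, smul_eq_mul,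
    mul_ite, mul_zero, add_zero, Finset.sum_ite_eq, Finset.mem_univ, if_true]
  linear_combination (-g x (D (ξ t) x (B x)) u) * eps_mul_self t

lemma projV_field (hB : ∀ y, B y ∈ (ofPara3Sasakian g D ξ).V y) :
    B = fun y ↦ ∑ s, (ofPara3Sasakian g D ξ).η s y (B y) • ξ s y := by
  funext y
  conv_lhs => rw [← h.projV_of_mem y (hB y)]
  simp only [PqcData.projV, sum_apply, ContinuousLinearMap.smulRight_apply]
  rfl

lemma canonConn_xi (t : Fin 3) (u : TangentSpace 𝓘(ℝ, Model n) x) :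
    canonConn g D ξ (ξ t) x u
      = (2 : ℝ) • D (ξ t) x ((ofPara3Sasakian g D ξ).projV x u) := by
  rw [canonConn_apply, h.canonDiff_xi]; abel

lemma phi_mem_V (s : Fin 3) {u : TangentSpace 𝓘(ℝ, Model n) x}
    (hu : u ∈ (ofPara3Sasakian g D ξ).V x) : D (ξ s) x u ∈ (ofPara3Sasakian g D ξ).V x := by
  rw [← h.projV_of_mem x hu, h.projV_apply, map_sum]
  refine Submodule.sum_mem _ fun t _ ↦ ?_
  rw [map_smul]
  refine Submodule.smul_mem _ _ ?_
  have hm (r : Fin 3) : ξ r x ∈ (ofPara3Sasakian g D ξ).V x := Submodule.subset_span ⟨r, rfl⟩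
  obtain ⟨⟨p1, p2, p3⟩, ⟨p4, p5, p6⟩, ⟨p7, p8, p9⟩⟩ := h.phi_table x
  fin_cases s <;> fin_cases t <;>
    simp [p1, p2, p3, p4, p5, p6, p7, p8, p9, hm]

lemma canonConn_vertical (hB : DiffAt B x) (hBV : ∀ y, B y ∈ (ofPara3Sasakian g D ξ).V y)
    (u : TangentSpace 𝓘(ℝ, Model n) x) :
    canonConn g D ξ B x u
      = ∑ s, (dirDeriv (fun y ↦ (ofPara3Sasakian g D ξ).η s y (B y)) x u • ξ s x
        + (ofPara3Sasakian g D ξ).η s x (B x) •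
          (2 : ℝ) • D (ξ s) x ((ofPara3Sasakian g D ξ).projV x u)) := by
  conv_lhs => rw [h.projV_field hBV]
  rw [conn_sum _ fun s _ ↦ ((h.smooth s).diffAt x).smul (h.diffAt_eta s hB)]
  refine Finset.sum_congr rfl fun s _ ↦ ?_
  rw [conn_smul _ (h.diffAt_eta s hB) ((h.smooth s).diffAt x), h.canonConn_xi]
  abel

lemma canonConn_mem_V (hB : DiffAt B x) (hBV : ∀ y, B y ∈ (ofPara3Sasakian g D ξ).V y)
    (u : TangentSpace 𝓘(ℝ, Model n) x) :
    canonConn g D ξ B x u ∈ (ofPara3Sasakian g D ξ).V x := by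
  rw [h.canonConn_vertical hB hBV]
  exact Submodule.sum_mem _ fun s _ ↦ Submodule.add_mem _
    (Submodule.smul_mem _ _ (Submodule.subset_span ⟨s, rfl⟩))
    (Submodule.smul_mem _ _ (Submodule.smul_mem _ _ (h.phi_mem_V s (h.projV_mem x u))))

lemma canonConn_metric (hB : DiffAt B x) (hC : DiffAt C x)
    (hBH : ∀ y, B y ∈ (ofPara3Sasakian g D ξ).H y) (hCH : ∀ y, C y ∈ (ofPara3Sasakian g D ξ).H y)
    (u : TangentSpace 𝓘(ℝ, Model n) x) :
    dirDeriv (fun y ↦ g y (B y) (C y)) x u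
      = g x (canonConn g D ξ B x u) (C x) + g x (B x) (canonConn g D ξ C x u) := by
  rw [h.leviCivita.metric _ _ _ _ hB hC, canonConn_apply, canonConn_apply,
    h.canonDiff_horizontal (hBH x), h.canonDiff_horizontal (hCH x)]
  simp only [map_add, map_sum, map_smul, add_apply, sum_apply, smul_apply, smul_eq_mul,
    mem_H.1 (hCH x), h.symm x (B x) (ξ _ x), mem_H.1 (hBH x), mul_zero, zero_add, h.skew x _ (B x)]
  have : ∑ s, eps s * g x (ξ s x) u * -g x (B x) (D (ξ s) x (C x))
      = -∑ s, eps s * g x (ξ s x) u * g x (B x) (D (ξ s) x (C x)) := by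
    rw [← Finset.sum_neg_distrib]
    exact Finset.sum_congr rfl fun s _ ↦ by ring
  rw [this]
  ring

variable [T2Space M]

/-- The covariant derivative of `I_s`. -/
lemma canonConn_phi (hB : DiffAt B x) (hBH : ∀ y, B y ∈ (ofPara3Sasakian g D ξ).H y) (s : Fin 3)
    (u : TangentSpace 𝓘(ℝ, Model n) x) :
    canonConn g D ξ (fun y ↦ D (ξ s) y (B y)) x u - D (ξ s) x (canonConn g D ξ B x u)
      = ∑ t, (eps t * g x (ξ t x) u) •
          (D (ξ t) x (D (ξ s) x (B x)) - D (ξ s) x (D (ξ t) x (B x))) := by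
  have hH (s t) := h.phi_mem_H x s (h.phi_mem_H x t (hBH x))
  -- Both sides are horizontal, so it is enough to pair with horizontal `w`, which removes all terms
  -- along the Reeb fields.
  refine sub_eq_zero.1 (h.nondegenerate_H x (Submodule.sub_mem _ (Submodule.sub_mem _
    (h.canonConn_mem_H (h.diffAt_phi s hB) (fun y ↦ h.phi_mem_H y s (hBH y)) u)
    (h.phi_mem_H x s (h.canonConn_mem_H hB hBH u))) (Submodule.sum_mem _ fun t _ ↦
      Submodule.smul_mem _ _ (Submodule.sub_mem _ (hH t s) (hH s t)))) fun w hw ↦ ?_)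
  rw [canonConn_apply, canonConn_apply, h.conn_phi s u hB,
    h.canonDiff_horizontal (hBH x), h.canonDiff_horizontal (h.phi_mem_H x s (hBH x)),
    mem_H.1 (hBH x)]
  have hξ (t : Fin 3) : g x (D (ξ s) x (ξ t x)) w = 0 := by
    rw [h.skew, mem_H.1 (h.phi_mem_H x s hw), neg_zero]
  simp only [map_add, map_sum, map_sub, map_smul, sub_apply, add_apply, sum_apply, smul_apply,
    smul_eq_mul, mem_H.1 hw, hξ, mul_zero, zero_add, zero_mul, mul_sub, Finset.sum_sub_distrib]
  ring

/-- The commutators of the `I_s` correspond to the endomorphisms `2Φ_s` of the vertical space. -/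
lemma sum_eta_phi_xi (s t : Fin 3) {w : TangentSpace 𝓘(ℝ, Model n) x}
    (hw : w ∈ (ofPara3Sasakian g D ξ).H x) :
    ∑ r, (ofPara3Sasakian g D ξ).η r x ((2 : ℝ) • D (ξ s) x (ξ t x)) • D (ξ r) x w
      = D (ξ s) x (D (ξ t) x w) - D (ξ t) x (D (ξ s) x w) := by
  have e5 (s : Fin 3) (u : TangentSpace 𝓘(ℝ, Model n) x) :
    (ofPara3Sasakian g D ξ).η s x u = -eps s * g x (ξ s x) u := rfl
  simp only [e5]
  obtain ⟨⟨p1, p2, p3⟩, ⟨p4, p5, p6⟩, ⟨p7, p8, p9⟩⟩ := h.phi_table x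
  obtain ⟨⟨q1, q2, q3⟩, ⟨q4, q5, q6⟩, ⟨q7, q8, q9⟩⟩ := h.orthogonal_table x
  obtain ⟨⟨r1, r2, r3⟩, ⟨r4, r5, r6⟩, ⟨r7, r8, r9⟩⟩ := h.phi_phi_table x w
  have w0 := mem_H.1 hw 0
  have w1 := mem_H.1 hw 1
  have w2 := mem_H.1 hw 2
  fin_cases s <;> fin_cases t <;>
    simp [Fin.sum_univ_three, p1, p2, p3, p4, p5, p6, p7, p8, p9, q1, q2, q3, q4, q5, q6, q7, q8,
      q9, r1, r2, r3, r4, r5, r6, r7, r8, r9, w0, w1, w2] <;> module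

/-- The inner sum is `∇_u` of the vertical field `∑ f_s ξ_s`. One identity therefore yields both the
invariance of the bundle spanned by the `I_s` and, for `f_s = η_s(ξ)`, the condition `∇φ = 0`. -/
lemma canonConn_sum_phi {f : Fin 3 → M → ℝ} (hf : ∀ s, FunDiffAt (n := n) (f s) x)
    (hB : DiffAt B x) (hBH : ∀ y, B y ∈ (ofPara3Sasakian g D ξ).H y)
    (u : TangentSpace 𝓘(ℝ, Model n) x) :
    canonConn g D ξ (fun y ↦ ∑ s, f s y • D (ξ s) y (B y)) x u
        - ∑ s, f s x • D (ξ s) x (canonConn g D ξ B x u)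
      = ∑ s, (ofPara3Sasakian g D ξ).η s x
          (∑ s, (dirDeriv (f s) x u • ξ s x
            + f s x • (2 : ℝ) • D (ξ s) x ((ofPara3Sasakian g D ξ).projV x u)))
          • D (ξ s) x (B x) := by
  rw [conn_sum _ fun s _ ↦ (h.diffAt_phi s hB).smul (hf s), ← Finset.sum_sub_distrib]
  have h1 (s : Fin 3) : canonConn g D ξ (fun y ↦ f s y • D (ξ s) y (B y)) x u
      - f s x • D (ξ s) x (canonConn g D ξ B x u)
      = dirDeriv (f s) x u • D (ξ s) x (B x)
        + f s x • ∑ t, (-eps t * g x (ξ t x) u) •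
          ∑ r, (ofPara3Sasakian g D ξ).η r x ((2 : ℝ) • D (ξ s) x (ξ t x)) • D (ξ r) x (B x) := by
    have h2 := h.canonConn_phi hB hBH s u
    rw [conn_smul _ (hf s) (h.diffAt_phi s hB), add_sub_right_comm, ← smul_sub, h2]
    refine (add_comm _ _).trans ?_
    congr 2
    refine Finset.sum_congr rfl fun t _ ↦ ?_
    rw [h.sum_eta_phi_xi s t (hBH x)]
    module
  rw [Finset.sum_congr rfl fun s _ ↦ h1 s]
  have e5 (s : Fin 3) : (ofPara3Sasakian g D ξ).η s x = -eps s • g x (ξ s x) := rfl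
  rw [h.projV_apply]
  simp only [Fin.sum_univ_three, map_add, map_smul, h.eta_xi, smul_eq_mul]
  simp
  module

lemma canonConn_torsion (u v : TangentSpace 𝓘(ℝ, Model n) x) :
    (canonConn g D ξ).torsion x u v
      = canonDiff g D ξ x v u - canonDiff g D ξ x u v := by
  have h1 := torsion_eq (canonConn g D ξ) (diffAt_ext u) (diffAt_ext v)
  rw [canonConn_apply, canonConn_apply, h.leviCivita.bracket_eq (diffAt_ext u) (diffAt_ext v)] at h1
  simp only [ext_self] at h1
  rw [h1]; abel

/-- Both corrections in `canonConn_torsion` equal `∑ ε_s g(ξ_s, u) Φ_s v`: in one, `g(Φ_s v, u) =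
0`; the other is linear in `u` with value `-Φ_t v` at `ξ_t`. -/
lemma canonConn_torsion_vertical {u v : TangentSpace 𝓘(ℝ, Model n) x}
    (hu : u ∈ (ofPara3Sasakian g D ξ).V x) (hv : v ∈ (ofPara3Sasakian g D ξ).H x) :
    (canonConn g D ξ).torsion x u v = 0 := by
  rw [h.canonConn_torsion, h.canonDiff_horizontal hv]
  have h1 (s : Fin 3) : g x (D (ξ s) x v) u = 0 := by
    rw [h.symm, h.metric_V_H x hu (h.phi_mem_H x s hv)]
  have h2 : canonDiff g D ξ x u v = ∑ s, (eps s * g x (ξ s x) u) • D (ξ s) x v := by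
    conv_lhs => rw [← h.projV_of_mem x hu, h.projV_apply]
    simp only [map_sum, map_smul, sum_apply, smul_apply, h.canonDiff_xi_horizontal _ hv]
    exact Finset.sum_congr rfl fun s _ ↦ by module
  simp [h1, h2]

/-- Both sides are combinations of the `ξ_s`, and `metric_xi_conn` computes the coefficients of the
bracket. -/
lemma canonConn_torsion_horizontal (hB : DiffAt B x) (hC : DiffAt C x)
    (hBH : ∀ y, B y ∈ (ofPara3Sasakian g D ξ).H y) (hCH : ∀ y, C y ∈ (ofPara3Sasakian g D ξ).H y) :
    (canonConn g D ξ).torsion x (B x) (C x)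
      = -(ofPara3Sasakian g D ξ).projV x (bracket B C x) := by
  rw [h.canonConn_torsion, h.canonDiff_horizontal (hBH x), h.canonDiff_horizontal (hCH x),
    h.leviCivita.bracket_eq hB hC, h.projV_apply, ← Finset.sum_sub_distrib,
    ← Finset.sum_neg_distrib]
  refine Finset.sum_congr rfl fun s _ ↦ ?_
  rw [map_sub, h.metric_xi_conn hB hBH, h.metric_xi_conn hC hCH, mem_H.1 (hBH x), mem_H.1 (hCH x)]
  module

/-- The canonical connection of a para 3-Sasakian manifold is the canonical connection of its
paraquaternionic contact structure. -/
lemma isCanonical_canonConn : (ofPara3Sasakian g D ξ).IsCanonical (canonConn g D ξ) where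
  smooth := h.smooth_canonConn
  preserves_H x u X hX hXH := h.canonConn_mem_H hX hXH u
  preserves_V x u X hX hXV := h.canonConn_mem_V hX hXV u
  metric x u X Y hX hY hXH hYH := h.canonConn_metric hX hY hXH hYH u
  preserves_PQ x u f hf := ⟨_, fun X hX hXH ↦ h.canonConn_sum_phi hf hX hXH u⟩
  torsion_H x X Y hX hY hXH hYH := h.canonConn_torsion_horizontal hX hY hXH hYH
  torsion_V x v hv B _ e he := by
    refine Finset.sum_eq_zero fun a _ ↦ ?_
    beta_reduce
    rw [h.canonConn_torsion_vertical hv (he.1 a)]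
    simp
  identification x u v X hv hX hvV hXH := by
    rw [h.canonConn_vertical hv hvV]
    exact h.canonConn_sum_phi (fun s ↦ h.diffAt_eta s hv) hX hXH u

end IsPara3Sasakian

end

/-! ### Skew endomorphisms normalizing `sp(1, ℝ)` -/

section

variable {n : ℕ} {M : Type*} [TopologicalSpace M] [ChartedSpace (Model n) M]
  [IsManifold 𝓘(ℝ, Model n) ∞ M]

variable {g : TwoTensor n M} {D : Connection n M} {ξ : Fin 3 → VField n M}

/-- The rank two endomorphism `X ↦ g(u, X)w - g(w, X)u`. -/
def wedgeEnd (g : TwoTensor n M) (x : M) (u w : TangentSpace 𝓘(ℝ, Model n) x) :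
    TangentSpace 𝓘(ℝ, Model n) x →ₗ[ℝ] TangentSpace 𝓘(ℝ, Model n) x :=
  ((g x u).smulRight w - (g x w).smulRight u).toLinearMap

lemma wedgeEnd_apply {x : M} (u w v : TangentSpace 𝓘(ℝ, Model n) x) :
    wedgeEnd g x u w v = g x u v • w - g x w v • u := rfl

namespace IsPara3Sasakian

variable (h : IsPara3Sasakian g D ξ) {x : M}
include h

/-- The products `I_s I_t` on the horizontal space. -/
lemma phi_phi_table_H {u : TangentSpace 𝓘(ℝ, Model n) x}
    (hu : u ∈ (ofPara3Sasakian g D ξ).H x) :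
    (D (ξ 0) x (D (ξ 0) x u) = u ∧ D (ξ 0) x (D (ξ 1) x u) = D (ξ 2) x u ∧
      D (ξ 0) x (D (ξ 2) x u) = D (ξ 1) x u) ∧
    (D (ξ 1) x (D (ξ 0) x u) = -D (ξ 2) x u ∧ D (ξ 1) x (D (ξ 1) x u) = u ∧
      D (ξ 1) x (D (ξ 2) x u) = -D (ξ 0) x u) ∧
    (D (ξ 2) x (D (ξ 0) x u) = -D (ξ 1) x u ∧ D (ξ 2) x (D (ξ 1) x u) = D (ξ 0) x u ∧
      D (ξ 2) x (D (ξ 2) x u) = -u) := by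
  simpa only [mem_H.1 hu, zero_smul, add_zero] using h.phi_phi_table x u

lemma metric_phi_self (s : Fin 3) (u : TangentSpace 𝓘(ℝ, Model n) x) :
    g x (D (ξ s) x u) u = 0 := by
  have := h.skew x s u u
  rw [h.symm x u] at this
  linarith

/-- The `I_s` are orthogonal to each other. -/
lemma metric_phi_phi (s t : Fin 3) {u : TangentSpace 𝓘(ℝ, Model n) x}
    (hu : u ∈ (ofPara3Sasakian g D ξ).H x) :
    g x (D (ξ s) x u) (D (ξ t) x u) = if s = t then -eps s * g x u u else 0 := by
  obtain ⟨⟨r1, r2, r3⟩, ⟨r4, r5, r6⟩, ⟨r7, r8, r9⟩⟩ := h.phi_phi_table_H hu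
  have h1 (s : Fin 3) : g x u (D (ξ s) x u) = 0 := by rw [h.symm, h.metric_phi_self]
  rw [h.skew]
  fin_cases s <;> fin_cases t <;> simp [r1, r2, r3, r4, r5, r6, r7, r8, r9, h1]

lemma frame_metric_ne_zero {e : Fin (2 * n) ⊕ Fin (2 * n) → TangentSpace 𝓘(ℝ, Model n) x}
    (he : (ofPara3Sasakian g D ξ).IsFrame x e) (a) : g x (e a) (e a) ≠ 0 := fun h0 ↦ by
  simpa [h0] using h.frame_mul_self he a

/-- The orthogonal projection of `wedgeEnd u w` to the centralizer of the `I_s`. -/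
lemma isSpn_average {u w : TangentSpace 𝓘(ℝ, Model n) x}
    (hu : u ∈ (ofPara3Sasakian g D ξ).H x) (hw : w ∈ (ofPara3Sasakian g D ξ).H x) :
    (ofPara3Sasakian g D ξ).IsSpn x
      (wedgeEnd g x u w - ∑ s, eps s • wedgeEnd g x (D (ξ s) x u) (D (ξ s) x w)) := by
  have hu' (s) := h.phi_mem_H x s hu
  have hw' (s) := h.phi_mem_H x s hw
  refine ⟨fun X hX ↦ ?_, fun X hX Y hY ↦ ?_, fun s X hX ↦ ?_⟩
  · simp only [LinearMap.sub_apply, LinearMap.sum_apply, LinearMap.smul_apply, wedgeEnd_apply]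
    exact Submodule.sub_mem _ (Submodule.sub_mem _ (Submodule.smul_mem _ _ hw)
      (Submodule.smul_mem _ _ hu)) (Submodule.sum_mem _ fun s _ ↦ Submodule.smul_mem _ _
        (Submodule.sub_mem _ (Submodule.smul_mem _ _ (hw' s)) (Submodule.smul_mem _ _ (hu' s))))
  · change g x _ _ = -g x _ _
    simp only [LinearMap.sub_apply, LinearMap.add_apply, LinearMap.smul_apply, wedgeEnd_apply,
      Fin.sum_univ_three, map_sub, map_add, map_smul, sub_apply, add_apply, smul_apply,
      smul_eq_mul]
    rw [h.symm x X u, h.symm x X w]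
    simp only [h.symm x X (D _ _ _)]
    ring
  -- With `W = wedgeEnd u w`, skewness gives `wedgeEnd (I_s u) (I_s w) = -I_s W I_s`, and `I_s⁻¹ =
  -- ε_s I_s`. The endomorphism is thus the sum of the conjugates of `W` by `1, I_1, I_2, I_3`, and
  -- conjugation by any `I_s` permutes these.
  · change _ = D (ξ s) x _
    have sk (s : Fin 3) (u v) : g x u (D (ξ s) x v) = -g x (D (ξ s) x u) v := by
      rw [h.skew, neg_neg]
    obtain ⟨⟨r1, r2, r3⟩, ⟨r4, r5, r6⟩, ⟨r7, r8, r9⟩⟩ := h.phi_phi_table_H hu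
    obtain ⟨⟨q1, q2, q3⟩, ⟨q4, q5, q6⟩, ⟨q7, q8, q9⟩⟩ := h.phi_phi_table_H hw
    change (wedgeEnd g x u w - ∑ s, eps s • wedgeEnd g x (D (ξ s) x u) (D (ξ s) x w))
      (D (ξ s) x X) = _
    simp only [LinearMap.sub_apply, LinearMap.add_apply, LinearMap.smul_apply, wedgeEnd_apply,
      Fin.sum_univ_three, map_sub, map_add, map_smul, sk]
    fin_cases s <;>
    · simp [r1, r2, r3, r4, r5, r6, r7, r8, r9, q1, q2, q3, q4, q5, q6, q7, q8, q9]
      module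

variable {e : Fin (2 * n) ⊕ Fin (2 * n) → TangentSpace 𝓘(ℝ, Model n) x}
  (he : (ofPara3Sasakian g D ξ).IsFrame x e)
include he

lemma frame_sum_wedgeEnd {A : TangentSpace 𝓘(ℝ, Model n) x →ₗ[ℝ] TangentSpace 𝓘(ℝ, Model n) x}
    {u w : TangentSpace 𝓘(ℝ, Model n) x}
    (hu : u ∈ (ofPara3Sasakian g D ξ).H x) (hw : w ∈ (ofPara3Sasakian g D ξ).H x) :
    ∑ a, g x (e a) (e a) * g x (A (e a)) (wedgeEnd g x u w (e a))
      = g x (A u) w - g x (A w) u := by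
  have hL (w) : IsLinearMap ℝ (fun v ↦ g x (A v) w) :=
    ⟨fun _ _ ↦ by simp, fun _ _ ↦ by simp⟩
  rw [← h.frame_sum_linear he (hL w) hu, ← h.frame_sum_linear he (hL u) hw,
    ← Finset.sum_sub_distrib]
  refine Finset.sum_congr rfl fun a _ ↦ ?_
  rw [wedgeEnd_apply, map_sub, map_smul, map_smul, h.symm x u, h.symm x w]
  simp only [smul_eq_mul]
  ring

/-- An endomorphism of the horizontal space which normalizes `sp(1, ℝ)`, is skew-symmetric and
orthogonal to `sp(n, ℝ) ⊕ sp(1, ℝ)` vanishes. -/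
lemma eq_zero_of_orthogonal (hn : 1 ≤ n)
    (A : TangentSpace 𝓘(ℝ, Model n) x →ₗ[ℝ] TangentSpace 𝓘(ℝ, Model n) x)
    (hA : ∀ u ∈ (ofPara3Sasakian g D ξ).H x, A u ∈ (ofPara3Sasakian g D ξ).H x)
    (hskew : ∀ u ∈ (ofPara3Sasakian g D ξ).H x, ∀ v ∈ (ofPara3Sasakian g D ξ).H x,
      g x (A u) v + g x u (A v) = 0)
    (hcomm : ∀ s, ∃ c : Fin 3 → ℝ, ∀ u ∈ (ofPara3Sasakian g D ξ).H x,
      A (D (ξ s) x u) - D (ξ s) x (A u) = ∑ t, c t • D (ξ t) x u)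
    (horth : ∀ B, (ofPara3Sasakian g D ξ).IsSpnSp1 x B →
      ∑ a, g x (e a) (e a) * g x (A (e a)) (B (e a)) = 0)
    {u : TangentSpace 𝓘(ℝ, Model n) x} (hu : u ∈ (ofPara3Sasakian g D ξ).H x) : A u = 0 := by
  -- Testing orthogonality against the averaged rank-two maps shows that the average of `A` itself,
  -- `A + ∑ ε_s I_s A I_s`, is zero: `A` has no component commuting with all `I_s`.
  have h1 (u) (hu : u ∈ (ofPara3Sasakian g D ξ).H x) :
      A u + ∑ s, eps s • D (ξ s) x (A (D (ξ s) x u)) = 0 := by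
    refine h.nondegenerate_H x (Submodule.add_mem _ (hA u hu) (Submodule.sum_mem _ fun s _ ↦
      Submodule.smul_mem _ _ (h.phi_mem_H x s (hA _ (h.phi_mem_H x s hu))))) fun w hw ↦ ?_
    have h2 := horth _ ⟨_, 0, h.isSpn_average hu hw, fun X hX ↦ by
      simp only [Pi.zero_apply, zero_smul, Finset.sum_const_zero, add_zero]; rfl⟩
    have h3 : ∑ a, g x (e a) (e a) * g x (A (e a)) ((wedgeEnd g x u w
        - ∑ s, eps s • wedgeEnd g x (D (ξ s) x u) (D (ξ s) x w)) (e a))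
        = ∑ a, g x (e a) (e a) * g x (A (e a)) (wedgeEnd g x u w (e a))
          - ∑ s, eps s * ∑ a, g x (e a) (e a)
            * g x (A (e a)) (wedgeEnd g x (D (ξ s) x u) (D (ξ s) x w) (e a)) := by
      simp only [LinearMap.sub_apply, LinearMap.sum_apply, LinearMap.smul_apply, map_sub, map_sum,
        map_smul, smul_eq_mul, mul_sub, Finset.mul_sum, Finset.sum_sub_distrib]
      rw [Finset.sum_comm]
      congr 1
      exact Finset.sum_congr rfl fun s _ ↦ Finset.sum_congr rfl fun a _ ↦ by ring
    rw [h3, h.frame_sum_wedgeEnd he hu hw] at h2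
    have h4 (s) : ∑ a, g x (e a) (e a)
            * g x (A (e a)) (wedgeEnd g x (D (ξ s) x u) (D (ξ s) x w) (e a))
        = -2 * g x (D (ξ s) x (A (D (ξ s) x u))) w := by
      rw [h.frame_sum_wedgeEnd he (h.phi_mem_H x s hu) (h.phi_mem_H x s hw), h.skew x s (A _)]
      have := hskew _ (h.phi_mem_H x s hu) _ (h.phi_mem_H x s hw)
      rw [h.symm x _ (A _)] at this
      linarith
    have h5 := hskew _ hu _ hw
    rw [h.symm x _ (A _)] at h5
    simp only [h4, Fin.sum_univ_three] at h2
    simp only [map_add, map_smul, add_apply, smul_apply, Fin.sum_univ_three, smul_eq_mul]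
    linarith
  choose c hc using hcomm
  -- Replace `A I_s` by `I_s A + ∑ c_st I_t` in the vanishing average. Since `ε_s I_s² = 1`, this
  -- gives `4A = -∑ ε_s c_st I_s I_t`; the diagonal products give the scalar `a` and the others the
  -- coefficients `d`.
  obtain ⟨a, d, had⟩ : ∃ (a : ℝ) (d : Fin 3 → ℝ), ∀ u ∈ (ofPara3Sasakian g D ξ).H x,
      A u = a • u + ∑ t, d t • D (ξ t) x u := by
    refine ⟨-(1 / 4) * (c 0 0 + c 1 1 + c 2 2), fun t ↦ -(1 / 4) *
      (![-c 1 2 - c 2 1, c 0 2 + c 2 0, c 0 1 - c 1 0] : Fin 3 → ℝ) t, fun u hu ↦ ?_⟩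
    have h2 := h1 u hu
    obtain ⟨⟨r1, r2, r3⟩, ⟨r4, r5, r6⟩, ⟨r7, r8, r9⟩⟩ := h.phi_phi_table_H hu
    obtain ⟨⟨q1, q2, q3⟩, ⟨q4, q5, q6⟩, ⟨q7, q8, q9⟩⟩ := h.phi_phi_table_H (hA u hu)
    simp only [fun s ↦ sub_eq_iff_eq_add.1 (hc s u hu), Fin.sum_univ_three, map_add, map_smul, r1,
      r2, r3, r4, r5, r6, r7, r8, r9, q1, q5, q9, eps_zero, eps_one, eps_two] at h2
    simp only [Fin.sum_univ_three, Matrix.cons_val]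
    linear_combination (norm := module) (1 / 4 : ℝ) • h2
  -- Orthogonality to `I_t` isolates `d t`, because `1, I_1, I_2, I_3` are mutually orthogonal and
  -- `I_t` has square `-4n ε_t ≠ 0`.
  have hd (t) : d t = 0 := by
    have h2 := horth (D (ξ t) x).toLinearMap ⟨0, Pi.single t 1,
      ⟨fun X _ ↦ by simp, fun X _ Y _ ↦ by simp, fun s X _ ↦ by simp⟩, fun X hX ↦ by
        change D (ξ t) x X = 0 + ∑ s, (Pi.single t (1 : ℝ) : Fin 3 → ℝ) s • D (ξ s) x X
        simp [Pi.single_apply]⟩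
    have h3 (b) : g x (e b) (e b) * g x (A (e b)) (D (ξ t) x (e b))
        = (-eps t * d t) * (g x (e b) (e b) * g x (e b) (e b)) := by
      rw [had _ (he.1 b), map_add, map_sum, add_apply, sum_apply]
      simp only [map_smul, smul_apply, h.metric_phi_phi _ t (he.1 b), smul_eq_mul, mul_ite,
        mul_zero, Finset.sum_ite_eq', Finset.mem_univ, if_true, h.symm x (e b) (D _ _ _),
        h.metric_phi_self]
      ring
    have h4 : ∑ b, (-eps t * d t) * (g x (e b) (e b) * g x (e b) (e b)) = 0 := by
      rw [← h2]
      exact Finset.sum_congr rfl fun b _ ↦ (h3 b).symm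
    rw [← Finset.mul_sum, h.frame_sum_one he] at h4
    have hn' : (n : ℝ) ≠ 0 := by positivity
    simpa [eps_ne_zero, hn'] using h4
  -- A multiple of the identity is skew only if it is zero.
  have ha : a = 0 := by
    let b : Fin (2 * n) ⊕ Fin (2 * n) := Sum.inl ⟨0, by omega⟩
    have h2 := hskew _ (he.1 b) _ (he.1 b)
    rw [had _ (he.1 b)] at h2
    simp only [hd, zero_smul, Finset.sum_const_zero, add_zero, map_smul, smul_apply,
      smul_eq_mul] at h2
    have h3 := h.frame_metric_ne_zero he b
    have h4 : a * g x (e b) (e b) = 0 := by linarith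
    exact (mul_eq_zero.1 h4).resolve_right h3
  rw [had u hu]
  simp [ha, hd]

/-- The `I_s` are linearly independent. -/
lemma phi_linearIndependent (hn : 1 ≤ n) {c : Fin 3 → ℝ}
    (hc : ∀ u ∈ (ofPara3Sasakian g D ξ).H x, ∑ s, c s • D (ξ s) x u = 0) (t : Fin 3) :
    c t = 0 := by
  let b : Fin (2 * n) ⊕ Fin (2 * n) := Sum.inl ⟨0, by omega⟩
  have h1 := congrArg (fun v ↦ g x v (D (ξ t) x (e b))) (hc _ (he.1 b))
  simp only [map_sum, sum_apply, map_smul, smul_apply, h.metric_phi_phi _ t (he.1 b), smul_eq_mul,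
    mul_ite, mul_zero, Finset.sum_ite_eq', Finset.mem_univ, if_true, map_zero, zero_apply] at h1
  simpa [h.frame_metric_ne_zero he, eps_ne_zero] using h1

end IsPara3Sasakian

end

/-! ### Uniqueness of the canonical connection -/

section

variable {n : ℕ} {M : Type*} [TopologicalSpace M] [ChartedSpace (Model n) M]
  [IsManifold 𝓘(ℝ, Model n) ∞ M]

variable {g : TwoTensor n M} {D : Connection n M} {ξ : Fin 3 → VField n M}

/-- The difference of two connections. -/
def connDiff (D D' : Connection n M) (x : M) :
    TangentSpace 𝓘(ℝ, Model n) x →L[ℝ] TangentSpace 𝓘(ℝ, Model n) x →L[ℝ]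
      TangentSpace 𝓘(ℝ, Model n) x :=
  have : IsManifold 𝓘(ℝ, Model n) 1 M := .of_le (n := ∞) (one_le_two.trans two_le_infty)
  CovariantDerivative.difference D D' x

lemma connDiff_apply (D D' : Connection n M) {A : VField n M} {x : M} (hA : DiffAt A x)
    (u : TangentSpace 𝓘(ℝ, Model n) x) : connDiff D D' x (A x) u = D A x u - D' A x u := by
  have : IsManifold 𝓘(ℝ, Model n) 1 M := .of_le (n := ∞) (one_le_two.trans two_le_infty)
  exact congrArg (fun L ↦ L u) (IsCovariantDerivativeOn.difference_apply
    D.isCovariantDerivativeOnUniv D'.isCovariantDerivativeOnUniv (Set.mem_univ x) hA)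

lemma torsion_sub_torsion (D D' : Connection n M) (x : M) (u v : TangentSpace 𝓘(ℝ, Model n) x) :
    D.torsion x u v - D'.torsion x u v = connDiff D D' x v u - connDiff D D' x u v := by
  have h1 := torsion_eq D (diffAt_ext u) (diffAt_ext v)
  have h2 := torsion_eq D' (diffAt_ext u) (diffAt_ext v)
  have h3 := connDiff_apply D D' (diffAt_ext u) v
  have h4 := connDiff_apply D D' (diffAt_ext v) u
  simp only [ext_self] at h1 h2 h3 h4
  rw [h1, h2, h3, h4]
  abel

namespace IsPara3Sasakian

variable (h : IsPara3Sasakian g D ξ) {x : M}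
include h

lemma diffAt_projV {B : VField n M} (hB : DiffAt B x) :
    DiffAt (fun y ↦ (ofPara3Sasakian g D ξ).projV y (B y)) x := by
  have h1 : (fun y ↦ (ofPara3Sasakian g D ξ).projV y (B y))
      = fun y ↦ ∑ s, (ofPara3Sasakian g D ξ).η s y (B y) • ξ s y := by
    funext y
    simp only [PqcData.projV, sum_apply, ContinuousLinearMap.smulRight_apply]
    rfl
  rw [h1]
  exact DiffAt.sum fun s _ ↦ ((h.smooth s).diffAt x).smul (h.diffAt_eta s hB)

/-- Every horizontal vector is a value of a horizontal vector field. -/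
lemma exists_horizontal {u : TangentSpace 𝓘(ℝ, Model n) x}
    (hu : u ∈ (ofPara3Sasakian g D ξ).H x) :
    ∃ B : VField n M, DiffAt B x ∧ (∀ y, B y ∈ (ofPara3Sasakian g D ξ).H y) ∧ B x = u :=
  ⟨fun y ↦ (ofPara3Sasakian g D ξ).projH y (ext u y),
    (diffAt_ext u).sub (h.diffAt_projV (diffAt_ext u)), fun y ↦ h.projH_mem y _,
    by simp only [ext_self, h.projH_of_mem x hu]⟩

/-- Every vertical vector is a value of a vertical vector field. -/
lemma exists_vertical {u : TangentSpace 𝓘(ℝ, Model n) x}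
    (hu : u ∈ (ofPara3Sasakian g D ξ).V x) :
    ∃ B : VField n M, DiffAt B x ∧ (∀ y, B y ∈ (ofPara3Sasakian g D ξ).V y) ∧ B x = u :=
  ⟨fun y ↦ (ofPara3Sasakian g D ξ).projV y (ext u y), h.diffAt_projV (diffAt_ext u),
    fun y ↦ h.projV_mem y _, by simp only [ext_self, h.projV_of_mem x hu]⟩

variable [T2Space M] {nabla nabla' : Connection n M}
  (hc : (ofPara3Sasakian g D ξ).IsCanonical nabla)
  (hc' : (ofPara3Sasakian g D ξ).IsCanonical nabla')
include hc hc'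

lemma connDiff_mem_H {b : TangentSpace 𝓘(ℝ, Model n) x} (hb : b ∈ (ofPara3Sasakian g D ξ).H x)
    (u : TangentSpace 𝓘(ℝ, Model n) x) :
    connDiff nabla nabla' x b u ∈ (ofPara3Sasakian g D ξ).H x := by
  obtain ⟨B, hB, hBH, rfl⟩ := h.exists_horizontal hb
  rw [connDiff_apply _ _ hB]
  exact Submodule.sub_mem _ (hc.preserves_H x u B hB hBH) (hc'.preserves_H x u B hB hBH)

lemma connDiff_mem_V {b : TangentSpace 𝓘(ℝ, Model n) x} (hb : b ∈ (ofPara3Sasakian g D ξ).V x)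
    (u : TangentSpace 𝓘(ℝ, Model n) x) :
    connDiff nabla nabla' x b u ∈ (ofPara3Sasakian g D ξ).V x := by
  obtain ⟨B, hB, hBH, rfl⟩ := h.exists_vertical hb
  rw [connDiff_apply _ _ hB]
  exact Submodule.sub_mem _ (hc.preserves_V x u B hB hBH) (hc'.preserves_V x u B hB hBH)

lemma connDiff_skew {b c : TangentSpace 𝓘(ℝ, Model n) x} (hb : b ∈ (ofPara3Sasakian g D ξ).H x)
    (hcH : c ∈ (ofPara3Sasakian g D ξ).H x) (u : TangentSpace 𝓘(ℝ, Model n) x) :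
    g x (connDiff nabla nabla' x b u) c + g x b (connDiff nabla nabla' x c u) = 0 := by
  obtain ⟨B, hB, hBH, rfl⟩ := h.exists_horizontal hb
  obtain ⟨C, hC, hCH, rfl⟩ := h.exists_horizontal hcH
  rw [connDiff_apply _ _ hB, connDiff_apply _ _ hC]
  have h1 := hc.metric x u B C hB hC hBH hCH
  have h2 := (hc'.metric x u B C hB hC hBH hCH).symm.trans h1
  change g x _ _ + g x _ _ = g x _ _ + g x _ _ at h2
  rw [map_sub, map_sub, sub_apply]
  linarith

lemma connDiff_symm {b c : TangentSpace 𝓘(ℝ, Model n) x} (hb : b ∈ (ofPara3Sasakian g D ξ).H x)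
    (hcH : c ∈ (ofPara3Sasakian g D ξ).H x) :
    connDiff nabla nabla' x b c = connDiff nabla nabla' x c b := by
  obtain ⟨B, hB, hBH, rfl⟩ := h.exists_horizontal hb
  obtain ⟨C, hC, hCH, rfl⟩ := h.exists_horizontal hcH
  refine (sub_eq_zero.1 ?_).symm
  rw [← torsion_sub_torsion, hc.torsion_H x B C hB hC hBH hCH, hc'.torsion_H x B C hB hC hBH hCH,
    sub_self]

/-- Koszul argument: `g(K(b, c), d)` is symmetric in `b, c`, because the horizontal torsion is
prescribed, and skew in `b, d`, because both connections are metric. Such a trilinear form is zero.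
-/
lemma connDiff_horizontal {b c : TangentSpace 𝓘(ℝ, Model n) x}
    (hb : b ∈ (ofPara3Sasakian g D ξ).H x) (hcH : c ∈ (ofPara3Sasakian g D ξ).H x) :
    connDiff nabla nabla' x b c = 0 := by
  refine h.nondegenerate_H x (h.connDiff_mem_H hc hc' hb c) fun d hd ↦ ?_
  have h1 := h.connDiff_skew hc hc' hb hcH d
  have h2 := h.connDiff_skew hc hc' hb hd c
  have h3 := h.connDiff_skew hc hc' hcH hd b
  rw [h.symm x b] at h1 h2
  rw [h.symm x c] at h3
  rw [h.connDiff_symm hc hc' hb hcH] at h2 ⊢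
  rw [h.connDiff_symm hc hc' hb hd] at h1
  rw [h.connDiff_symm hc hc' hcH hd] at h1
  linarith

lemma connDiff_comm (s : Fin 3) (v : TangentSpace 𝓘(ℝ, Model n) x) :
    ∃ c : Fin 3 → ℝ, ∀ u ∈ (ofPara3Sasakian g D ξ).H x,
      connDiff nabla nabla' x (D (ξ s) x u) v - D (ξ s) x (connDiff nabla nabla' x u v)
        = ∑ t, c t • D (ξ t) x u := by
  have key (nabla : Connection n M) (hc : (ofPara3Sasakian g D ξ).IsCanonical nabla) :
      ∃ c : Fin 3 → ℝ, ∀ B : VField n M, DiffAt B x → (∀ y, B y ∈ (ofPara3Sasakian g D ξ).H y) →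
        nabla (fun y ↦ D (ξ s) y (B y)) x v - D (ξ s) x (nabla B x v)
          = ∑ t, c t • D (ξ t) x (B x) := by
    -- Constant coefficients `δ_st` single out the section `I_s`.
    obtain ⟨c, h1⟩ := hc.preserves_PQ x v (fun t _ ↦ if s = t then (1 : ℝ) else 0)
      fun t ↦ FunDiffAt.const _
    refine ⟨c, fun B hB hBH ↦ ?_⟩
    have h3 := h1 B hB hBH
    simp only [ite_smul, one_smul, zero_smul, Finset.sum_ite_eq, Finset.mem_univ, if_true] at h3
    exact h3
  obtain ⟨c, h1⟩ := key nabla hc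
  obtain ⟨c', h2⟩ := key nabla' hc'
  refine ⟨fun t ↦ c t - c' t, fun u hu ↦ ?_⟩
  obtain ⟨B, hB, hBH, rfl⟩ := h.exists_horizontal hu
  rw [connDiff_apply _ _ hB, connDiff_apply nabla _ (h.diffAt_phi s hB), map_sub]
  simp only [sub_smul, Finset.sum_sub_distrib, ← h1 B hB hBH, ← h2 B hB hBH]
  abel

-- The map `b ↦ K(b, v)` on `H` satisfies `eq_zero_of_orthogonal`. Its orthogonality is the torsion
-- axiom for `nabla`, since the candidate has no torsion `T(v, ·)` on `H` and the other term `K(v,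
-- b)` is vertical, so lost under projection to `H`.
omit hc' in
lemma connDiff_mixed (hn : 1 ≤ n) {b v : TangentSpace 𝓘(ℝ, Model n) x}
    (hb : b ∈ (ofPara3Sasakian g D ξ).H x) (hv : v ∈ (ofPara3Sasakian g D ξ).V x) :
    connDiff nabla (canonConn g D ξ) x b v = 0 := by
  have hc' := h.isCanonical_canonConn
  obtain ⟨e, he⟩ := h.exists_frame x
  refine h.eq_zero_of_orthogonal he hn
    (IsLinearMap.mk' (fun b ↦ connDiff nabla (canonConn g D ξ) x b v)
      ⟨fun _ _ ↦ by simp, fun _ _ ↦ by simp⟩)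
    (fun u hu ↦ h.connDiff_mem_H hc hc' hu v)
    (fun u hu w hw ↦ h.connDiff_skew hc hc' hu hw v) (fun s ↦ ?_) (fun B hB ↦ ?_) hb
  · exact h.connDiff_comm hc hc' s v
  · refine Eq.trans ?_ (hc.torsion_V x v hv B hB e he)
    refine Finset.sum_congr rfl fun a _ ↦ ?_
    have h1 := torsion_sub_torsion nabla (canonConn g D ξ) x v (e a)
    rw [h.canonConn_torsion_vertical hv (he.1 a), sub_zero] at h1
    have h2 : (ofPara3Sasakian g D ξ).projH x (connDiff nabla (canonConn g D ξ) x v (e a)) = 0 := by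
      rw [PqcData.projH, sub_apply, h.projV_of_mem x (h.connDiff_mem_V hc hc' hv (e a))]
      exact sub_self _
    have h3 : (ofPara3Sasakian g D ξ).projH x (nabla.torsion x v (e a))
        = connDiff nabla (canonConn g D ξ) x (e a) v := by
      rw [h1, map_sub, h.projH_of_mem x (h.connDiff_mem_H hc hc' (he.1 a) v), h2]
      exact sub_zero _
    exact congrArg (fun w ↦ g x (e a) (e a) * g x w (B (e a))) h3.symm

-- On `H` the two previous lemmas cover all directions. For vertical `b`, both connections satisfy
-- `∇φ = 0` and agree on horizontal fields, so `φ(K(b, u)) = 0`; linear independence of the `I_s`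
-- makes `φ` injective.
omit hc' in
lemma connDiff_eq_zero (hn : 1 ≤ n) (b u : TangentSpace 𝓘(ℝ, Model n) x) :
    connDiff nabla (canonConn g D ξ) x b u = 0 := by
  have hc' := h.isCanonical_canonConn
  have hH (c) (hcH : c ∈ (ofPara3Sasakian g D ξ).H x) (u) :
      connDiff nabla (canonConn g D ξ) x c u = 0 := by
    rw [← h.projH_add_projV x u, map_add, h.connDiff_horizontal hc hc' hcH (h.projH_mem x u),
      h.connDiff_mixed hc hn hcH (h.projV_mem x u), add_zero]
  rw [← h.projH_add_projV x b, map_add, add_apply, hH _ (h.projH_mem x b), zero_add]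
  obtain ⟨e, he⟩ := h.exists_frame x
  obtain ⟨B, hB, hBV, hBx⟩ := h.exists_vertical (h.projV_mem x b)
  have hK : connDiff nabla (canonConn g D ξ) x (B x) u ∈ (ofPara3Sasakian g D ξ).V x := by
    rw [hBx]; exact h.connDiff_mem_V hc hc' (h.projV_mem x b) u
  have hη (s) : (ofPara3Sasakian g D ξ).η s x (connDiff nabla (canonConn g D ξ) x (B x) u) = 0 := by
    refine h.phi_linearIndependent he hn (c := fun s ↦
      (ofPara3Sasakian g D ξ).η s x (connDiff nabla (canonConn g D ξ) x (B x) u)) (fun w hw ↦ ?_) s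
    obtain ⟨C, hC, hCH, rfl⟩ := h.exists_horizontal hw
    have h1 := hc.identification x u B C hB hC hBV hCH
    have h2 := hc'.identification x u B C hB hC hBV hCH
    have hd : DiffAt (fun y ↦ ∑ s, (ofPara3Sasakian g D ξ).η s y (B y) •
        (ofPara3Sasakian g D ξ).I s y (C y)) x :=
      DiffAt.sum fun s _ ↦ (h.diffAt_phi s hC).smul (h.diffAt_eta s hB)
    have h3 := connDiff_apply nabla (canonConn g D ξ) hd u
    have h4 := connDiff_apply nabla (canonConn g D ξ) hC u
    rw [hH _ (hCH x)] at h4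
    have h6 : ∑ s, (ofPara3Sasakian g D ξ).η s x (B x) • (ofPara3Sasakian g D ξ).I s x (C x)
        ∈ (ofPara3Sasakian g D ξ).H x := Submodule.sum_mem _ fun s _ ↦ Submodule.smul_mem _ _
      (h.phi_mem_H x s (hCH x))
    rw [hH _ h6] at h3
    rw [← sub_eq_zero.1 h3.symm, ← sub_eq_zero.1 h4.symm] at h2
    have h5 := h1.symm.trans h2
    simp only [connDiff_apply _ _ hB, map_sub, sub_smul, Finset.sum_sub_distrib]
    exact sub_eq_zero.2 h5
  rw [← hBx, ← h.projV_of_mem x hK, PqcData.projV, sum_apply]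
  refine Finset.sum_eq_zero fun s _ ↦ ?_
  rw [ContinuousLinearMap.smulRight_apply, hη, zero_smul]

omit hc' in
/-- Uniqueness of the canonical connection. -/
lemma canonical_eq (hn : 1 ≤ n) {A : VField n M} (hA : DiffAt A x) :
    nabla A x = canonConn g D ξ A x := by
  refine ContinuousLinearMap.ext fun u ↦ sub_eq_zero.1 ?_
  rw [← connDiff_apply _ _ hA, h.connDiff_eq_zero hc hn]

omit hc' in
lemma canonical_torsion (hn : 1 ≤ n) (u v : TangentSpace 𝓘(ℝ, Model n) x) :
    nabla.torsion x u v = (canonConn g D ξ).torsion x u v := by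
  refine sub_eq_zero.1 ?_
  rw [torsion_sub_torsion, h.connDiff_eq_zero hc hn, h.connDiff_eq_zero hc hn, sub_zero]

omit hc' in
lemma canonical_curvOp (hn : 1 ≤ n) (u v w : TangentSpace 𝓘(ℝ, Model n) x) :
    curvOp nabla x u v w = curvOp (canonConn g D ξ) x u v w := by
  have h1 (v : TangentSpace 𝓘(ℝ, Model n) x) : nabla (fun y ↦ nabla (ext w) y (ext v y)) x
      = canonConn g D ξ (fun y ↦ canonConn g D ξ (ext w) y (ext v y)) x := by
    -- The connections are compared only on differentiable fields, so the inner derivatives agree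
    -- merely near `x`; the outer ones then agree because the inner field is differentiable there.
    have h2 : (fun y ↦ nabla (ext w) y (ext v y))
        =ᶠ[𝓝 x] fun y ↦ canonConn g D ξ (ext w) y (ext v y) := by
      filter_upwards [(smoothNear_ext w).eventually_diffAt] with y hy
      rw [h.canonical_eq hc hn hy]
    have h3 := (SmoothNear.conn hc.smooth (smoothNear_ext w) (smoothNear_ext v)).diffAt
    rw [← h.canonical_eq hc hn (h3.congr h2)]
    exact ContinuousLinearMap.ext (conn_congr nabla h3 h2)
  simp only [curvOp, h1, h.canonical_eq hc hn (diffAt_ext w)]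

end IsPara3Sasakian

end

/-! ### Curvature of the Levi-Civita and of the canonical connection -/

section

variable {n : ℕ} {M : Type*} [TopologicalSpace M] [ChartedSpace (Model n) M]
  [IsManifold 𝓘(ℝ, Model n) ∞ M]

variable {g : TwoTensor n M} {D : Connection n M} {ξ : Fin 3 → VField n M}

/-- The pair symmetry of an algebraic curvature tensor. -/
lemma pair_symm_of_bianchi {E : Type*} {R : E → E → E → E → ℝ}
    (b : ∀ u v w z, R u v w z = -R v u w z) (c : ∀ u v w z, R u v w z = -R u v z w)
    (hR : ∀ u v w z, R u v w z + R v w u z + R w u v z = 0) (u v w z : E) :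
    R u v w z = R w z u v := by
  -- The four Bianchi identities for the rotations of `(u, v, w, z)`; the antisymmetries listed
  -- afterwards match their terms so that all but the desired pair cancel.
  have a1 := hR u v w z
  have a2 := hR v w z u
  have a3 := hR w z u v
  have a4 := hR z u v w
  linarith [b v w u z, b w u v z, c v w u z, b z v w u, c z v w u, c w z v u, b w z u v, c w z u v,
    b z u w v, c z u w v, b u w z v, c u w z v, c u v w z, c u v z w, b u v w z, c z u v w, b v z u w,
    c v z u w, b u w v z, c u w v z, b z w v u, c z w v u, b z w u v, c v w z u]

lemma curv_swap_left (D : Connection n M) {x : M} (u v w z : TangentSpace 𝓘(ℝ, Model n) x) :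
    curv g D x u v w z = -curv g D x v u w z := by
  rw [curv, curv, curvOp_eq, curvOp_eq, curvField_swap, map_neg, neg_apply]

namespace IsPara3Sasakian

variable (h : IsPara3Sasakian g D ξ) {x : M} [T2Space M]
include h

/-! ### The curvature of the Levi-Civita connection -/

lemma curv_swap_right (u v w z : TangentSpace 𝓘(ℝ, Model n) x) :
    curv g D x u v w z = -curv g D x u v z w := by
  have h1 := h.leviCivita.curvField_skew h.metric.smooth (smoothNear_ext u) (smoothNear_ext v)
    (smoothNear_ext w) (smoothNear_ext z)
  rw [ext_self, ext_self] at h1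
  rw [curv, curv, curvOp_eq, curvOp_eq, h1, h.symm x w]

lemma curv_bianchi (u v w z : TangentSpace 𝓘(ℝ, Model n) x) :
    curv g D x u v w z + curv g D x v w u z + curv g D x w u v z = 0 := by
  simp only [curv, curvOp_eq]
  rw [← add_apply, ← add_apply, ← map_add, ← map_add, h.leviCivita.bianchi_field
    (smoothNear_ext u) (smoothNear_ext v) (smoothNear_ext w), map_zero, zero_apply]

lemma curv_pair (u v w z : TangentSpace 𝓘(ℝ, Model n) x) :
    curv g D x u v w z = curv g D x w z u v :=
  pair_symm_of_bianchi (curv_swap_left D) h.curv_swap_right h.curv_bianchi u v w z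

/-- `D_B ξ_s = Φ_s B`, so the curvature on `ξ_s` is the antisymmetrized derivative of `Φ_s`, which
the para-Sasakian equation prescribes. -/
lemma curvField_xi {A B : VField n M} (hA : DiffAt A x) (hB : DiffAt B x) (s : Fin 3) :
    curvField D A B (ξ s) x = g x (ξ s x) (B x) • A x - g x (ξ s x) (A x) • B x := by
  rw [curvField, h.conn_phi s _ hB, h.conn_phi s _ hA, h.leviCivita.bracket_eq hA hB, map_sub,
    h.symm x (A x) (B x)]
  module

/-- Skewness puts the curvature on the actual field `ξ_s`, avoiding a comparison with the extension
of its value. -/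
lemma curv_xi (u v w : TangentSpace 𝓘(ℝ, Model n) x) (s : Fin 3) :
    curv g D x u v w (ξ s x) = g x (ξ s x) u * g x w v - g x (ξ s x) v * g x w u := by
  rw [curv, curvOp_eq, h.leviCivita.curvField_skew h.metric.smooth (smoothNear_ext u)
    (smoothNear_ext v) (smoothNear_ext w) ((h.smooth s).smoothNear x),
    h.curvField_xi (diffAt_ext u) (diffAt_ext v)]
  simp only [ext_self, map_sub, map_smul, smul_eq_mul]
  ring

/-- Pair symmetry moves `ξ_s` to the second pair, where `curv_xi` has factors `g(ξ_s, w)` and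
`g(ξ_s, z)`. No condition on `v` is needed, so `v = ξ_t` is included. -/
lemma curv_xi_left {w z : TangentSpace 𝓘(ℝ, Model n) x}
    (hw : w ∈ (ofPara3Sasakian g D ξ).H x) (hz : z ∈ (ofPara3Sasakian g D ξ).H x) (s : Fin 3)
    (v : TangentSpace 𝓘(ℝ, Model n) x) : curv g D x (ξ s x) v w z = 0 := by
  rw [h.curv_pair, h.curv_swap_right, h.curv_xi, mem_H.1 hw, mem_H.1 hz]
  ring

/-! ### The curvature of the canonical connection -/

variable {B C : VField n M}

/-- Pairing with horizontal `z` leaves, from a term `f ξ_s`, only `f Φ_s u`. Horizontality of `C` is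
required at `x` alone, as extensions provide no more; derivatives of `g(ξ_s, C)` therefore survive.
-/
lemma conn_canonDiff (hB : DiffAt B x) (hC : DiffAt C x)
    (hCH : C x ∈ (ofPara3Sasakian g D ξ).H x) {z : TangentSpace 𝓘(ℝ, Model n) x}
    (hz : z ∈ (ofPara3Sasakian g D ξ).H x) (u : TangentSpace 𝓘(ℝ, Model n) x) :
    DiffAt (fun y ↦ canonDiff g D ξ y (C y) (B y)) x ∧
    g x (D (fun y ↦ canonDiff g D ξ y (C y) (B y)) x u) z
      = ∑ s, eps s * (g x (D (ξ s) x (C x)) (B x) * g x (D (ξ s) x u) z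
        + (g x (D (ξ s) x u) (B x) + g x (ξ s x) (D B x u)) * g x (D (ξ s) x (C x)) z
        + g x (ξ s x) (B x) * g x (D (ξ s) x (D C x u)) z
        + (g x (D (ξ s) x u) (C x) + g x (ξ s x) (D C x u)) * g x (D (ξ s) x (B x)) z) := by
  have hg {B C : VField n M} (hB : DiffAt B x) (hC : DiffAt C x) :
      FunDiffAt (n := n) (fun y ↦ g y (B y) (C y)) x := diffAt_metric h.metric.smooth hB hC
  have hξ (s) := (h.smooth s).diffAt x
  have hf (s : Fin 3) : FunDiffAt (n := n) (fun y ↦ eps s * g y (D (ξ s) y (C y)) (B y)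
        - 2 * (g y (ξ (s + 1) y) (B y) * g y (ξ (s + 2) y) (C y)
          - g y (ξ (s + 2) y) (B y) * g y (ξ (s + 1) y) (C y))) x :=
    ((hg (h.diffAt_phi s hC) hB).const_mul _).sub
      ((((hg (hξ _) hB).mul (hg (hξ _) hC)).sub ((hg (hξ _) hB).mul (hg (hξ _) hC))).const_mul _)
  have hk {B : VField n M} (hB : DiffAt B x) (s : Fin 3) :
      FunDiffAt (n := n) (fun y ↦ eps s * g y (ξ s y) (B y)) x := (hg (hξ s) hB).const_mul _
  have hdk {B : VField n M} (hB : DiffAt B x) (s : Fin 3) :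
      dirDeriv (fun y ↦ eps s * g y (ξ s y) (B y)) x u
        = eps s * (g x (D (ξ s) x u) (B x) + g x (ξ s x) (D B x u)) := by
    rw [dirDeriv_const_mul _ (hg (hξ s) hB), h.leviCivita.metric _ _ _ _ (hξ s) hB]
  have e1 := fun s ↦ (hξ s).smul (hf s)
  have e2 := fun s ↦ (h.diffAt_phi s hC).smul (hk hB s)
  have e3 := fun s ↦ (h.diffAt_phi s hB).smul (hk hC s)
  have e4 := fun s ↦ ((e1 s).add (e2 s)).add (e3 s)
  simp only [canonDiff_apply]
  refine ⟨DiffAt.sum fun s _ ↦ e4 s, ?_⟩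
  rw [conn_sum D fun s _ ↦ e4 s, map_sum, sum_apply]
  refine Finset.sum_congr rfl fun s _ ↦ ?_
  rw [conn_add D ((e1 s).add (e2 s)) (e3 s), conn_add D (e1 s) (e2 s), conn_smul D (hf s) (hξ s),
    conn_smul D (hk hB s) (h.diffAt_phi s hC), conn_smul D (hk hC s) (h.diffAt_phi s hB),
    hdk hB, hdk hC, h.conn_phi s u hC]
  simp only [map_add, map_sub, map_smul, add_apply, sub_apply, smul_apply, smul_eq_mul,
    mem_H.1 hCH, mem_H.1 hz]
  ring

lemma metric_canonDiff {z : TangentSpace 𝓘(ℝ, Model n) x}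
    (hz : z ∈ (ofPara3Sasakian g D ξ).H x) (b u : TangentSpace 𝓘(ℝ, Model n) x) :
    g x (canonDiff g D ξ x b u) z
      = ∑ s, eps s * (g x (ξ s x) u * g x (D (ξ s) x b) z
        + g x (ξ s x) b * g x (D (ξ s) x u) z) := by
  rw [canonDiff_apply, map_sum, sum_apply]
  refine Finset.sum_congr rfl fun s _ ↦ ?_
  simp only [map_add, map_smul, add_apply, smul_apply, smul_eq_mul, mem_H.1 hz]
  ring

lemma canonDiff_canonDiff {w z : TangentSpace 𝓘(ℝ, Model n) x}
    (hw : w ∈ (ofPara3Sasakian g D ξ).H x) (hz : z ∈ (ofPara3Sasakian g D ξ).H x)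
    (u v : TangentSpace 𝓘(ℝ, Model n) x) :
    g x (canonDiff g D ξ x (canonDiff g D ξ x w v) u) z
      = (∑ s, ∑ t, (eps s * g x (ξ s x) u) * (eps t * g x (ξ t x) v)
          * g x (D (ξ s) x (D (ξ t) x w)) z)
        - ∑ s, eps s * (g x (D (ξ s) x w) v * g x (D (ξ s) x u) z) := by
  rw [h.metric_canonDiff hz, ← Finset.sum_sub_distrib]
  refine Finset.sum_congr rfl fun s _ ↦ ?_
  have h1 : g x (ξ s x) (canonDiff g D ξ x w v) = -g x (D (ξ s) x w) v := by
    rw [h.canonDiff_horizontal hw]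
    simp only [map_sum, map_add, map_smul, h.orthogonal, mem_H.1 (h.phi_mem_H x _ hw),
      smul_eq_mul, mul_zero, add_zero, mul_ite, Finset.sum_ite_eq, Finset.mem_univ, if_true]
    linear_combination (-g x (D (ξ s) x w) v) * eps_mul_self s
  have h2 : g x (D (ξ s) x (canonDiff g D ξ x w v)) z
      = ∑ t, (eps t * g x (ξ t x) v) * g x (D (ξ s) x (D (ξ t) x w)) z := by
    rw [h.canonDiff_horizontal hw]
    have h3 (t) : g x (D (ξ s) x (ξ t x)) z = 0 := by
      rw [h.skew, mem_H.1 (h.phi_mem_H x s hz), neg_zero]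
    simp only [map_sum, map_add, map_smul, sum_apply, add_apply, smul_apply, h3, smul_eq_mul,
      mul_zero, zero_add]
  rw [h1, h2, Finset.mul_sum, mul_add, Finset.mul_sum, sub_eq_add_neg]
  congr 1
  · exact Finset.sum_congr rfl fun t _ ↦ by ring
  · ring

lemma canonConn_canonConn (hB : SmoothNear B x) (hC : SmoothNear C x)
    (hCH : C x ∈ (ofPara3Sasakian g D ξ).H x) {z : TangentSpace 𝓘(ℝ, Model n) x}
    (hz : z ∈ (ofPara3Sasakian g D ξ).H x) (u : TangentSpace 𝓘(ℝ, Model n) x) :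
    g x (canonConn g D ξ (fun y ↦ canonConn g D ξ C y (B y)) x u) z
      = g x (D (fun y ↦ D C y (B y)) x u) z
        + (∑ s, ∑ t, (eps s * g x (ξ s x) u) * (eps t * g x (ξ t x) (B x))
          * g x (D (ξ s) x (D (ξ t) x (C x))) z)
        + ∑ s, eps s * (
        (g x (D (ξ s) x u) (B x) + g x (ξ s x) (D B x u)) * g x (D (ξ s) x (C x)) z
        + g x (ξ s x) (B x) * g x (D (ξ s) x (D C x u)) z
        + (g x (D (ξ s) x u) (C x) + g x (ξ s x) (D C x u)) * g x (D (ξ s) x (B x)) z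
        + g x (ξ s x) u * g x (D (ξ s) x (D C x (B x))) z
        + g x (ξ s x) (D C x (B x)) * g x (D (ξ s) x u) z) := by
  obtain ⟨h1, h2⟩ := h.conn_canonDiff hB.diffAt hC.diffAt hCH hz u
  rw [canonConn_apply]
  simp only [canonConn_apply]
  rw [conn_add D (hC.conn h.leviCivita.smooth hB).diffAt h1]
  simp only [map_add, add_apply]
  rw [h2, h.metric_canonDiff hz, h.canonDiff_canonDiff hCH hz]
  simp only [mul_add, Finset.sum_add_distrib]
  ring

/-- In the antisymmetrized second derivatives, the terms with first derivatives of the extension of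
`w` are symmetric in `u, v` and cancel. The derivatives of the extensions of `u` and `v` are
absorbed by the bracket, and skewness of `Φ_s` doubles `g(Φ_s u, v)`. The product of corrections
contributes the commutators. -/
lemma curv_canonConn {w z : TangentSpace 𝓘(ℝ, Model n) x}
    (hw : w ∈ (ofPara3Sasakian g D ξ).H x) (hz : z ∈ (ofPara3Sasakian g D ξ).H x)
    (u v : TangentSpace 𝓘(ℝ, Model n) x) :
    curv g (canonConn g D ξ) x u v w z = curv g D x u v w z
      + ∑ s, eps s * (g x (D (ξ s) x u) w * g x (D (ξ s) x v) z
        - g x (D (ξ s) x v) w * g x (D (ξ s) x u) z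
        + 2 * g x (D (ξ s) x u) v * g x (D (ξ s) x w) z)
      + ∑ s, ∑ t, (eps s * g x (ξ s x) u) * (eps t * g x (ξ t x) v)
          * (g x (D (ξ s) x (D (ξ t) x w)) z - g x (D (ξ t) x (D (ξ s) x w)) z) := by
  have hu := smoothNear_ext u
  have hv := smoothNear_ext v
  have hw' : ext w x ∈ (ofPara3Sasakian g D ξ).H x := by rwa [ext_self]
  have h1 := h.canonConn_canonConn hv (smoothNear_ext w) hw' hz u
  have h2 := h.canonConn_canonConn hu (smoothNear_ext w) hw' hz v
  have h3 : g x (canonConn g D ξ (ext w) x (bracket (ext u) (ext v) x)) z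
      = g x (D (ext w) x (bracket (ext u) (ext v) x)) z
        + ∑ s, eps s * ((g x (ξ s x) (D (ext v) x u) - g x (ξ s x) (D (ext u) x v))
          * g x (D (ξ s) x w) z) := by
    rw [canonConn_apply, map_add, add_apply, h.metric_canonDiff hz, ext_self,
      h.leviCivita.bracket_eq hu.diffAt hv.diffAt]
    simp only [ext_self, mem_H.1 hw, zero_mul, add_zero, map_sub]
  have h4 : ∑ s, ∑ t, (eps s * g x (ξ s x) v) * (eps t * g x (ξ t x) u)
          * g x (D (ξ s) x (D (ξ t) x w)) z
      = ∑ s, ∑ t, (eps s * g x (ξ s x) u) * (eps t * g x (ξ t x) v)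
          * g x (D (ξ t) x (D (ξ s) x w)) z := by
    rw [Finset.sum_comm]
    exact Finset.sum_congr rfl fun s _ ↦ Finset.sum_congr rfl fun t _ ↦ by ring
  have h5 (s) : g x (D (ξ s) x v) u = -g x (D (ξ s) x u) v := by rw [h.skew, h.symm]
  simp only [ext_self, h5] at h1 h2 h3
  rw [h4] at h2
  simp only [curv, curvOp, map_sub, sub_apply, h1, h2, h3, mul_sub, Finset.sum_sub_distrib]
  simp only [Fin.sum_univ_three]
  ring

/-- The Ricci identity for `Φ_s`. -/
lemma curvField_phi {A : VField n M} (hA : SmoothNear A x) (hB : SmoothNear B x)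
    (hC : SmoothNear C x) (s : Fin 3) :
    curvField D A B (fun y ↦ D (ξ s) y (C y)) x = D (ξ s) x (curvField D A B C x)
      + g x (D (ξ s) x (A x)) (C x) • B x - g x (D (ξ s) x (B x)) (C x) • A x
      - g x (B x) (C x) • D (ξ s) x (A x) + g x (A x) (C x) • D (ξ s) x (B x) := by
  have hξ := (h.smooth s).diffAt x
  -- The full second derivative of `Φ_s C`; the terms pairing `ξ_s` or a vector field with a first
  -- derivative of `C` drop out on antisymmetrizing in `A, B`.
  have key (A B : VField n M) (hA : SmoothNear A x) (hB : SmoothNear B x) :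
      D (fun y ↦ D (fun y ↦ D (ξ s) y (C y)) y (B y)) x (A x)
        = D (ξ s) x (D (fun y ↦ D C y (B y)) x (A x)) + g x (ξ s x) (D C x (B x)) • A x
          - g x (A x) (D C x (B x)) • ξ s x
          + (g x (ξ s x) (C x) • D B x (A x)
            + (g x (D (ξ s) x (A x)) (C x) + g x (ξ s x) (D C x (A x))) • B x)
          - (g x (B x) (C x) • D (ξ s) x (A x)
            + (g x (D B x (A x)) (C x) + g x (B x) (D C x (A x))) • ξ s x) := by
    have e0 := hC.conn h.leviCivita.smooth hB
    have e1 := diffAt_metric h.metric.smooth hξ hC.diffAt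
    have e2 := diffAt_metric h.metric.smooth hB.diffAt hC.diffAt
    have e3 := h.diffAt_phi s e0.diffAt
    have h1 : (fun y ↦ D (ξ s) y (D C y (B y)) + (g y (ξ s y) (C y) • B y
        - g y (B y) (C y) • ξ s y)) =ᶠ[𝓝 x] fun y ↦ D (fun y ↦ D (ξ s) y (C y)) y (B y) := by
      filter_upwards [hC.eventually_diffAt] with y hy
      rw [h.conn_phi s _ hy]
    have e4 := e3.add ((hB.diffAt.smul e1).sub (hξ.smul e2))
    rw [← conn_congr D e4 h1, conn_add D e3 ((hB.diffAt.smul e1).sub (hξ.smul e2)),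
      conn_sub D (hB.diffAt.smul e1) (hξ.smul e2), conn_smul D e1 hB.diffAt, conn_smul D e2 hξ,
      h.conn_phi s _ e0.diffAt, h.leviCivita.metric _ _ _ _ hξ hC.diffAt,
      h.leviCivita.metric _ _ _ _ hB.diffAt hC.diffAt]
    module
  rw [curvField, curvField, key A B hA hB, key B A hB hA, h.conn_phi s _ hC.diffAt,
    h.leviCivita.bracket_eq hA.diffAt hB.diffAt]
  simp only [map_sub, sub_apply]
  module

lemma curv_phi (s : Fin 3) (u v w z : TangentSpace 𝓘(ℝ, Model n) x) :
    curv g D x u v (D (ξ s) x w) z + curv g D x u v w (D (ξ s) x z)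
      = g x (D (ξ s) x u) w * g x v z - g x (D (ξ s) x v) w * g x u z
        - g x v w * g x (D (ξ s) x u) z + g x u w * g x (D (ξ s) x v) z := by
  have hw : SmoothNear (fun y ↦ D (ξ s) y (ext w y)) x :=
    ((h.smooth s).smoothNear x).conn h.leviCivita.smooth (smoothNear_ext w)
  -- The field `Φ_s (ext w)` and the extension of `Φ_s w` agree only at `x`. Applying skewness to
  -- both shows that their curvatures pair equally with `z`.
  have h1 := h.leviCivita.curvField_skew h.metric.smooth (smoothNear_ext u) (smoothNear_ext v)
    hw (smoothNear_ext z)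
  have h2 := h.leviCivita.curvField_skew h.metric.smooth (smoothNear_ext u) (smoothNear_ext v)
    (smoothNear_ext (D (ξ s) x w)) (smoothNear_ext z)
  have h3 := h.curvField_phi (smoothNear_ext u) (smoothNear_ext v) (smoothNear_ext w) s
  simp only [ext_self] at h1 h2 h3
  rw [curv, curv, curvOp_eq, curvOp_eq, h2, ← h1, h3]
  simp only [map_add, map_sub, map_smul, add_apply, sub_apply, smul_apply, smul_eq_mul, h.skew x s
    (curvField _ _ _ _ _)]
  ring

end IsPara3Sasakian

end

/-! ### The horizontal curvature as an algebraic curvature tensor -/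

section

variable {n : ℕ} {M : Type*} [TopologicalSpace M] [ChartedSpace (Model n) M]
  [IsManifold 𝓘(ℝ, Model n) ∞ M]

variable {g : TwoTensor n M} {D : Connection n M} {ξ : Fin 3 → VField n M}

/-- The algebraic curvature tensor which agrees with the curvature of the canonical connection on
the horizontal space. -/
def horCurv (g : TwoTensor n M) (D : Connection n M) (ξ : Fin 3 → VField n M) (x : M)
    (u v w z : TangentSpace 𝓘(ℝ, Model n) x) : ℝ :=
  curv g D x u v w z
    + ∑ s, eps s * (g x (D (ξ s) x u) w * g x (D (ξ s) x v) z
      - g x (D (ξ s) x v) w * g x (D (ξ s) x u) z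
      + 2 * g x (D (ξ s) x u) v * g x (D (ξ s) x w) z)

namespace IsPara3Sasakian

variable (h : IsPara3Sasakian g D ξ) {x : M} [T2Space M]
include h

lemma phi_swap (s : Fin 3) (u v : TangentSpace 𝓘(ℝ, Model n) x) :
    g x (D (ξ s) x u) v = -g x (D (ξ s) x v) u := by rw [h.skew, h.symm]

lemma horCurv_swap_left (u v w z : TangentSpace 𝓘(ℝ, Model n) x) :
    horCurv g D ξ x u v w z = -horCurv g D ξ x v u w z := by
  simp only [horCurv, Fin.sum_univ_three, curv_swap_left D u v, h.phi_swap _ u v]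
  ring

lemma horCurv_swap_right (u v w z : TangentSpace 𝓘(ℝ, Model n) x) :
    horCurv g D ξ x u v w z = -horCurv g D ξ x u v z w := by
  simp only [horCurv, Fin.sum_univ_three, h.curv_swap_right u v w z, h.phi_swap _ w z]
  ring

/-- The correction satisfies the identity separately for each `s`, using skewness of `Φ_s`; this is
where the coefficient `2` matters. -/
lemma horCurv_bianchi (u v w z : TangentSpace 𝓘(ℝ, Model n) x) :
    horCurv g D ξ x u v w z + horCurv g D ξ x v w u z + horCurv g D ξ x w u v z = 0 := by
  have h1 := h.curv_bianchi u v w z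
  simp only [horCurv, Fin.sum_univ_three, h.phi_swap _ v u, h.phi_swap _ w u, h.phi_swap _ w v]
  linear_combination h1

lemma horCurv_pair (u v w z : TangentSpace 𝓘(ℝ, Model n) x) :
    horCurv g D ξ x u v w z = horCurv g D ξ x w z u v :=
  pair_symm_of_bianchi h.horCurv_swap_left h.horCurv_swap_right h.horCurv_bianchi u v w z

omit h [T2Space M] in
lemma isLinearMap_horCurv (u v w : TangentSpace 𝓘(ℝ, Model n) x) :
    IsLinearMap ℝ (horCurv g D ξ x u v w) where
  map_add a b := by
    simp only [horCurv, curv, map_add, Fin.sum_univ_three]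
    ring
  map_smul c a := by
    simp only [horCurv, curv, map_smul, Fin.sum_univ_three, smul_eq_mul]
    ring

/-- Linearity is evident only in the last argument, because the others enter through `ext`. The
curvature symmetries move the first argument to the last place. -/
lemma isLinearMap_horCurv_left (v w z : TangentSpace 𝓘(ℝ, Model n) x) :
    IsLinearMap ℝ (fun u ↦ horCurv g D ξ x u v w z) := by
  have h1 (u) : horCurv g D ξ x u v w z = horCurv g D ξ x z w v u := by
    rw [h.horCurv_pair u, h.horCurv_swap_left w, h.horCurv_swap_right z, neg_neg]
  simp only [h1]
  exact isLinearMap_horCurv z w v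

lemma isLinearMap_horCurv_third (u v z : TangentSpace 𝓘(ℝ, Model n) x) :
    IsLinearMap ℝ (fun w ↦ horCurv g D ξ x u v w z) := by
  simp only [fun w ↦ h.horCurv_pair u v w z]
  exact h.isLinearMap_horCurv_left z u v

lemma curv_canonConn_horizontal {u v w z : TangentSpace 𝓘(ℝ, Model n) x}
    (hv : u ∈ (ofPara3Sasakian g D ξ).H x ∨ v ∈ (ofPara3Sasakian g D ξ).H x)
    (hw : w ∈ (ofPara3Sasakian g D ξ).H x) (hz : z ∈ (ofPara3Sasakian g D ξ).H x) :
    curv g (canonConn g D ξ) x u v w z = horCurv g D ξ x u v w z := by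
  rw [h.curv_canonConn hw hz, horCurv, add_eq_left]
  refine Finset.sum_eq_zero fun s _ ↦ Finset.sum_eq_zero fun t _ ↦ ?_
  rcases hv with hv | hv <;> rw [mem_H.1 hv] <;> ring

lemma curv_canonConn_xi_left {v w z : TangentSpace 𝓘(ℝ, Model n) x}
    (hv : v ∈ (ofPara3Sasakian g D ξ).H x) (hw : w ∈ (ofPara3Sasakian g D ξ).H x)
    (hz : z ∈ (ofPara3Sasakian g D ξ).H x) (s : Fin 3) :
    curv g (canonConn g D ξ) x (ξ s x) v w z = 0 := by
  rw [h.curv_canonConn_horizontal (.inr hv) hw hz, horCurv, h.curv_xi_left hw hz, zero_add]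
  refine Finset.sum_eq_zero fun t _ ↦ ?_
  have h1 {v} (hv : v ∈ (ofPara3Sasakian g D ξ).H x) : g x (D (ξ t) x (ξ s x)) v = 0 := by
    rw [h.skew, mem_H.1 (h.phi_mem_H x t hv), neg_zero]
  rw [h1 hv, h1 hw, h1 hz]
  ring

/-- Here the commutator term of `curv_canonConn` survives, and it cancels the term `2 g(Φ_r ξ_s,
ξ_t) g(Φ_r w, z)`. -/
lemma curv_canonConn_xi_xi {w z : TangentSpace 𝓘(ℝ, Model n) x}
    (hw : w ∈ (ofPara3Sasakian g D ξ).H x) (hz : z ∈ (ofPara3Sasakian g D ξ).H x) (s t : Fin 3) :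
    curv g (canonConn g D ξ) x (ξ s x) (ξ t x) w z = 0 := by
  have h1 (r : Fin 3) {v} (hv : v ∈ (ofPara3Sasakian g D ξ).H x) :
      g x (D (ξ r) x (ξ s x)) v = 0 := by
    rw [h.skew, mem_H.1 (h.phi_mem_H x r hv), neg_zero]
  rw [h.curv_canonConn hw hz, h.curv_xi_left hw hz]
  simp only [h1 _ hw, h1 _ hz]
  obtain ⟨⟨p1, p2, p3⟩, ⟨p4, p5, p6⟩, ⟨p7, p8, p9⟩⟩ := h.phi_table x
  obtain ⟨⟨q1, q2, q3⟩, ⟨q4, q5, q6⟩, ⟨q7, q8, q9⟩⟩ := h.orthogonal_table x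
  obtain ⟨⟨r1, r2, r3⟩, ⟨r4, r5, r6⟩, ⟨r7, r8, r9⟩⟩ := h.phi_phi_table_H hw
  fin_cases s <;> fin_cases t <;>
    simp [Fin.sum_univ_three, p1, p2, p3, p4, p5, p6, p7, p8, p9, q1, q2, q3, q4, q5, q6, q7, q8,
      q9, r1, r2, r3, r4, r5, r6, r7, r8, r9] <;> ring

/-- The commutator of the curvature with `I_j`. -/
lemma horCurv_phi {u v w z : TangentSpace 𝓘(ℝ, Model n) x}
    (hw : w ∈ (ofPara3Sasakian g D ξ).H x)
    (hz : z ∈ (ofPara3Sasakian g D ξ).H x) (j : Fin 3) :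
    horCurv g D ξ x u v (D (ξ j) x w) z + horCurv g D ξ x u v w (D (ξ j) x z)
      = ∑ s, 2 * eps s * g x (D (ξ s) x u) v
          * g x (D (ξ s) x (D (ξ j) x w) - D (ξ j) x (D (ξ s) x w)) z := by
  have h1 := h.curv_phi j u v w z
  have sk (s : Fin 3) (u v) : g x (D (ξ s) x u) v = -g x u (D (ξ s) x v) := h.skew x s u v
  obtain ⟨⟨q1, q2, q3⟩, ⟨q4, q5, q6⟩, ⟨q7, q8, q9⟩⟩ := h.phi_phi_table_H hz
  obtain ⟨⟨r1, r2, r3⟩, ⟨r4, r5, r6⟩, ⟨r7, r8, r9⟩⟩ := h.phi_phi_table_H hw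
  have e1 (s) : g x (D (ξ s) x (D (ξ j) x w) - D (ξ j) x (D (ξ s) x w)) z
      = g x (D (ξ s) x (D (ξ j) x w)) z + g x (D (ξ s) x w) (D (ξ j) x z) := by
    rw [map_sub, sub_apply, h.skew x j]
    ring
  simp only [e1]
  -- The mixed products in the correction cancel exactly the right side of `curv_phi`. Only the
  -- terms with `g(Φ_s u, v)` remain, and they form the commutators.
  have h2 : ∑ s, eps s * (g x (D (ξ s) x u) (D (ξ j) x w) * g x (D (ξ s) x v) z
      + g x (D (ξ s) x u) w * g x (D (ξ s) x v) (D (ξ j) x z)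
      - g x (D (ξ s) x v) (D (ξ j) x w) * g x (D (ξ s) x u) z
      - g x (D (ξ s) x v) w * g x (D (ξ s) x u) (D (ξ j) x z))
      = -(g x (D (ξ j) x u) w * g x v z - g x (D (ξ j) x v) w * g x u z
        - g x v w * g x (D (ξ j) x u) z + g x u w * g x (D (ξ j) x v) z) := by
    simp only [sk, Fin.sum_univ_three]
    fin_cases j <;>
    · simp [r1, r2, r3, r4, r5, r6, r7, r8, r9, q1, q2, q3, q4, q5, q6, q7, q8, q9]
      ring
  simp only [horCurv]
  simp only [Fin.sum_univ_three] at h2 ⊢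
  linear_combination h1 + h2

end IsPara3Sasakian

end

/-! ### Contractions of the horizontal curvature -/

section

variable {n : ℕ} {M : Type*} [TopologicalSpace M] [ChartedSpace (Model n) M]
  [IsManifold 𝓘(ℝ, Model n) ∞ M]

variable {g : TwoTensor n M} {D : Connection n M} {ξ : Fin 3 → VField n M}

namespace IsPara3Sasakian

variable (h : IsPara3Sasakian g D ξ) {x : M} [T2Space M]
  {e : Fin (2 * n) ⊕ Fin (2 * n) → TangentSpace 𝓘(ℝ, Model n) x}
  (he : (ofPara3Sasakian g D ξ).IsFrame x e)
include h he

/-- The contraction of `I_s` with a form commuting with all `I_j` vanishes. -/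
lemma sum_commuting {P : TangentSpace 𝓘(ℝ, Model n) x → TangentSpace 𝓘(ℝ, Model n) x → ℝ}
    (h1 : ∀ v, IsLinearMap ℝ (fun u ↦ P u v)) (h2 : ∀ u, IsLinearMap ℝ (P u))
    (hP : ∀ j, ∀ w ∈ (ofPara3Sasakian g D ξ).H x, ∀ z ∈ (ofPara3Sasakian g D ξ).H x,
      P (D (ξ j) x w) z + P w (D (ξ j) x z) = 0) (s : Fin 3) :
    ∑ a, g x (e a) (e a) * P (e a) (D (ξ s) x (e a)) = 0 := by
  -- Every index is of the form `i + 2`, so that `I_s` is, up to sign, the product `I_i I_{i+1}`.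
  obtain ⟨i, rfl⟩ : ∃ i : Fin 3, s = i + 2 := ⟨s + 1, by fin_cases s <;> rfl⟩
  have hm (a) : P (e a) (D (ξ i) x (D (ξ (i + 1)) x (e a)))
      = -eps (i + 2) * P (e a) (D (ξ (i + 2)) x (e a)) := by
    rw [h.phi_mul, mem_H.1 (he.1 a), zero_smul, add_zero, ← neg_smul, (h2 _).map_smul, smul_eq_mul]
  have hm' (a) : P (e a) (D (ξ (i + 1)) x (D (ξ i) x (e a)))
      = eps (i + 2) * P (e a) (D (ξ (i + 2)) x (e a)) := by
    rw [h.phi_mul', mem_H.1 (he.1 a), zero_smul, add_zero, (h2 _).map_smul, smul_eq_mul]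
  have h3 (a) : P (D (ξ i) x (e a)) (D (ξ (i + 1)) x (e a))
      = eps (i + 2) * P (e a) (D (ξ (i + 2)) x (e a)) := by
    have := hP i _ (he.1 a) _ (h.phi_mem_H x (i + 1) (he.1 a))
    rw [hm] at this
    linarith
  -- Moving `I_i` by invariance of `P` or by the contraction gives `I_i I_{i+1}` or `I_{i+1} I_i`,
  -- which have opposite signs. So the sum equals its own negative.
  have h4 := h.frame_sum_phi he i (F := fun u v ↦ P u (D (ξ (i + 1)) x v)) (fun v ↦ h1 _)
    fun u ↦ ⟨fun a b ↦ by rw [map_add, (h2 u).map_add], fun c a ↦ by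
      rw [map_smul, (h2 u).map_smul]⟩
  simp only [h3, hm'] at h4
  have h5 : eps (i + 2) * ∑ a, g x (e a) (e a) * P (e a) (D (ξ (i + 2)) x (e a)) = 0 := by
    rw [Finset.mul_sum]
    have : ∀ a, eps (i + 2) * (g x (e a) (e a) * P (e a) (D (ξ (i + 2)) x (e a)))
        = g x (e a) (e a) * (eps (i + 2) * P (e a) (D (ξ (i + 2)) x (e a))) := fun a ↦ by ring
    simp only [this]
    linarith
  exact (mul_eq_zero.1 h5).resolve_left (eps_ne_zero _)

lemma sum_phi_phi (s t : Fin 3) :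
    ∑ a, g x (e a) (e a) * g x (D (ξ s) x (e a)) (D (ξ t) x (e a))
      = if s = t then -eps s * (4 * n) else 0 := by
  simp only [fun a ↦ h.metric_phi_phi s t (he.1 a), mul_ite, mul_zero]
  split_ifs
  · rw [← h.frame_sum_one he, Finset.mul_sum]
    exact Finset.sum_congr rfl fun a _ ↦ by ring
  · simp

/-- Subtracting `∑ 2ε_t g(Φ_t u, v) g(Φ_t ·, ·)` leaves a form commuting with all `I_j`, which does
not contribute. The subtracted part gives `2ε_s · (-4n ε_s) = -8n`. -/
lemma sum_horCurv_phi (u v : TangentSpace 𝓘(ℝ, Model n) x) (s : Fin 3) :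
    ∑ a, g x (e a) (e a) * horCurv g D ξ x u v (e a) (D (ξ s) x (e a))
      = -8 * n * g x (D (ξ s) x u) v := by
  let P (w z : TangentSpace 𝓘(ℝ, Model n) x) : ℝ :=
    horCurv g D ξ x u v w z - ∑ t, 2 * eps t * g x (D (ξ t) x u) v * g x (D (ξ t) x w) z
  have h1 := h.sum_commuting he (P := P)
    (fun z ↦ ⟨fun a b ↦ by
        simp only [P, (h.isLinearMap_horCurv_third u v z).map_add, map_add, add_apply, mul_add,
          Finset.sum_add_distrib]
        ring,
      fun c a ↦ by
        simp only [P, (h.isLinearMap_horCurv_third u v z).map_smul, map_smul, smul_apply,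
          smul_eq_mul, mul_sub, Fin.sum_univ_three]
        ring⟩)
    (fun w ↦ ⟨fun a b ↦ by
        simp only [P, (isLinearMap_horCurv u v w).map_add, map_add, mul_add,
          Finset.sum_add_distrib]
        ring,
      fun c a ↦ by
        simp only [P, (isLinearMap_horCurv u v w).map_smul, map_smul,
          smul_eq_mul, mul_sub, Fin.sum_univ_three]
        ring⟩)
    (fun j w hw z hz ↦ by
      have h2 := h.horCurv_phi (u := u) (v := v) hw hz j
      have e1 (s) : g x (D (ξ s) x (D (ξ j) x w) - D (ξ j) x (D (ξ s) x w)) z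
          = g x (D (ξ s) x (D (ξ j) x w)) z + g x (D (ξ s) x w) (D (ξ j) x z) := by
        rw [map_sub, sub_apply, h.skew x j]
        ring
      simp only [e1, Fin.sum_univ_three] at h2
      simp only [P, Fin.sum_univ_three]
      linarith) s
  simp only [P, mul_sub, Finset.sum_sub_distrib, Finset.mul_sum] at h1
  rw [Finset.sum_comm] at h1
  have h3 (t) : ∑ a, g x (e a) (e a) * (2 * eps t * g x (D (ξ t) x u) v
        * g x (D (ξ t) x (e a)) (D (ξ s) x (e a)))
      = if t = s then -8 * n * g x (D (ξ s) x u) v else 0 := by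
    have h4 := h.sum_phi_phi he t s
    have h5 : ∑ a, g x (e a) (e a) * (2 * eps t * g x (D (ξ t) x u) v
        * g x (D (ξ t) x (e a)) (D (ξ s) x (e a)))
        = 2 * eps t * g x (D (ξ t) x u) v
          * ∑ a, g x (e a) (e a) * g x (D (ξ t) x (e a)) (D (ξ s) x (e a)) := by
      rw [Finset.mul_sum]
      exact Finset.sum_congr rfl fun a _ ↦ by ring
    rw [h5, h4]
    split_ifs with hts
    · subst hts
      linear_combination (-8 * n * g x (D (ξ t) x u) v) * eps_mul_self t
    · simp
  simp only [h3, Finset.sum_ite_eq', Finset.mem_univ, if_true] at h1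
  linarith

lemma sum_phi_horCurv (u v : TangentSpace 𝓘(ℝ, Model n) x) (s : Fin 3) :
    ∑ a, g x (e a) (e a) * horCurv g D ξ x (e a) (D (ξ s) x (e a)) u v
      = -8 * n * g x (D (ξ s) x u) v := by
  rw [← h.sum_horCurv_phi he u v s]
  exact Finset.sum_congr rfl fun a _ ↦ by rw [h.horCurv_pair]

/-- By the Bianchi identity and pair symmetry, the contraction in `sum_horCurv_phi` is a difference
of two mixed ones, which are opposite because `I_s` is skew; hence the factor `-1/2`. -/
lemma sum_horCurv_mixed (u v : TangentSpace 𝓘(ℝ, Model n) x) (s : Fin 3) :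
    ∑ a, g x (e a) (e a) * horCurv g D ξ x (e a) u v (D (ξ s) x (e a))
      = 4 * n * g x (D (ξ s) x u) v := by
  have h1 := h.sum_horCurv_phi he u v s
  have h2 := h.frame_sum_phi he s (F := fun a b ↦ horCurv g D ξ x a u v b)
    (fun z ↦ h.isLinearMap_horCurv_left u v z) (fun a ↦ isLinearMap_horCurv a u v)
  have h3 (a) : horCurv g D ξ x u v (e a) (D (ξ s) x (e a))
      = horCurv g D ξ x (D (ξ s) x (e a)) u v (e a)
        - horCurv g D ξ x (e a) u v (D (ξ s) x (e a)) := by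
    have h4 := h.horCurv_bianchi u v (e a) (D (ξ s) x (e a))
    have h5 := h.horCurv_swap_left v (e a) u (D (ξ s) x (e a))
    have h6 := h.horCurv_pair (e a) v u (D (ξ s) x (e a))
    have h7 := h.horCurv_swap_left u (D (ξ s) x (e a)) (e a) v
    have h8 := h.horCurv_swap_right (D (ξ s) x (e a)) u (e a) v
    linarith
  simp only [h3, mul_sub, Finset.sum_sub_distrib] at h1
  linarith

/-- The horizontal Ricci tensor. -/
lemma sum_horCurv_self {u v : TangentSpace 𝓘(ℝ, Model n) x}
    (hu : u ∈ (ofPara3Sasakian g D ξ).H x) (hv : v ∈ (ofPara3Sasakian g D ξ).H x) :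
    ∑ a, g x (e a) (e a) * horCurv g D ξ x (e a) u v (e a) = (4 * n + 8) * g x u v := by
  -- The Ricci trace arises from the mixed contraction at `I_1 v` by commuting `R(e_a, u)` with
  -- `I_1`. The mixed contraction contributes `4n`, and the commutators with `I_2` and `I_3`
  -- contribute `4` each.
  have h1 := h.sum_horCurv_mixed he u (D (ξ 0) x v) 0
  obtain ⟨⟨q1, q2, q3⟩, ⟨q4, q5, q6⟩, ⟨q7, q8, q9⟩⟩ := h.phi_phi_table_H hv
  obtain ⟨⟨r1, r2, r3⟩, ⟨r4, r5, r6⟩, ⟨r7, r8, r9⟩⟩ := h.phi_phi_table_H hu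
  have h2 (a) : horCurv g D ξ x (e a) u v (e a)
      = -4 * (g x (e a) (D (ξ 1) x u) * g x (D (ξ 1) x v) (e a)
          - g x (e a) (D (ξ 2) x u) * g x (D (ξ 2) x v) (e a))
        - horCurv g D ξ x (e a) u (D (ξ 0) x v) (D (ξ 0) x (e a)) := by
    obtain ⟨⟨p1, p2, p3⟩, ⟨p4, p5, p6⟩, ⟨p7, p8, p9⟩⟩ := h.phi_phi_table_H (he.1 a)
    have h3 := h.horCurv_phi (u := e a) (v := u) hv (h.phi_mem_H x 0 (he.1 a)) 0
    have sk (s : Fin 3) (u v) : g x (D (ξ s) x u) v = -g x u (D (ξ s) x v) := h.skew x s u v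
    simp only [Fin.sum_univ_three, q1, q2, q3, q4, q7, p1, sub_self, mul_zero, zero_add,
      map_sub, map_neg, sub_apply, neg_apply, eps_one, eps_two] at h3
    have e1 : g x (D (ξ 2) x v) (D (ξ 0) x (e a)) = -g x (D (ξ 1) x v) (e a) := by
      rw [← neg_neg (g x (D (ξ 2) x v) _), ← h.skew, q3]
    have e2 : g x (D (ξ 1) x v) (D (ξ 0) x (e a)) = -g x (D (ξ 2) x v) (e a) := by
      rw [← neg_neg (g x (D (ξ 1) x v) _), ← h.skew, q2]
    rw [e1, e2, h.skew x 1 (e a), h.skew x 2 (e a)] at h3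
    linarith
  have h4 (s t : Fin 3) :
      ∑ a, g x (e a) (e a) * (g x (e a) (D (ξ s) x u) * g x (D (ξ t) x v) (e a))
        = g x (D (ξ t) x v) (D (ξ s) x u) :=
    h.frame_sum_linear he (L := fun w ↦ g x (D (ξ t) x v) w)
      ⟨fun _ _ ↦ map_add _ _ _, fun _ _ ↦ map_smul _ _ _⟩ (h.phi_mem_H x s hu)
  have h5 : ∑ a, g x (e a) (e a) * horCurv g D ξ x (e a) u v (e a)
      = -4 * (g x (D (ξ 1) x v) (D (ξ 1) x u) - g x (D (ξ 2) x v) (D (ξ 2) x u))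
        - 4 * n * g x (D (ξ 0) x u) (D (ξ 0) x v) := by
    rw [← h1, ← h4, ← h4, ← Finset.sum_sub_distrib, Finset.mul_sum, ← Finset.sum_sub_distrib]
    refine Finset.sum_congr rfl fun a _ ↦ ?_
    rw [h2]
    ring
  rw [h5, h.skew, h.skew, h.skew, r5, r9, q1, map_neg, h.symm x v]
  ring

end IsPara3Sasakian

end

/-! ### Transfer to an arbitrary canonical connection -/

section

variable {n : ℕ} {M : Type*} [TopologicalSpace M] [ChartedSpace (Model n) M]
  [IsManifold 𝓘(ℝ, Model n) ∞ M]

variable {g : TwoTensor n M} {D : Connection n M} {ξ : Fin 3 → VField n M}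

namespace IsPara3Sasakian

variable (h : IsPara3Sasakian g D ξ) {x : M} [T2Space M] {nabla : Connection n M}
  (hc : (ofPara3Sasakian g D ξ).IsCanonical nabla) (hn : 1 ≤ n)
include h hc hn

/-! ### The torsion and the curvature of a canonical connection -/

lemma canonical_torsion_vertical {v u : TangentSpace 𝓘(ℝ, Model n) x}
    (hv : v ∈ (ofPara3Sasakian g D ξ).V x) (hu : u ∈ (ofPara3Sasakian g D ξ).H x) :
    nabla.torsion x v u = 0 := by
  rw [h.canonical_torsion hc hn, h.canonConn_torsion_vertical hv hu]

lemma canonical_T (s : Fin 3) {u : TangentSpace 𝓘(ℝ, Model n) x}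
    (hu : u ∈ (ofPara3Sasakian g D ξ).H x) (v : TangentSpace 𝓘(ℝ, Model n) x) :
    (ofPara3Sasakian g D ξ).T nabla x ((ofPara3Sasakian g D ξ).ξ s x) u v = 0 := by
  rw [PqcData.T, h.canonical_torsion_vertical hc hn (Submodule.subset_span ⟨s, rfl⟩) hu, map_zero,
    zero_apply]

lemma canonical_tau {u v : TangentSpace 𝓘(ℝ, Model n) x}
    (hu : u ∈ (ofPara3Sasakian g D ξ).H x) (hv : v ∈ (ofPara3Sasakian g D ξ).H x) :
    (ofPara3Sasakian g D ξ).τ nabla x u v = 0 := by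
  rw [PqcData.τ, neg_eq_zero]
  refine Finset.sum_eq_zero fun s _ ↦ ?_
  have hI : (ofPara3Sasakian g D ξ).I s x u ∈ (ofPara3Sasakian g D ξ).H x := h.phi_mem_H x s hu
  rw [PqcData.Tsym, h.canonical_T hc hn s hI, h.canonical_T hc hn s hv]
  simp

lemma canonical_mu (s : Fin 3) {u v : TangentSpace 𝓘(ℝ, Model n) x}
    (hu : u ∈ (ofPara3Sasakian g D ξ).H x) (hv : v ∈ (ofPara3Sasakian g D ξ).H x) :
    (ofPara3Sasakian g D ξ).μ nabla s x u v = 0 := by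
  have hI : (ofPara3Sasakian g D ξ).I s x u ∈ (ofPara3Sasakian g D ξ).H x := h.phi_mem_H x s hu
  rw [PqcData.μ, PqcData.Tskew, h.canonical_T hc hn s hI, h.canonical_T hc hn s hv]
  simp

lemma canonical_curv (u v w z : TangentSpace 𝓘(ℝ, Model n) x) :
    curv g nabla x u v w z = curv g (canonConn g D ξ) x u v w z := by
  rw [curv, curv, h.canonical_curvOp hc hn]

variable {e : Fin (2 * n) ⊕ Fin (2 * n) → TangentSpace 𝓘(ℝ, Model n) x}
  (he : (ofPara3Sasakian g D ξ).IsFrame x e) {u v : TangentSpace 𝓘(ℝ, Model n) x}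
include he

lemma canonical_Ric (hu : u ∈ (ofPara3Sasakian g D ξ).H x)
    (hv : v ∈ (ofPara3Sasakian g D ξ).H x) :
    (ofPara3Sasakian g D ξ).Ric nabla e u v = (4 * n + 8) * g x u v := by
  rw [← h.sum_horCurv_self he hu hv]
  change ∑ a, g x (e a) (e a) * curv g nabla x (e a) u v (e a) = _
  simp only [h.canonical_curv hc hn, fun a ↦ h.curv_canonConn_horizontal (.inr hu) hv (he.1 a)]

lemma canonical_Scal : (ofPara3Sasakian g D ξ).Scal nabla e = 16 * n * (n + 2) := by
  change ∑ a, g x (e a) (e a) * (ofPara3Sasakian g D ξ).Ric nabla e (e a) (e a) = _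
  simp only [fun a ↦ h.canonical_Ric hc hn he (he.1 a) (he.1 a)]
  have h1 (a) : g x (e a) (e a) * ((4 * n + 8) * g x (e a) (e a))
      = (4 * n + 8) * (g x (e a) (e a) * g x (e a) (e a)) := by ring
  simp only [h1]
  rw [← Finset.mul_sum, h.frame_sum_one he]
  ring

lemma canonical_ricciForm (s : Fin 3) (hu : u ∈ (ofPara3Sasakian g D ξ).H x)
    (hv : v ∈ (ofPara3Sasakian g D ξ).H x) :
    (ofPara3Sasakian g D ξ).ricciForm nabla e s u v
      = -2 * (ofPara3Sasakian g D ξ).omega s x u v := by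
  change 1 / (4 * n) * ∑ a, g x (e a) (e a) * curv g nabla x u v (e a) (D (ξ s) x (e a)) = _
  simp only [h.canonical_curv hc hn,
    fun a ↦ h.curv_canonConn_horizontal (u := u) (.inr hv) (he.1 a) (h.phi_mem_H x s (he.1 a))]
  rw [h.sum_horCurv_phi he, h.omega_eq_of_mem x s hu hv]
  field_simp
  ring

lemma canonical_varrhoForm (s : Fin 3) (hu : u ∈ (ofPara3Sasakian g D ξ).H x)
    (hv : v ∈ (ofPara3Sasakian g D ξ).H x) :
    (ofPara3Sasakian g D ξ).varrhoForm nabla e s u v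
      = -2 * (ofPara3Sasakian g D ξ).omega s x u v := by
  change 1 / (4 * n) * ∑ a, g x (e a) (e a) * curv g nabla x (e a) (D (ξ s) x (e a)) u v = _
  simp only [h.canonical_curv hc hn,
    fun a ↦ h.curv_canonConn_horizontal (v := D (ξ s) x (e a)) (.inl (he.1 a)) hu hv]
  rw [h.sum_phi_horCurv he, h.omega_eq_of_mem x s hu hv]
  field_simp
  ring

lemma canonical_zetaForm (s : Fin 3) (hu : u ∈ (ofPara3Sasakian g D ξ).H x)
    (hv : v ∈ (ofPara3Sasakian g D ξ).H x) :
    (ofPara3Sasakian g D ξ).zetaForm nabla e s u v = (ofPara3Sasakian g D ξ).omega s x u v := by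
  change 1 / (4 * n) * ∑ a, g x (e a) (e a) * curv g nabla x (e a) u v (D (ξ s) x (e a)) = _
  simp only [h.canonical_curv hc hn,
    fun a ↦ h.curv_canonConn_horizontal (.inr hu) hv (h.phi_mem_H x s (he.1 a))]
  rw [h.sum_horCurv_mixed he, h.omega_eq_of_mem x s hu hv]
  field_simp

lemma canonical_Ric_xi (s : Fin 3) (hu : u ∈ (ofPara3Sasakian g D ξ).H x) :
    (ofPara3Sasakian g D ξ).Ric nabla e (ξ s x) u = 0 := by
  change ∑ a, g x (e a) (e a) * curv g nabla x (e a) (ξ s x) u (e a) = 0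
  refine Finset.sum_eq_zero fun a _ ↦ ?_
  rw [h.canonical_curv hc hn, curv_swap_left,
    h.curv_canonConn_xi_left (he.1 a) hu (he.1 a), neg_zero, mul_zero]

lemma canonical_ricciForm_xi (s t : Fin 3) (hu : u ∈ (ofPara3Sasakian g D ξ).H x) :
    (ofPara3Sasakian g D ξ).ricciForm nabla e s (ξ t x) u = 0 := by
  refine mul_eq_zero_of_right _ (Finset.sum_eq_zero fun a _ ↦ ?_)
  change _ * curv g nabla x (ξ t x) u (e a) (D (ξ s) x (e a)) = 0
  rw [h.canonical_curv hc hn,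
    h.curv_canonConn_xi_left hu (he.1 a) (h.phi_mem_H x s (he.1 a)), mul_zero]

lemma canonical_zetaForm_xi (s t : Fin 3) (hu : u ∈ (ofPara3Sasakian g D ξ).H x) :
    (ofPara3Sasakian g D ξ).zetaForm nabla e s (ξ t x) u = 0 := by
  refine mul_eq_zero_of_right _ (Finset.sum_eq_zero fun a _ ↦ ?_)
  change _ * curv g nabla x (e a) (ξ t x) u (D (ξ s) x (e a)) = 0
  rw [h.canonical_curv hc hn, curv_swap_left,
    h.curv_canonConn_xi_left (he.1 a) hu (h.phi_mem_H x s (he.1 a)), neg_zero, mul_zero]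

lemma canonical_ricciForm_xi_xi (s t r : Fin 3) :
    (ofPara3Sasakian g D ξ).ricciForm nabla e s (ξ t x) (ξ r x) = 0 := by
  refine mul_eq_zero_of_right _ (Finset.sum_eq_zero fun a _ ↦ ?_)
  change _ * curv g nabla x (ξ t x) (ξ r x) (e a) (D (ξ s) x (e a)) = 0
  rw [h.canonical_curv hc hn,
    h.curv_canonConn_xi_xi (he.1 a) (h.phi_mem_H x s (he.1 a)), mul_zero]

end IsPara3Sasakian

end

end Pqc

end

theorem mainTheorem9 (n : ℕ) (hn : 1 ≤ n) {M : Type*} [TopologicalSpace M] [T2Space M]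
    [ChartedSpace (Pqc.Model n) M] [IsManifold 𝓘(ℝ, Pqc.Model n) ∞ M]
    (g : Pqc.TwoTensor n M) (D : Pqc.Connection n M) (ξ : Fin 3 → Pqc.VField n M)
    (h : Pqc.IsPara3Sasakian g D ξ) (S : Pqc.PqcData n M) (hS : S = Pqc.ofPara3Sasakian g D ξ) :
    -- `S` is a pqc structure with Reeb vector fields `ξ_s`
    S.IsPqc ∧
    -- the structure equations
    (∀ (s t : Fin 3) (x : M), (∀ X ∈ S.H x, Pqc.extDeriv₁ (S.η s) x (ξ t x) X = 0) ∧
      Pqc.extDeriv₁ (S.η s) x (ξ t x) (ξ s x) = 0) ∧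
    (∀ (i : Fin 3) (x : M),
      Pqc.extDeriv₁ (S.η i) x (ξ (i + 1) x) (ξ (i + 2) x) = -2 * Pqc.eps i) ∧
    (∀ (i : Fin 3) (x : M) (u v : TangentSpace 𝓘(ℝ, Pqc.Model n) x),
      Pqc.extDeriv₁ (S.η i) x u v
        = -2 * Pqc.eps i * S.omega i x u v
          - 2 * Pqc.eps i * Pqc.wedge₁₁ (S.η (i + 1)) (S.η (i + 2)) x u v) ∧
    (∀ (i : Fin 3) (x : M) (u v w : TangentSpace 𝓘(ℝ, Pqc.Model n) x),
      Pqc.extDeriv₂ (S.omega i) x u v w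
        = 2 * Pqc.eps (i + 1) * Pqc.wedge₂₁ (S.omega (i + 1)) (S.η (i + 2)) x u v w
          - 2 * Pqc.eps (i + 2) * Pqc.wedge₂₁ (S.omega (i + 2)) (S.η (i + 1)) x u v w) ∧
    -- the canonical connection exists and is unique
    (∃ nabla : Pqc.Connection n M, S.IsCanonical nabla) ∧
    (∀ nabla nabla' : Pqc.Connection n M, S.IsCanonical nabla → S.IsCanonical nabla' →
      ∀ (A : Pqc.VField n M) (x : M), Pqc.DiffAt A x → nabla A x = nabla' A x) ∧
    ∀ nabla : Pqc.Connection n M, S.IsCanonical nabla →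
      -- the torsion endomorphism vanishes
      (∀ (x : M), ∀ v ∈ S.V x, ∀ X ∈ S.H x, nabla.torsion x v X = 0) ∧
      (∀ (x : M), ∀ X ∈ S.H x, ∀ Y ∈ S.H x,
        S.τ nabla x X Y = 0 ∧ ∀ s, S.μ nabla s x X Y = 0) ∧
      -- pqc-Einstein
      S.IsPqcEinstein nabla ∧
      -- the Ricci-type tensors
      (∀ (x : M) (e : Fin (2 * n) ⊕ Fin (2 * n) → TangentSpace 𝓘(ℝ, Pqc.Model n) x),
        S.IsFrame x e →
          S.Scal nabla e = 16 * n * (n + 2) ∧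
          (∀ s, ∀ X ∈ S.H x, ∀ Y ∈ S.H x,
            S.ricciForm nabla e s X Y = -2 * S.omega s x X Y ∧
            S.varrhoForm nabla e s X Y = -2 * S.omega s x X Y ∧
            -2 * S.zetaForm nabla e s X Y = -2 * S.omega s x X Y) ∧
          (∀ (s t : Fin 3), ∀ X ∈ S.H x,
            S.Ric nabla e (ξ s x) X = 0 ∧
            S.ricciForm nabla e s (ξ t x) X = 0 ∧
            S.zetaForm nabla e s (ξ t x) X = 0) ∧
          ∀ s t r : Fin 3, S.ricciForm nabla e s (ξ t x) (ξ r x) = 0) ∧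
      -- the canonical curvature in terms of the Levi-Civita curvature
      ∀ x : M, ∀ Z ∈ S.H x, ∀ W ∈ S.H x,
        (∀ X ∈ S.H x, ∀ Y ∈ S.H x,
          Pqc.curv g nabla x X Y Z W = Pqc.curv g D x X Y Z W
            + ∑ s, Pqc.eps s * (S.omega s x X Z * S.omega s x Y W - S.omega s x Y Z * S.omega s x X W
                + 2 * S.omega s x X Y * S.omega s x Z W)) ∧
        (∀ s, ∀ Y ∈ S.H x,
          Pqc.curv g nabla x (ξ s x) Y Z W = 0 ∧ Pqc.curv g D x (ξ s x) Y Z W = 0) ∧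
        ∀ s t : Fin 3,
          Pqc.curv g nabla x (ξ s x) (ξ t x) Z W = 0 ∧
          Pqc.curv g D x (ξ s x) (ξ t x) Z W = 0 ∧
          Pqc.curv g D x Z W (ξ s x) (ξ t x) = 0 := by
  subst hS
  refine ⟨h.isPqc, fun s t x ↦ h.dEta_xi x s t, fun i x ↦ h.dEta_xi_xi x i,
    fun i x u v ↦ h.dEta_eq x i u v, fun i x u v w ↦ h.dOmega x i u v w,
    ⟨_, h.isCanonical_canonConn⟩, fun nabla nabla' hc hc' A x hA ↦ ?_, fun nabla hc ↦ ?_⟩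
  · rw [h.canonical_eq hc hn hA, h.canonical_eq hc' hn hA]
  refine ⟨fun x v hv X hX ↦ h.canonical_torsion_vertical hc hn hv hX,
    fun x X hX Y hY ↦ ⟨h.canonical_tau hc hn hX hY, fun s ↦ h.canonical_mu hc hn s hX hY⟩,
    fun x e he X hX Y hY ↦ ?_,
    fun x e he ↦ ⟨h.canonical_Scal hc hn he,
      fun s X hX Y hY ↦ ⟨h.canonical_ricciForm hc hn he s hX hY,
        h.canonical_varrhoForm hc hn he s hX hY, by rw [h.canonical_zetaForm hc hn he s hX hY]⟩,
      fun s t X hX ↦ ⟨h.canonical_Ric_xi hc hn he s hX, h.canonical_ricciForm_xi hc hn he s t hX,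
        h.canonical_zetaForm_xi hc hn he s t hX⟩,
      fun s t r ↦ h.canonical_ricciForm_xi_xi hc hn he s t r⟩,
    fun x Z hZ W hW ↦ ⟨fun X hX Y hY ↦ ?_, fun s Y hY ↦ ⟨?_, h.curv_xi_left hZ hW s Y⟩,
      fun s t ↦ ⟨?_, h.curv_xi_left hZ hW s _, ?_⟩⟩⟩
  · rw [h.canonical_Ric hc hn he hX hY, h.canonical_Scal hc hn he]
    change _ = _ * g x X Y
    field_simp
    ring
  · rw [h.canonical_curv hc hn, h.curv_canonConn_horizontal (.inl hX) hZ hW, Pqc.horCurv]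
    simp only [h.omega_eq_of_mem x _ hX hY, h.omega_eq_of_mem x _ hX hZ,
      h.omega_eq_of_mem x _ hY hW, h.omega_eq_of_mem x _ hY hZ, h.omega_eq_of_mem x _ hX hW,
      h.omega_eq_of_mem x _ hZ hW]
  · rw [h.canonical_curv hc hn, h.curv_canonConn_xi_left hY hZ hW]
  · rw [h.canonical_curv hc hn, h.curv_canonConn_xi_xi hZ hW]
  · rw [h.curv_pair, h.curv_xi_left hZ hW]
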